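/- Let $\mathbb K=\mathbb R$ or $\mathbb K=\mathbb C$, and let $M$ be a finite-dimensional $C^\infty$-manifold (if $\mathbb K=\mathbb R$) or a complex manifold (if $\mathbb K=\mathbb C$); "smooth" means $C^\infty$, respectively holomorphic, $\dim M$ is the dimension over $\mathbb K$, and $T^*_mM\otimes\mathbb C$ stands for $T_m^*M\otimes_{\mathbb K}\mathbb C$ (the space $\operatorname{Hom}_{\mathbb K}(T_mM,\mathbb C)$, which is $T_m^*M$ itself if $\mathbb K=\mathbb C$). Let $\{,\}_1,\{,\}_2$ be two compatible Poisson brackets on $M$, given by smooth bivector fields: $\lambda_1\{,\}_1+\lambda_2\{,\}_2$ is Poisson for all $\lambda_1,\lambda_2\in\mathbb K$. Extend the brackets by complex linearity to complex-valued smooth functions on open subsets. The pairings $(,)_a$ on $T^*_mM$, $a=1,2$, are given by $(df|_m,dg|_m)_a=\{f,g\}_a|_m$. A smooth complex-valued function $F$ on an open set is a Casimir function of a bracket if $\{F,f\}=0$ for every smooth function $f$ on every smaller open set. Functions $G_1,\dots,G_r$ on an open set $V$ are called dependent if $dG_1|_m,\dots,dG_r|_m\in T_m^*M\otimes\mathbb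 C$ are linearly dependent over $\mathbb C$ at every $m\in V$. Let $L$ be a finite set; for each $l\in L$ let $\mathcal U_l\subset\mathbb C$ be an open subset of $\mathbb C$ (or an open subset of the real line $\mathbb R\subset\mathbb C$), and let $F_{l,\lambda}$, $\lambda\in\mathcal U_l$, be smooth complex-valued functions on $M$. Suppose that for all $l\in L$ and $\lambda\in\mathcal U_l$ the function $F_{l,\lambda}$ is a Casimir function of $\lambda\{,\}_1+\{,\}_2$, and that for all $l\in L$ and $m\in M$ the differential $dF_{l,\lambda}|_m$ depends continuously on $\lambda\in\mathcal U_l$. For $m\in M$ let $W_1(m)\subset T_m^*M\otimes\mathbb C$ be the complex span of all $dF_{l,\lambda}|_m$, $l\in L$, $\lambda\in\mathcal U_l$. Suppose that for some integer $R\ge 0$ and some $m_0\in M$: 1. $\dim_{\mathbb C} W_1(m_0)\ge\frac{\dim M+R}{2}$; 2. for some $\lambda_1,\lambda_2\in\mathbb K$ the bracket $\lambda_1\{,\}_1+\lambda_2\{,\}_2$ has at most $R$ independent Casimir functions on any open subset of $M$ near $m_0$; that is, there is a neighborhood $N$ of $m_0$ such that for each open $V\subset N$ any $R+1$ complex-valued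 Casimir functions of this bracket on $V$ are dependent. Then $\dim M-R$ is even, $\dim_{\mathbb C} W_1(m_0)=\frac{\dim M+R}{2}$, and there are positive integers $t_1,\dots,t_R$ with $\sum_k t_k=\dim M$ and an open subset $U\subset M$ with $m_0$ in its closure such that the structure is homogeneous of type $(t_1,\dots,t_R)$ on $U$: all $t_k$ are odd, and for every $m\in U$ the space $T_m^*M$ with the pair of pairings $(,)_1,(,)_2$ is a direct sum (orthogonal for both pairings) of indecomposable blocks of dimensions $t_1,\dots,t_R$. Moreover, for every $m\in U$ this pair is isomorphic over $\mathbb K$ to $\bigoplus_{k=1}^R\mathcal K_{t_k}$, where the Kronecker pair $\mathcal K_{2s-1}$ has a basis $w_0,\dots,w_{2s-2}$ in which the only non-zero pairings, up to skew symmetry, are $(w_{2j},w_{2j+1})_1=1$ and $(w_{2j+1},w_{2j+2})_2=1$, $0\le j\le s-2$. -/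

import Mathlib

open scoped Manifold ContDiff

noncomputable section

namespace Bihamiltonian

section Geometry

variable {𝕜 : Type*} [RCLike 𝕜]
  {E : Type*} [NormedAddCommGroup E] [NormedSpace 𝕜 E]
  {M : Type*} [TopologicalSpace M] [ChartedSpace E M]

variable (𝕜 E) in
/-- `A`-valued covectors at `m`. For `A = 𝕜` this is the cotangent space `T*_m M`, and for `A = ℂ`
it is its complexification `T*_m M ⊗ ℂ` (which is `T*_m M` itself when `𝕜 = ℂ`). -/
abbrev Covector (A : Type*) [NormedAddCommGroup A] [NormedSpace 𝕜 A] (m : M) : Type _ :=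
  TangentSpace 𝓘(𝕜, E) m →L[𝕜] A

variable (𝕜 E) in
/-- The differential `df|_m` of a function with values in `A`. -/
def differential {A : Type*} [NormedAddCommGroup A] [NormedSpace 𝕜 A] (f : M → A) (m : M) :
    Covector 𝕜 E A m :=
  mfderiv 𝓘(𝕜, E) 𝓘(𝕜, A) f m

variable (𝕜 E) in
/-- Smooth functions on a set `V`, with values in `A` (holomorphic functions if `𝕜 = ℂ`). -/
def SmoothOn {A : Type*} [NormedAddCommGroup A] [NormedSpace 𝕜 A] (f : M → A) (V : Set M) : Prop :=
  ContMDiffOn 𝓘(𝕜, E) 𝓘(𝕜, A) ∞ f V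

variable (𝕜 E M) in
/-- A field of contravariant tensors of valence 2, written as a field of maps `T*_m M → T_m M`.
Skew-symmetry and smoothness are part of `IsPoisson`. -/
abbrev TensorField : Type _ :=
  ∀ m : M, Covector 𝕜 E 𝕜 m →ₗ[𝕜] TangentSpace 𝓘(𝕜, E) m

/-- The bilinear pairing `(α, β) = α (P β)` on `T*_m M`. -/
def pairing (P : TensorField 𝕜 E M) (m : M) : LinearMap.BilinForm 𝕜 (Covector 𝕜 E 𝕜 m) :=
  LinearMap.mk₂ 𝕜 (fun α β => α (P m β)) (fun _ _ _ => rfl) (fun _ _ _ => rfl)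
    (fun _ _ _ => by simp only [map_add]) (fun _ _ _ => by simp only [map_smul])

/-- The bracket `{f, g}|_m = (df|_m, dg|_m)`. The first argument may also be complex-valued:
this is the extension of the bracket by complex linearity. -/
def bracket (P : TensorField 𝕜 E M) {A : Type*} [NormedAddCommGroup A] [NormedSpace 𝕜 A]
    (f : M → A) (g : M → 𝕜) (m : M) : A :=
  differential 𝕜 E f m (P m (differential 𝕜 E g m))

/-- `P` is a smooth bivector field whose bracket is a Poisson bracket. Functions are taken on
arbitrary open subsets, since on a complex manifold there may be few global ones. -/
structure IsPoisson (P : TensorField 𝕜 E M) : Prop where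
  skew : ∀ (m : M) (α β : Covector 𝕜 E 𝕜 m), pairing P m α β = - pairing P m β α
  smooth : ∀ V : Set M, IsOpen V → ∀ f g : M → 𝕜, SmoothOn 𝕜 E f V → SmoothOn 𝕜 E g V →
    SmoothOn 𝕜 E (bracket P f g) V
  jacobi : ∀ V : Set M, IsOpen V → ∀ f g h : M → 𝕜,
    SmoothOn 𝕜 E f V → SmoothOn 𝕜 E g V → SmoothOn 𝕜 E h V → ∀ m ∈ V,
      bracket P f (bracket P g h) m + bracket P g (bracket P h f) m
        + bracket P h (bracket P f g) m = 0

/-- Two Poisson brackets all of whose linear combinations are Poisson. -/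
def IsBihamiltonian (P₁ P₂ : TensorField 𝕜 E M) : Prop :=
  IsPoisson P₁ ∧ IsPoisson P₂ ∧ ∀ a b : 𝕜, IsPoisson (a • P₁ + b • P₂)

variable [NormedAlgebra 𝕜 ℂ]

/-- The complex-valued smooth function `F` on the open set `V` is a Casimir function of
`a {,}₁ + b {,}₂`, where `a` and `b` are complex numbers. -/
def IsCasimirOn (P₁ P₂ : TensorField 𝕜 E M) (a b : ℂ) (F : M → ℂ) (V : Set M) : Prop :=
  SmoothOn 𝕜 E F V ∧
    ∀ V' : Set M, IsOpen V' → V' ⊆ V → ∀ g : M → 𝕜, SmoothOn 𝕜 E g V' → ∀ m ∈ V',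
      a * bracket P₁ F g m + b * bracket P₂ F g m = 0

variable (𝕜 E) in
/-- Functional dependence on `V`: the differentials are linearly dependent over `ℂ` at every
point of `V`. -/
def DependentOn {r : ℕ} (G : Fin r → M → ℂ) (V : Set M) : Prop :=
  ∀ m ∈ V, ¬ LinearIndependent ℂ (fun i => differential 𝕜 E (G i) m)

/-- Near `m₀`, the bracket `a {,}₁ + b {,}₂` has at most `R` independent Casimir functions on any
open subset. -/
def AtMostIndependentCasimirsNear (P₁ P₂ : TensorField 𝕜 E M) (a b : ℂ) (R : ℕ) (m₀ : M) : Prop :=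
  ∃ N : Set M, IsOpen N ∧ m₀ ∈ N ∧ ∀ V : Set M, IsOpen V → V ⊆ N →
    ∀ G : Fin (R + 1) → M → ℂ, (∀ i, IsCasimirOn P₁ P₂ a b (G i) V) → DependentOn 𝕜 E G V

variable (𝕜 E) in
/-- The complex span `W₁(m)` of the differentials at `m` of all the functions `F l z`, `z ∈ U l`. -/
def spanDifferentials {L : Type*} (U : L → Set ℂ) (F : L → ℂ → M → ℂ) (m : M) :
    Submodule ℂ (Covector 𝕜 E ℂ m) :=
  Submodule.span ℂ {w | ∃ l, ∃ z ∈ U l, w = differential 𝕜 E (F l z) m}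

end Geometry

section LinearAlgebra

variable {𝕜 : Type*} [Field 𝕜] {W : Type*} [AddCommGroup W] [Module 𝕜 W]

/-- `A` and `B` are orthogonal with respect to both forms (which are skew-symmetric in all uses). -/
def Orthogonal₂ (b₁ b₂ : LinearMap.BilinForm 𝕜 W) (A B : Submodule 𝕜 W) : Prop :=
  ∀ x ∈ A, ∀ y ∈ B, b₁ x y = 0 ∧ b₂ x y = 0

/-- The restriction of the pair of forms to the subspace `S` is indecomposable. -/
def IsIndecomposableBlock (b₁ b₂ : LinearMap.BilinForm 𝕜 W) (S : Submodule 𝕜 W) : Prop :=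
  S ≠ ⊥ ∧ ∀ A B : Submodule 𝕜 W, A ⊔ B = S → Disjoint A B → Orthogonal₂ b₁ b₂ A B →
    A = ⊥ ∨ B = ⊥

/-- The pair of forms decomposes into a direct sum of indecomposable blocks of odd dimensions
`t 0, …, t (R - 1)`. -/
def DecomposesWithType {R : ℕ} (b₁ b₂ : LinearMap.BilinForm 𝕜 W) (t : Fin R → ℕ) : Prop :=
  ∃ S : Fin R → Submodule 𝕜 W, DirectSum.IsInternal S ∧
    (∀ i j, i ≠ j → Orthogonal₂ b₁ b₂ (S i) (S j)) ∧
    ∀ i, Odd (t i) ∧ Module.finrank 𝕜 (S i) = t i ∧ IsIndecomposableBlock b₁ b₂ (S i)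

variable (𝕜) in
/-- First form of the Kronecker pair: `(w_{2l}, w_{2l+1})₁ = 1`, extended skew-symmetrically,
other pairings being zero. -/
def kronecker₁ (p q : ℕ) : 𝕜 :=
  if Even p ∧ q = p + 1 then 1 else if Even q ∧ p = q + 1 then -1 else 0

variable (𝕜) in
/-- Second form of the Kronecker pair: `(w_{2l+1}, w_{2l+2})₂ = 1`, extended skew-symmetrically,
other pairings being zero. -/
def kronecker₂ (p q : ℕ) : 𝕜 :=
  if Odd p ∧ q = p + 1 then 1 else if Odd q ∧ p = q + 1 then -1 else 0

/-- The pair of forms is isomorphic to the direct sum of the Kronecker pairs of odd dimensions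
`t 0, …, t (R - 1)`. -/
def IsKroneckerSum {R : ℕ} (b₁ b₂ : LinearMap.BilinForm 𝕜 W) (t : Fin R → ℕ) : Prop :=
  (∀ i, Odd (t i)) ∧
    ∃ e : Module.Basis (Σ i : Fin R, Fin (t i)) 𝕜 W,
      ∀ x y : (Σ i : Fin R, Fin (t i)),
        b₁ (e x) (e y) = (if x.1 = y.1 then kronecker₁ 𝕜 x.2 y.2 else 0) ∧
        b₂ (e x) (e y) = (if x.1 = y.1 then kronecker₂ 𝕜 x.2 y.2 else 0)

end LinearAlgebra

/-- The structure is homogeneous of type `t` on `U`: at every `m ∈ U` the pair of pairings on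
`T*_m M` decomposes into indecomposable blocks of the odd dimensions `t k`. -/
def IsHomogeneousOn {𝕜 : Type*} [RCLike 𝕜]
    {E : Type*} [NormedAddCommGroup E] [NormedSpace 𝕜 E]
    {M : Type*} [TopologicalSpace M] [ChartedSpace E M]
    (P₁ P₂ : TensorField 𝕜 E M) {R : ℕ} (t : Fin R → ℕ) (U : Set M) : Prop :=
  ∀ m ∈ U, DecomposesWithType (pairing P₁ m) (pairing P₂ m) t

end Bihamiltonian

end

section Auxiliary

open Module

universe u v

/-! Fix a point, write b₁, b₂ for the two pairings and X for the complex span W₁. The differential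
of a Casimir function at parameter z lies in the kernel of z b₁ + b₂. Subtracting the relations of
two such vectors with parameters z ≠ z' gives (z - z') b₁ = 0 on them, hence b₂ = 0 too; continuity
in the parameter covers z = z'. So X is isotropic for both forms, hence for c = a b₁ + b b₂, and 2
dim X ≤ dim M + corank c. Where the rank of c is locally constant, Frobenius' theorem yields corank
c independent Casimir functions, so corank c ≤ R (`finrank_ker_le_of_casimirs`). Together with
condition 1 the bound is attained.

Attaining the bound forces Kronecker type (`exists_kronecker_basis_of_isotropic`). Both b₁ and b₂
then map X onto its annihilator, and X is the extension of scalars of the least subspace W closed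
under S ↦ b₂⁻¹(b₁ S), which lives over the base field. Minimality of W splits the pencil from W to
its annihilator into chains (`exists_chain_family_of_surjective`). Vectors dual to the chains,
corrected so as to span an isotropic complement, complete them to a Kronecker basis with 2 dim W -
dim M = R blocks (`exists_kronecker_basis_of_chains`).

To pass from points to an open set, note that condition 1 is open in m, being carried by finitely
many differentials. Ranks are lower semicontinuous, so on a dense open set the rank of c is locally
constant, and so are the ranks of multiplication by λ b₁ + b₂ on polynomials of bounded degree; the
latter determine the block sizes up to order. Only finitely many types are possible, so m₀ is in the
closure of an open set with a single type (`exists_isKroneckerSum_constant_type`).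

Frobenius' theorem is needed in the real and the holomorphic setting at once. It is obtained from
the inverse function theorem applied to an integral equation in C([0,1], E): time is real, while the
parameters range over a space over 𝕜, so smooth dependence on them has the right meaning in both
cases. -/

/-! ### Chains in a pencil of linear maps -/

/-- Induction on dim Z. With I = T₁(ker T₂), the pair (W, Z) is replaced by (Z, Z/I); the hypothesis
on S passes to the quotient and, with S = 0, gives I ≠ 0. Each chain of the smaller pair lifts to a
chain one step longer, and ker T₁ ∩ ker T₂ supplies chains of length one. -/
theorem exists_chain_family {K : Type*} [Field K] (p : ℕ) :
    ∀ (W Z : Type u) [AddCommGroup W] [Module K W] [FiniteDimensional K W]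
      [AddCommGroup Z] [Module K Z] [FiniteDimensional K Z] (T₁ T₂ : W →ₗ[K] Z),
      finrank K Z = p → Function.Surjective T₂ →
      (∀ S : Submodule K Z, (S.comap T₂).map T₁ ≤ S → S = ⊤) →
      ∃ (ι : Type) (_ : Fintype ι) (d : ι → ℕ) (n : ι → ℕ → W),
        (∀ k j, d k < j → n k j = 0) ∧ (∀ k, T₂ (n k 0) = 0) ∧
        (∀ k j, T₁ (n k j) + T₂ (n k (j + 1)) = 0) ∧
        LinearIndependent K (fun q : Σ k, Fin (d k + 1) => n q.1 q.2) ∧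
        LinearIndependent K (fun q : Σ k, Fin (d k) => T₂ (n q.1 (q.2 + 1))) ∧
        ∑ k, (d k + 1) = finrank K W ∧ ∑ k, d k = finrank K Z := by
  induction p using Nat.strong_induction_on with
  | _ p ih =>
    intro W Z _ _ _ _ _ _ T₁ T₂ hp hsurj hC
    classical
    by_cases hZ : p = 0
    · have hZ0 : finrank K Z = 0 := by rw [hp, hZ]
      have : Subsingleton Z := finrank_zero_iff.mp hZ0
      refine ⟨Fin (finrank K W), inferInstance, fun _ => 0,
        fun k j => if j = 0 then finBasis K W k else 0, ?_, ?_, ?_, ?_, ?_, ?_, ?_⟩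
      · intro k j h; simp [Nat.pos_iff_ne_zero.mp h]
      · intro k; exact Subsingleton.elim _ _
      · intro k j; exact Subsingleton.elim _ _
      · have h := (finBasis K W).linearIndependent
        have h2 := h.comp (fun q : Σ _ : Fin (finrank K W), Fin (0 + 1) => q.1) (by
          rintro ⟨a, x⟩ ⟨b, y⟩ hab
          obtain rfl : a = b := hab
          congr 1
          exact Subsingleton.elim (α := Fin 1) x y)
        convert h2 using 1
        funext q
        simp
      · have : IsEmpty (Σ _ : Fin (finrank K W), Fin 0) := ⟨fun q => q.2.elim0⟩
        exact linearIndependent_empty_type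
      · simp
      · simp [hZ0]
    · set N := LinearMap.ker T₂ with hN
      set I := N.map T₁ with hI
      have hIne : I ≠ ⊥ := by
        intro h0
        have h1 : (⊥ : Submodule K Z) = ⊤ := hC ⊥ (by
          rw [← LinearMap.ker.eq_1]; exact h0.le)
        have : finrank K Z = 0 := by
          rw [← finrank_top K Z, ← h1, finrank_bot]
        omega
      have hIpos : 0 < finrank K I := by
        rw [Nat.pos_iff_ne_zero]
        intro h; exact hIne (Submodule.finrank_eq_zero.mp h)
      have hq : finrank K (Z ⧸ I) + finrank K I = finrank K Z := I.finrank_quotient_add_finrank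
      obtain ⟨g, hg⟩ := T₂.exists_rightInverse_of_surjective (LinearMap.range_eq_top.mpr hsurj)
      have hg' : ∀ z, T₂ (g z) = z := fun z => LinearMap.congr_fun hg z
      have hker : ∀ w, T₂ w = 0 → T₁ w ∈ I := fun w hw => ⟨w, hw, rfl⟩
      -- Modulo I, the map T₁ ∘ T₂⁻¹ does not depend on the right inverse g.
      obtain ⟨ι, _, d, z, hz0, hzk, hzr, hzli, -, hzc, hzc'⟩ :=
        ih (finrank K (Z ⧸ I)) (by omega) Z (Z ⧸ I) (I.mkQ ∘ₗ T₁ ∘ₗ g) I.mkQ rfl I.mkQ_surjective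
        (by
          intro S hS
          have h1 := hC (S.comap I.mkQ) (by
            rintro _ ⟨w, hw, rfl⟩
            have h2 : (I.mkQ ∘ₗ T₁ ∘ₗ g) (T₂ w) ∈ S := hS ⟨T₂ w, hw, rfl⟩
            have h3 : I.mkQ (T₁ (g (T₂ w))) = I.mkQ (T₁ w) := by
              simp only [Submodule.mkQ_apply]
              rw [Submodule.Quotient.eq, ← map_sub]
              exact hker _ (by simp [hg'])
            change I.mkQ (T₁ w) ∈ S
            rw [← h3]; exact h2)
          rw [eq_top_iff]
          intro x _
          obtain ⟨y, rfl⟩ := I.mkQ_surjective x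
          have : y ∈ S.comap I.mkQ := h1 ▸ Submodule.mem_top
          exact this)
      -- adjustment of lifts
      have hlift0 : ∀ k, ∃ w, T₂ w = 0 ∧ T₁ w + z k 0 = 0 := by
        intro k
        have h1 : z k 0 ∈ I := by simpa using hzk k
        obtain ⟨w, hw, hw'⟩ := h1
        have hw0 : T₂ w = 0 := hw
        exact ⟨-w, by simp [hw0], by simp [hw']⟩
      have hlift : ∀ k j, ∃ w, T₂ w = z k j ∧ T₁ w + z k (j + 1) = 0 := by
        intro k j
        have h1 : T₁ (g (z k j)) + z k (j + 1) ∈ I := by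
          have := hzr k j
          rw [← Submodule.Quotient.mk_eq_zero]
          simpa using this
        obtain ⟨w, hw, hw'⟩ := h1
        have hw0 : T₂ w = 0 := hw
        refine ⟨g (z k j) - w, by simp [hg', hw0], ?_⟩
        rw [map_sub, hw']; abel
      choose n0 hn0 hn0' using hlift0
      choose n1 hn1 hn1' using hlift
      let N' := N ⊓ LinearMap.ker T₁
      let bN := finBasis K N'
      -- The lifts satisfy T₂ n₀ = 0, T₂ n_{j+1} = z_j and T₁ n_j = -z_j. The value 0 beyond d + 1
      -- is consistent because z vanishes beyond d.
      let n : ι ⊕ Fin (finrank K N') → ℕ → W :=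
        Sum.elim (fun k j => if d k + 1 < j then 0 else Nat.casesOn j (n0 k) (fun i => n1 k i))
          (fun k j => if j = 0 then (bN k : W) else 0)
      have hT2z : ∀ k j, T₂ (n (Sum.inl k) (j + 1)) = z k j := by
        intro k j
        by_cases h : d k < j
        · simp [n, h, hz0 k j h]
        · simp [n, h, hn1]
      have hT1z : ∀ k j, T₁ (n (Sum.inl k) j) = - z k j := by
        intro k j
        by_cases h : d k + 1 < j
        · simp [n, h, hz0 k j (by omega)]
        · cases j with
          | zero => simpa [n] using eq_neg_of_add_eq_zero_left (hn0' k)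
          | succ j =>
            have h' : ¬ d k < j := by omega
            simpa [n, h'] using eq_neg_of_add_eq_zero_left (hn1' k j)
      have hT2zero : ∀ k, T₂ (n (Sum.inl k) 0) = 0 := by
        intro k; simp [n, hn0]
      refine ⟨ι ⊕ Fin (finrank K N'), inferInstance, Sum.elim (fun k => d k + 1) (fun _ => 0),
        n, ?_, ?_, ?_, ?_, ?_, ?_, ?_⟩
      · rintro (k | k) j hj
        · simp at hj; simp [n, hj]
        · simp at hj; simp [n, Nat.pos_iff_ne_zero.mp hj]
      · rintro (k | k)
        · exact hT2zero k
        · have : T₂ (bN k : W) = 0 := (bN k).2.1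
          simpa [n] using this
      · rintro (k | k) j
        · rw [hT2z, hT1z]; simp
        · have : T₁ (bN k : W) = 0 := (bN k).2.2
          rcases j with _ | j
          · simpa [n] using this
          · simp [n]
      · rw [Fintype.linearIndependent_iff]
        intro c hc
        rw [Fintype.sum_sigma, Fintype.sum_sum_type] at hc
        have hc' : (∑ k : ι, (c ⟨Sum.inl k, (0 : Fin (d k + 1 + 1))⟩ • n (Sum.inl k) 0 +
            ∑ j : Fin (d k + 1), c ⟨Sum.inl k, (j.succ : Fin (d k + 1 + 1))⟩ •
              n (Sum.inl k) (j + 1))) +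
            ∑ k : Fin (finrank K N'), c ⟨Sum.inr k, (0 : Fin (0 + 1))⟩ • (bN k : W) = 0 := by
          rw [← hc]
          congr 1
          · refine Finset.sum_congr rfl fun k _ => ?_
            exact (Fin.sum_univ_succ (n := d k + 1) (fun j => c ⟨Sum.inl k, j⟩ •
              n (Sum.inl k) j)).symm
          · refine Finset.sum_congr rfl fun k _ => ?_
            exact (Fin.sum_univ_one (fun j : Fin 1 => c ⟨Sum.inr k, j⟩ •
              n (Sum.inr k) j)).symm
        have hbT1 : ∀ k, T₁ (bN k : W) = 0 := fun k => (bN k).2.2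
        have hbT2 : ∀ k, T₂ (bN k : W) = 0 := fun k => (bN k).2.1
        -- T₂ kills the heads and the vectors of N' and sends the remaining chain vectors to the
        -- independent z, so only head and N' coefficients survive.
        have h2 := congrArg T₂ hc'
        simp only [map_add, map_sum, map_smul, hT2zero, hT2z, hbT2, smul_zero, zero_add,
          Finset.sum_const_zero, add_zero, map_zero] at h2
        have h3 := Fintype.linearIndependent_iff.mp hzli
          (fun q => c ⟨Sum.inl q.1, (q.2.succ : Fin (d q.1 + 1 + 1))⟩)
          (by rw [Fintype.sum_sigma]; exact h2)
        have h3' : ∀ k (j : Fin (d k + 1)), c ⟨Sum.inl k, (j.succ : Fin (d k + 1 + 1))⟩ = 0 :=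
          fun k j => h3 ⟨k, j⟩
        -- T₁ sends the heads to -z k 0, which are independent, and kills N'.
        have h1 := congrArg T₁ hc'
        simp only [h3', zero_smul, Finset.sum_const_zero, add_zero, map_add, map_sum, map_smul,
          hT1z, hbT1, smul_zero, map_zero] at h1
        have h4 := Fintype.linearIndependent_iff.mp hzli
          (fun q => if q.2 = 0 then - c ⟨Sum.inl q.1, (0 : Fin (d q.1 + 1 + 1))⟩ else 0)
          (by
            rw [Fintype.sum_sigma, ← h1]
            refine Finset.sum_congr rfl fun k _ => ?_
            rw [Finset.sum_eq_single 0] <;> simp +contextual)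
        have h4' : ∀ k, c ⟨Sum.inl k, (0 : Fin (d k + 1 + 1))⟩ = 0 := by
          intro k
          have := h4 ⟨k, 0⟩
          simpa using this
        simp only [h3', h4', zero_smul, Finset.sum_const_zero, zero_add] at hc'
        have h5 : ∑ k : Fin (finrank K N'), c ⟨Sum.inr k, (0 : Fin (0 + 1))⟩ • bN k = 0 := by
          apply Subtype.ext
          rw [AddSubmonoidClass.coe_finsetSum]
          exact hc'
        have h6 := Fintype.linearIndependent_iff.mp bN.linearIndependent _ h5
        rintro ⟨k | k, j⟩
        · induction j using Fin.cases with
          | zero => exact h4' k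
          | succ j => exact h3' k j
        · have : j = (0 : Fin (0 + 1)) := Subsingleton.elim (α := Fin 1) _ _
          rw [this]; exact h6 k
      · rw [Fintype.linearIndependent_iff]
        intro c hc
        rw [Fintype.sum_sigma, Fintype.sum_sum_type] at hc
        have h3 := Fintype.linearIndependent_iff.mp hzli (fun q => c ⟨Sum.inl q.1, q.2⟩)
          (by
            rw [Fintype.sum_sigma, ← hc]
            simp only [hT2z]
            refine (add_eq_left.mpr ?_).symm
            exact Finset.sum_eq_zero fun k _ => Finset.sum_eq_zero fun j _ => j.elim0)
        rintro ⟨k | k, j⟩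
        · exact h3 ⟨k, j⟩
        · exact j.elim0
      -- T₁ maps ker T₂ onto I with kernel N', and the difference of the two sums for the smaller
      -- pair gives card ι = dim I.
      · have e1 := LinearMap.finrank_range_add_finrank_ker T₂
        rw [LinearMap.range_eq_top.mpr hsurj, finrank_top] at e1
        have e2 := LinearMap.finrank_range_add_finrank_ker (T₁.domRestrict N)
        rw [LinearMap.range_domRestrict] at e2
        have e3 : finrank K (LinearMap.ker (T₁.domRestrict N)) = finrank K N' := by
          rw [LinearMap.ker_domRestrict]
          have e0 := (Submodule.comapSubtypeEquivOfLe (p := N') (q := N) inf_le_left).finrank_eq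
          rw [← e0, Submodule.comap_inf, Submodule.comap_subtype_self, top_inf_eq]
        have e4 : ∑ k, (d k + 1) = ∑ k, d k + Fintype.card ι := by
          simp [Finset.sum_add_distrib]
        have e5 : ∑ k, (d k + 1 + 1) = ∑ k, d k + 2 * Fintype.card ι := by
          simp [Finset.sum_add_distrib, add_assoc, mul_comm]
        simp only [Fintype.sum_sum_type, Sum.elim_inl, Sum.elim_inr,
          Finset.sum_const, Finset.card_univ, smul_eq_mul, mul_one, Fintype.card_fin, zero_add]
        change finrank K I + _ = _ at e2
        change _ + finrank K N = _ at e1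
        omega
      · simp only [Fintype.sum_sum_type, Sum.elim_inl, Sum.elim_inr, Finset.sum_const_zero,
          add_zero]
        exact hzc

/-! ### From chains to a Kronecker basis -/

/-- A functional vanishing on the image of V in K^ι is a linear relation among the f i, so the joint
map is onto. -/
theorem exists_dual_vectors {K V ι : Type*} [Field K] [AddCommGroup V] [Module K V]
    [Fintype ι] [DecidableEq ι] {f : ι → V →ₗ[K] K} (hf : LinearIndependent K f) :
    ∃ v : ι → V, ∀ i j, f i (v j) = if i = j then 1 else 0 := by
  have hs : Function.Surjective (LinearMap.pi f) := by
    rw [← LinearMap.dualMap_injective_iff, injective_iff_map_eq_zero]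
    intro φ hφ
    have h1 : ∑ i, φ (Pi.single i 1) • f i = 0 := by
      ext x
      have := LinearMap.congr_fun hφ x
      rw [LinearMap.dualMap_apply, ← Finset.univ_sum_single (LinearMap.pi f x), map_sum] at this
      simp only [LinearMap.zero_apply] at this
      rw [LinearMap.zero_apply, ← this, LinearMap.sum_apply]
      refine Finset.sum_congr rfl fun i _ => ?_
      have h : (Pi.single i (LinearMap.pi f x i) : ι → K) = f i x • Pi.single i 1 := by
        rw [← Pi.single_smul]; simp
      rw [h, map_smul, LinearMap.smul_apply, smul_eq_mul, smul_eq_mul, mul_comm]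
    have h2 := Fintype.linearIndependent_iff.mp hf _ h1
    refine LinearMap.pi_ext' fun i => ?_
    ext
    simpa using h2 i
  choose v hv using fun j => hs (Pi.single j 1)
  refine ⟨v, fun i j => ?_⟩
  have := congrFun (hv j) i
  simpa [Pi.single_apply] using this

/-- Coefficients solving, for given `c₁`, `c₂`, the recursion that makes the complement isotropic. -/
def correction {K : Type*} [Field K] (D : ℕ) (c₁ c₂ : ℕ → ℕ → K) : ℕ → ℕ → K
  | 0, _ => 0
  | j + 1, i => c₂ i j + if i + 1 < D then correction D c₁ c₂ j (i + 1) + c₁ (i + 1) j else 0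

/-- If φ k i l j and φ l j k i are treated as separate unknowns X and Y, both equations become a
recursion in j that starts from X = 0. Since c₁ and c₂ are skew, exchanging the two index pairs
gives another solution; the mean of the two has Y equal to the transpose of X, which is why 2 must
be invertible. -/
theorem exists_correction {K ι : Type*} [Field K] (h2 : (2 : K) ≠ 0) (d : ι → ℕ)
    (c₁ c₂ : ι → ℕ → ι → ℕ → K) (h₁ : ∀ k i l j, c₁ k i l j = - c₁ l j k i)
    (h₂ : ∀ k i l j, c₂ k i l j = - c₂ l j k i) :
    ∃ φ : ι → ℕ → ι → ℕ → K, ∀ k i l j, i < d k → j < d l →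
      φ k i l j - φ l j k i = - c₁ k i l j ∧ φ k i l (j + 1) - φ l j k (i + 1) = c₂ k i l j := by
  let X : ι → ι → ℕ → ℕ → K := fun k l =>
    correction (d k) (fun i j => c₁ k i l j) (fun i j => c₂ k i l j)
  -- For i ≥ d k the first equation imposes nothing, so Y is free there and is set to 0.
  let Y : ι → ι → ℕ → ℕ → K := fun k l j i => if i < d k then X k l j i + c₁ k i l j else 0
  have hX : ∀ k l j i, X k l (j + 1) i = c₂ k i l j + Y k l j (i + 1) := fun _ _ _ _ => rfl
  refine ⟨fun k i l j => (X k l j i + Y l k i j) / 2, fun k i l j hi hj => ⟨?_, ?_⟩⟩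
  · have e1 : Y k l j i = X k l j i + c₁ k i l j := if_pos hi
    have e2 : Y l k i j = X l k i j + c₁ l j k i := if_pos hj
    simp only
    rw [e1, e2, h₁ l j k i]
    field_simp
    ring
  · simp only
    rw [hX, hX, h₂ l j k i]
    field_simp
    ring

open Bihamiltonian in
-- The two families interleave: w_{2i} is n i and w_{2i+1} is v i.
theorem exists_kronecker_basis_of_dual_chains {K V ι : Type*} [Field K] [AddCommGroup V]
    [Module K V] [FiniteDimensional K V] [Fintype ι] [DecidableEq ι]
    (b₁ b₂ : LinearMap.BilinForm K V)
    (sk₁ : ∀ x y, b₁ x y = - b₁ y x) (sk₂ : ∀ x y, b₂ x y = - b₂ y x)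
    (d : ι → ℕ) (n v : ι → ℕ → V)
    (iso₁ : ∀ k i l j, b₁ (n k i) (n l j) = 0) (iso₂ : ∀ k i l j, b₂ (n k i) (n l j) = 0)
    (li : LinearIndependent K (fun q : Σ k, Fin (d k + 1) => n q.1 q.2))
    (hN₁ : ∀ k i l j, j < d l → b₁ (n k i) (v l j) = if k = l ∧ i = j then 1 else 0)
    (hN₂ : ∀ k i l j, j < d l → b₂ (n k i) (v l j) = if k = l ∧ i = j + 1 then -1 else 0)
    (isv₁ : ∀ k i l j, i < d k → j < d l → b₁ (v k i) (v l j) = 0)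
    (isv₂ : ∀ k i l j, i < d k → j < d l → b₂ (v k i) (v l j) = 0)
    (hcard : ∑ k, (2 * d k + 1) = finrank K V) :
    ∃ e : Basis (Σ k, Fin (2 * d k + 1)) K V, ∀ x y,
      b₁ (e x) (e y) = (if x.1 = y.1 then kronecker₁ K x.2 y.2 else 0) ∧
      b₂ (e x) (e y) = (if x.1 = y.1 then kronecker₂ K x.2 y.2 else 0) := by
  let e : (Σ k, Fin (2 * d k + 1)) → V := fun x =>
    if Even (x.2 : ℕ) then n x.1 (x.2 / 2) else v x.1 (x.2 / 2)
  have he0 : ∀ x : (Σ k, Fin (2 * d k + 1)), ∀ i, (x.2 : ℕ) = 2 * i → e x = n x.1 i := by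
    intro x i h; simp [e, h]
  have he1 : ∀ x : (Σ k, Fin (2 * d k + 1)), ∀ i, (x.2 : ℕ) = 2 * i + 1 → e x = v x.1 i := by
    intro x i h
    have h3 : (2 * i + 1) / 2 = i := by omega
    simp [e, h, h3]
  have hli : LinearIndependent K e := by
    rw [Fintype.linearIndependent_iff]
    intro c hc
    -- Pairing the relation with n under b₁ isolates the coefficient of the dual vector v; what
    -- remains is a relation among the n.
    have hodd : ∀ x : (Σ k, Fin (2 * d k + 1)), ∀ i, (x.2 : ℕ) = 2 * i + 1 → c x = 0 := by
      intro x i hx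
      have h1 := congrArg (b₁ (n x.1 i)) hc
      rw [map_sum, map_zero, Finset.sum_eq_single x] at h1
      · have := x.2.2
        rw [map_smul, he1 x i hx, hN₁ _ _ _ _ (by omega)] at h1
        simpa using h1
      · intro y _ hy
        rw [map_smul]
        obtain ⟨j, hj | hj⟩ := Nat.even_or_odd' (y.2 : ℕ)
        · rw [he0 y j hj, iso₁, smul_zero]
        · have := y.2.2
          rw [he1 y j hj, hN₁ _ _ _ _ (by omega), if_neg, smul_zero]
          rintro ⟨h3, h4⟩
          apply hy
          obtain ⟨k, p⟩ := x
          obtain ⟨l, q⟩ := y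
          obtain rfl : k = l := h3
          congr 1
          apply Fin.ext
          simp only at hx hj
          omega
      · simp
    let ev : (Σ k, Fin (d k + 1)) → (Σ k, Fin (2 * d k + 1)) := fun q =>
      ⟨q.1, ⟨2 * q.2, by have := q.2.2; omega⟩⟩
    have hev : Function.Injective ev := by
      rintro ⟨k, p⟩ ⟨l, q⟩ h
      obtain rfl : k = l := congrArg Sigma.fst h
      have := eq_of_heq (Sigma.mk.inj h).2
      congr 1
      apply Fin.ext
      have := Fin.ext_iff.mp this
      simp only at this
      omega
    have hev' : ∀ x : (Σ k, Fin (2 * d k + 1)), ∀ i, (x.2 : ℕ) = 2 * i → ∃ q, ev q = x := by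
      rintro ⟨k, x⟩ i hi
      have := x.2
      refine ⟨⟨k, ⟨i, by simp only at hi; omega⟩⟩, ?_⟩
      simp only [ev]
      congr 1
      exact Fin.ext hi.symm
    have h4 : ∑ q, c (ev q) • n q.1 q.2 = 0 := by
      rw [← hc]
      refine Fintype.sum_of_injective ev hev _ _ ?_ ?_
      · intro x hx
        obtain ⟨j, hj | hj⟩ := Nat.even_or_odd' (x.2 : ℕ)
        · exact absurd (hev' x j hj) hx
        · rw [hodd x j hj, zero_smul]
      · intro q
        rw [he0 (ev q) q.2 rfl]
    have h5 := Fintype.linearIndependent_iff.mp li _ h4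
    intro x
    obtain ⟨j, hj | hj⟩ := Nat.even_or_odd' (x.2 : ℕ)
    · obtain ⟨q, rfl⟩ := hev' x j hj
      exact h5 q
    · exact hodd x j hj
  have hcard' : Fintype.card (Σ k, Fin (2 * d k + 1)) = finrank K V := by
    rw [← hcard]; simp
  by_cases hne : Nonempty (Σ k, Fin (2 * d k + 1))
  swap
  · have : IsEmpty (Σ k, Fin (2 * d k + 1)) := not_nonempty_iff.mp hne
    have : Subsingleton V := by
      apply (finrank_zero_iff (R := K)).mp
      rw [← hcard']; exact Fintype.card_eq_zero
    exact ⟨Basis.empty V, fun x => isEmptyElim x⟩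
  refine ⟨basisOfLinearIndependentOfCardEqFinrank hli hcard', fun x y => ?_⟩
  rw [coe_basisOfLinearIndependentOfCardEqFinrank]
  have hx := x.2.2
  have hy := y.2.2
  obtain ⟨i, hi | hi⟩ := Nat.even_or_odd' (x.2 : ℕ) <;>
  obtain ⟨j, hj | hj⟩ := Nat.even_or_odd' (y.2 : ℕ)
  · rw [he0 x i hi, he0 y j hj, iso₁, iso₂, kronecker₁, kronecker₂, hi, hj]
    constructor <;> split_ifs <;> grind
  · rw [he0 x i hi, he1 y j hj, hN₁ _ _ _ _ (by omega), hN₂ _ _ _ _ (by omega), kronecker₁,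
      kronecker₂, hi, hj]
    constructor <;> split_ifs <;> grind
  · rw [he1 x i hi, he0 y j hj, sk₁, sk₂, hN₁ _ _ _ _ (by omega), hN₂ _ _ _ _ (by omega),
      kronecker₁, kronecker₂, hi, hj]
    constructor <;> split_ifs <;> grind
  · rw [he1 x i hi, he1 y j hj, isv₁ _ _ _ _ (by omega) (by omega),
      isv₂ _ _ _ _ (by omega) (by omega), kronecker₁, kronecker₂, hi, hj]
    constructor <;> split_ifs <;> grind

open Bihamiltonian in
-- Vectors v dual to the functionals b₁ (n k i) have the right pairings with the chains under b₁,
-- and also under b₂ because b₂ (n k (i+1)) = -b₁ (n k i). Only the pairings among the v themselves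
-- have to be repaired.
theorem exists_kronecker_basis_of_chains {K V ι : Type*} [Field K] (two_ne : (2 : K) ≠ 0)
    [AddCommGroup V] [Module K V] [FiniteDimensional K V] [Fintype ι] [DecidableEq ι]
    (b₁ b₂ : LinearMap.BilinForm K V)
    (sk₁ : ∀ x y, b₁ x y = - b₁ y x) (sk₂ : ∀ x y, b₂ x y = - b₂ y x)
    (d : ι → ℕ) (n : ι → ℕ → V) (hn : ∀ k j, d k < j → n k j = 0) (hn0 : ∀ k, b₂ (n k 0) = 0)
    (hr : ∀ k j, b₁ (n k j) + b₂ (n k (j + 1)) = 0)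
    (iso₁ : ∀ k i l j, b₁ (n k i) (n l j) = 0) (iso₂ : ∀ k i l j, b₂ (n k i) (n l j) = 0)
    (li : LinearIndependent K (fun q : Σ k, Fin (d k + 1) => n q.1 q.2))
    (li' : LinearIndependent K (fun q : Σ k, Fin (d k) => b₁ (n q.1 q.2)))
    (hcard : ∑ k, (2 * d k + 1) = finrank K V) :
    ∃ e : Basis (Σ k, Fin (2 * d k + 1)) K V, ∀ x y,
      b₁ (e x) (e y) = (if x.1 = y.1 then kronecker₁ K x.2 y.2 else 0) ∧
      b₂ (e x) (e y) = (if x.1 = y.1 then kronecker₂ K x.2 y.2 else 0) := by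
  obtain ⟨v', hv'⟩ := exists_dual_vectors li'
  let v : ι → ℕ → V := fun k i => if h : i < d k then v' ⟨k, ⟨i, h⟩⟩ else 0
  have hN₁ : ∀ k i l j, j < d l → b₁ (n k i) (v l j) = if k = l ∧ i = j then 1 else 0 := by
    intro k i l j hj
    by_cases hi : i < d k
    · have := hv' ⟨k, ⟨i, hi⟩⟩ ⟨l, ⟨j, hj⟩⟩
      simp only [v, dif_pos hj]
      rw [this]
      congr 1
      apply propext
      constructor
      · intro h
        obtain rfl : k = l := congrArg Sigma.fst h
        exact ⟨rfl, Fin.ext_iff.mp (eq_of_heq (Sigma.mk.inj h).2)⟩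
      · rintro ⟨rfl, rfl⟩; rfl
    -- At and beyond the end of a chain the next vector is 0, so b₁ (n k i) = 0.
    · have h0 := hr k i
      rw [hn k (i + 1) (by omega), map_zero, add_zero] at h0
      rw [h0, if_neg, LinearMap.zero_apply]
      rintro ⟨rfl, rfl⟩
      exact hi hj
  have hb₂ : ∀ k i, b₂ (n k (i + 1)) = - b₁ (n k i) := fun k i =>
    eq_neg_of_add_eq_zero_right (hr k i)
  -- Adding u = ∑ φ n to v keeps the pairings with the isotropic n. It changes b₁ (v, v) by φ k i l
  -- j - φ l j k i and b₂ (v, v) by φ l j k (i+1) - φ k i l (j+1); φ is chosen to cancel both.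
  obtain ⟨φ, hφ⟩ := exists_correction two_ne d (fun k i l j => b₁ (v k i) (v l j))
    (fun k i l j => b₂ (v k i) (v l j)) (fun _ _ _ _ => sk₁ _ _) (fun _ _ _ _ => sk₂ _ _)
  let u : ι → ℕ → V := fun k i => ∑ l, ∑ j ∈ Finset.range (d l + 1), φ k i l j • n l j
  have hu : ∀ k i (f : V →ₗ[K] K), f (u k i) =
      ∑ l, ∑ j ∈ Finset.range (d l + 1), φ k i l j * f (n l j) := by
    intro k i f; simp [u, map_sum]
  have nu₁ : ∀ k i l j, b₁ (n k i) (u l j) = 0 := by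
    intro k i l j; rw [hu]; simp [iso₁]
  have nu₂ : ∀ k i l j, b₂ (n k i) (u l j) = 0 := by
    intro k i l j; rw [hu]; simp [iso₂]
  have uu₁ : ∀ k i l j, b₁ (u k i) (u l j) = 0 := by
    intro k i l j
    rw [sk₁, hu, neg_eq_zero]
    exact Finset.sum_eq_zero fun a _ => Finset.sum_eq_zero fun c _ => by
      rw [sk₁, nu₁]; simp
  have uu₂ : ∀ k i l j, b₂ (u k i) (u l j) = 0 := by
    intro k i l j
    rw [sk₂, hu, neg_eq_zero]
    exact Finset.sum_eq_zero fun a _ => Finset.sum_eq_zero fun c _ => by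
      rw [sk₂, nu₂]; simp
  have uv₁ : ∀ k i l j, j < d l → b₁ (u k i) (v l j) = φ k i l j := by
    intro k i l j hj
    rw [sk₁, hu]
    rw [Finset.sum_eq_single l, Finset.sum_eq_single j]
    · rw [sk₁, hN₁ _ _ _ _ hj]; simp
    · intro c _ hc
      rw [sk₁, hN₁ _ _ _ _ hj]; simp [hc]
    · intro h; exact absurd (Finset.mem_range.mpr (by omega)) h
    · intro a _ ha
      refine Finset.sum_eq_zero fun c _ => ?_
      rw [sk₁, hN₁ _ _ _ _ hj]; simp [ha]
    · simp
  have hN₂ : ∀ k i l j, j < d l →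
      b₂ (n k i) (v l j) = if k = l ∧ i = j + 1 then -1 else 0 := by
    intro k i l j hj
    cases i with
    | zero => rw [hn0]; simp
    | succ i => rw [hb₂, LinearMap.neg_apply, hN₁ _ _ _ _ hj]; split_ifs <;> grind
  have uv₂ : ∀ k i l j, j < d l → b₂ (u k i) (v l j) = - φ k i l (j + 1) := by
    intro k i l j hj
    rw [sk₂, hu]
    rw [Finset.sum_eq_single l, Finset.sum_eq_single (j + 1)]
    · rw [sk₂, hN₂ _ _ _ _ hj]; simp
    · intro c _ hc
      rw [sk₂, hN₂ _ _ _ _ hj]; simp [hc]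
    · intro h; exact absurd (Finset.mem_range.mpr (by omega)) h
    · intro a _ ha
      refine Finset.sum_eq_zero fun c _ => ?_
      rw [sk₂, hN₂ _ _ _ _ hj]; simp [ha]
    · simp
  refine exists_kronecker_basis_of_dual_chains b₁ b₂ sk₁ sk₂ d n (fun k i => v k i + u k i)
    iso₁ iso₂ li ?_ ?_ ?_ ?_ hcard
  · intro k i l j hj
    rw [map_add, nu₁, add_zero, hN₁ _ _ _ _ hj]
  · intro k i l j hj
    rw [map_add, nu₂, add_zero, hN₂ _ _ _ _ hj]
  · intro k i l j hi hj
    have := (hφ k i l j hi hj).1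
    simp only [map_add, LinearMap.add_apply]
    rw [uu₁, uv₁ _ _ _ _ hj, sk₁ (v k i) (u l j), uv₁ _ _ _ _ hi]
    linear_combination this
  · intro k i l j hi hj
    have := (hφ k i l j hi hj).2
    simp only [map_add, LinearMap.add_apply]
    rw [uu₂, uv₂ _ _ _ _ hj, sk₂ (v k i) (u l j), uv₂ _ _ _ _ hi]
    linear_combination -this

/-- The induction turns Z into the new source, which requires a single universe; the isomorphism of
Z with W/ker T₂ removes that restriction. -/
theorem exists_chain_family_of_surjective {K : Type*} [Field K] {W : Type u} {Z : Type v}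
    [AddCommGroup W] [Module K W] [FiniteDimensional K W]
    [AddCommGroup Z] [Module K Z] [FiniteDimensional K Z] (T₁ T₂ : W →ₗ[K] Z)
    (hsurj : Function.Surjective T₂)
    (hC : ∀ S : Submodule K Z, (S.comap T₂).map T₁ ≤ S → S = ⊤) :
    ∃ (ι : Type) (_ : Fintype ι) (d : ι → ℕ) (n : ι → ℕ → W),
      (∀ k j, d k < j → n k j = 0) ∧ (∀ k, T₂ (n k 0) = 0) ∧
      (∀ k j, T₁ (n k j) + T₂ (n k (j + 1)) = 0) ∧
      LinearIndependent K (fun q : Σ k, Fin (d k + 1) => n q.1 q.2) ∧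
      LinearIndependent K (fun q : Σ k, Fin (d k) => T₂ (n q.1 (q.2 + 1))) ∧
      ∑ k, (d k + 1) = finrank K W ∧ ∑ k, d k = finrank K Z := by
  let E := T₂.quotKerEquivOfSurjective hsurj
  obtain ⟨ι, _, d, n, h1, h2, h3, h4, h5, h6, h7⟩ :=
    exists_chain_family _ W (W ⧸ LinearMap.ker T₂) (E.symm.toLinearMap ∘ₗ T₁)
    (E.symm.toLinearMap ∘ₗ T₂) rfl (E.symm.surjective.comp hsurj) (by
      intro S hS
      have h := hC (S.comap E.symm.toLinearMap) (by
        rw [Submodule.map_le_iff_le_comap] at hS ⊢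
        exact hS)
      rw [eq_top_iff]
      intro x _
      have : E x ∈ S.comap E.symm.toLinearMap := h ▸ Submodule.mem_top
      simpa using this)
  refine ⟨ι, inferInstance, d, n, h1, ?_, ?_, h4, ?_, h6, ?_⟩
  · intro k; simpa using h2 k
  · intro k j
    have := h3 k j
    simp only [LinearMap.comp_apply] at this
    rw [← map_add] at this
    exact E.symm.map_eq_zero_iff.mp this
  · exact LinearIndependent.of_comp E.symm.toLinearMap h5
  · rw [h7]; exact E.finrank_eq

/-! ### Isotropic subspaces and kernels of a pencil -/

section Isotropic

variable {L V : Type*} [Field L] [AddCommGroup V] [Module L V]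

theorem map_le_dualAnnihilator_of_isotropic {b : LinearMap.BilinForm L V} {X : Submodule L V}
    (hX : ∀ x ∈ X, ∀ y ∈ X, b x y = 0) : X.map b ≤ X.dualAnnihilator := by
  rintro _ ⟨x, hx, rfl⟩
  rw [Submodule.mem_dualAnnihilator]
  exact fun y hy => hX x hx y hy

variable [FiniteDimensional L V]

theorem finrank_le_finrank_map_add_finrank_ker (b : LinearMap.BilinForm L V)
    (X : Submodule L V) :
    finrank L X ≤ finrank L (X.map b) + finrank L (LinearMap.ker b) := by
  have e2 := LinearMap.finrank_range_add_finrank_ker (b.domRestrict X)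
  rw [LinearMap.range_domRestrict] at e2
  have : finrank L (LinearMap.ker (b.domRestrict X)) ≤ finrank L (LinearMap.ker b) := by
    rw [LinearMap.ker_domRestrict]
    refine LinearMap.finrank_le_finrank_of_injective
      (f := (X.subtype.restrict (p := (LinearMap.ker b).comap X.subtype)
        (q := LinearMap.ker b) fun x hx => hx)) ?_
    intro x y hxy
    have := congrArg Subtype.val hxy
    exact Subtype.ext (Subtype.ext this)
  omega

/-- b maps X into its annihilator, of dimension dim V - dim X, and loses at most R dimensions. -/
theorem two_mul_finrank_le_of_isotropic {b : LinearMap.BilinForm L V} {X : Submodule L V}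
    (hX : ∀ x ∈ X, ∀ y ∈ X, b x y = 0) {R : ℕ} (hR : finrank L (LinearMap.ker b) ≤ R) :
    2 * finrank L X ≤ finrank L V + R := by
  obtain ⟨r, hr⟩ : ∃ r, r = finrank L (X.dualAnnihilator : Submodule L (Dual L V)) := ⟨_, rfl⟩
  have h1 : finrank L (X.map b) ≤ r :=
    hr ▸ Submodule.finrank_mono (map_le_dualAnnihilator_of_isotropic hX)
  have h2 := finrank_le_finrank_map_add_finrank_ker b X
  have h3 : finrank L X + r = _ := hr ▸ Subspace.finrank_add_finrank_dualAnnihilator_eq X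
  omega

/-- The equality case of the isotropy bound. -/
theorem map_eq_dualAnnihilator_of_isotropic {b : LinearMap.BilinForm L V} {X : Submodule L V}
    (hX : ∀ x ∈ X, ∀ y ∈ X, b x y = 0) {R : ℕ} (hR : finrank L (LinearMap.ker b) ≤ R)
    (h : finrank L V + R ≤ 2 * finrank L X) : X.map b = X.dualAnnihilator := by
  have h2 := finrank_le_finrank_map_add_finrank_ker b X
  obtain ⟨r, hr⟩ : ∃ r, r = finrank L (X.dualAnnihilator : Submodule L (Dual L V)) := ⟨_, rfl⟩
  have h3 : finrank L X + r = _ := hr ▸ Subspace.finrank_add_finrank_dualAnnihilator_eq X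
  have h4 : r ≤ finrank L (X.map b) := by omega
  exact Submodule.eq_of_le_of_finrank_le (map_le_dualAnnihilator_of_isotropic hX) (hr ▸ h4)

/-- The range of the transpose of b is the annihilator of ker b, and for a skew form the transpose
is -b after identifying V with its bidual. -/
theorem mem_range_of_skew {b : LinearMap.BilinForm L V} (hb : ∀ x y, b x y = - b y x)
    {f : V →ₗ[L] L} (hf : ∀ x, b x = 0 → f x = 0) : ∃ y, b y = f := by
  have h1 : f ∈ LinearMap.range b.dualMap := by
    rw [LinearMap.range_dualMap_eq_dualAnnihilator_ker, Submodule.mem_dualAnnihilator]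
    exact hf
  obtain ⟨φ, hφ⟩ := h1
  obtain ⟨y, rfl⟩ := (Module.evalEquiv L V).surjective φ
  refine ⟨-y, ?_⟩
  ext z
  rw [← hφ, map_neg, LinearMap.neg_apply, ← hb]
  rfl

/-- An endomorphism has finitely many eigenvalues, hence almost all kernels of a pencil lie in any
subspace that contains the kernel of `b₂` and on which `b₂⁻¹ b₁` acts. -/
theorem le_of_span_kernels {b₁ b₂ : LinearMap.BilinForm L V} {X Y : Submodule L V}
    (hker : LinearMap.ker b₂ ≤ Y) (hY : Y.map b₁ ≤ Y.map b₂) (hX : X.map b₁ ≤ X.map b₂)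
    (hspan : ∀ s : Set L, s.Finite →
      X ≤ Submodule.span L {w | w ∈ X ∧ ∃ z ∉ s, z • b₁ w + b₂ w = 0}) : X ≤ Y := by
  -- b₂⁻¹ b₁ is defined only modulo ker b₂; a choice on a basis gives an endomorphism T of X with b₂
  -- T = b₁.
  let c := finBasis L X
  have hc : ∀ i, ∃ y : X, b₂ (y : V) = b₁ (c i : V) := fun i => by
    obtain ⟨y, hy, hxy⟩ := hX ⟨(c i : V), (c i).2, rfl⟩
    exact ⟨⟨y, hy⟩, hxy⟩
  choose g hg using hc
  let T : X →ₗ[L] X := c.constr L g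
  have hT : ∀ x : X, b₂ (T x : V) = b₁ (x : V) := by
    have h : b₂ ∘ₗ X.subtype ∘ₗ T = b₁ ∘ₗ X.subtype := c.ext fun i => by
      simp [T, c.constr_basis, hg]
    exact fun x => LinearMap.congr_fun h x
  let Y' := Y.comap X.subtype
  have hTY : Y' ≤ Y'.comap T := by
    intro x hx
    obtain ⟨y, hy, hxy⟩ := hY ⟨(x : V), hx, rfl⟩
    have h1 : (T x : V) - y ∈ Y := hker (by rw [LinearMap.mem_ker, map_sub, hT, hxy, sub_self])
    have h2 := Y.add_mem h1 hy
    rw [sub_add_cancel] at h2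
    exact h2
  let Tq : Module.End L (X ⧸ Y') := Y'.mapQ Y' T hTY
  -- If z b₁ w + b₂ w = 0 with z ≠ 0, then b₂ (T w) = b₁ w = -z⁻¹ b₂ w. As ker b₂ ≤ Y, the class of
  -- w modulo Y is zero or an eigenvector for -z⁻¹, so avoiding finitely many z puts w in Y.
  have hfin : {z : L | Tq.HasEigenvalue (-z⁻¹)}.Finite :=
    (Module.End.finite_hasEigenvalue Tq).preimage
      ((neg_injective.comp inv_injective).injOn)
  refine (hspan ({0} ∪ {z : L | Tq.HasEigenvalue (-z⁻¹)}) ((Set.finite_singleton 0).union hfin)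
    ).trans (Submodule.span_le.mpr ?_)
  rintro w ⟨hw, z, hz, hzw⟩
  by_contra hwY
  rw [Set.mem_union, not_or] at hz
  have hz0 : z ≠ 0 := hz.1
  refine hz.2 (Module.End.hasEigenvalue_of_hasEigenvector (x := Y'.mkQ ⟨w, hw⟩) ⟨?_, ?_⟩)
  · rw [Module.End.mem_eigenspace_iff]
    change Y'.mkQ (T ⟨w, hw⟩) = _
    rw [← map_smul, Submodule.mkQ_apply, Submodule.mkQ_apply, Submodule.Quotient.eq]
    apply hker
    rw [LinearMap.mem_ker]
    change b₂ ((T ⟨w, hw⟩ : V) - (-z⁻¹) • w) = 0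
    rw [map_sub, hT, map_smul, eq_neg_of_add_eq_zero_right hzw, smul_neg, neg_smul, neg_neg,
      smul_smul, inv_mul_cancel₀ hz0, one_smul, sub_self]
  · intro h
    rw [Submodule.mkQ_apply, Submodule.Quotient.mk_eq_zero] at h
    exact hwY h

end Isotropic

/-! ### Extension of scalars -/

section BaseChange

variable {K L V V' : Type*} [Field K] [Field L] [Algebra K L] [AddCommGroup V] [Module K V]
  [AddCommGroup V'] [Module L V'] {I : Type*} [Fintype I] (e : Basis I K V) (e' : Basis I L V')

/-- The semilinear map of an extension of scalars that sends one basis to another. -/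
noncomputable def extensionMap : V →ₛₗ[algebraMap K L] V' where
  toFun v := ∑ i, algebraMap K L (e.repr v i) • e' i
  map_add' v w := by simp [add_smul, Finset.sum_add_distrib]
  map_smul' c v := by simp [mul_smul, Finset.smul_sum]

theorem extensionMap_basis (i : I) : extensionMap e e' (e i) = e' i := by
  classical
  simp only [extensionMap, LinearMap.coe_mk, AddHom.coe_mk, Basis.repr_self]
  rw [Finset.sum_eq_single i] <;> simp +contextual [eq_comm]

variable {e e'}

theorem extensionMap_form {b : LinearMap.BilinForm K V} {b' : LinearMap.BilinForm L V'}
    (h : ∀ i j, b' (e' i) (e' j) = algebraMap K L (b (e i) (e j))) (x y : V) :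
    b' (extensionMap e e' x) (extensionMap e e' y) = algebraMap K L (b x y) := by
  conv_rhs => rw [← e.sum_repr x, ← e.sum_repr y]
  simp only [extensionMap, LinearMap.coe_mk, AddHom.coe_mk, map_sum, LinearMap.sum_apply, map_smul,
    LinearMap.smul_apply, h, smul_eq_mul, map_mul]

theorem finrank_span_image_le [FiniteDimensional K V] (ι : V →ₛₗ[algebraMap K L] V')
    (S : Submodule K V) : finrank L (Submodule.span L (ι '' S)) ≤ finrank K S := by
  let c := finBasis K S
  have h1 : Submodule.span L (ι '' S) ≤ Submodule.span L (Set.range fun i => ι (c i)) := by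
    rw [Submodule.span_le]
    rintro _ ⟨v, hv, rfl⟩
    have h2 := congrArg Subtype.val (c.sum_repr ⟨v, hv⟩)
    rw [AddSubmonoidClass.coe_finsetSum] at h2
    change _ = v at h2
    rw [← h2, map_sum]
    refine Submodule.sum_mem _ fun i _ => ?_
    change ι (c.repr ⟨v, hv⟩ i • (c i : V)) ∈ _
    rw [map_smulₛₗ]
    exact Submodule.smul_mem _ _ (Submodule.subset_span ⟨i, rfl⟩)
  have := FiniteDimensional.span_of_finite L (Set.finite_range fun i => ι (c i))
  refine (Submodule.finrank_mono h1).trans ?_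
  have h3 := finrank_range_le_card (R := L) (fun i => ι (c i))
  rw [Fintype.card_fin] at h3
  exact h3

/-- The equations of the kernel have coefficients in K. Writing the coordinates of x in a K-basis of
L, the coefficient vector at each basis element solves the same equations. -/
theorem ker_le_span_image_ker {b : LinearMap.BilinForm K V} {b' : LinearMap.BilinForm L V'}
    (h : ∀ i j, b' (e' i) (e' j) = algebraMap K L (b (e i) (e j))) :
    LinearMap.ker b' ≤ Submodule.span L (extensionMap e e' '' (LinearMap.ker b)) := by
  classical
  intro x hx
  let c := Basis.ofVectorSpace K L
  let y := fun j => ∑ i, c.repr (e'.repr x i) j • e i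
  have hy : ∀ j, y j ∈ LinearMap.ker b := by
    intro j
    rw [LinearMap.mem_ker]
    refine e.ext fun k => ?_
    have h1 : ∑ i, b (e i) (e k) • e'.repr x i = 0 := by
      have h2 : b' x (e' k) = 0 := by rw [LinearMap.mem_ker.mp hx, LinearMap.zero_apply]
      rw [← e'.sum_repr x, map_sum, LinearMap.sum_apply] at h2
      rw [← h2]
      refine Finset.sum_congr rfl fun i _ => ?_
      rw [map_smul, LinearMap.smul_apply, h, Algebra.smul_def, smul_eq_mul, mul_comm]
    have h3 := congrArg (fun t => c.repr t j) h1
    simp only [map_sum, map_smul, map_zero, Finsupp.zero_apply, Finsupp.finsetSum_apply,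
      Finsupp.smul_apply, smul_eq_mul] at h3
    rw [LinearMap.zero_apply, ← h3]
    simp only [y, map_sum, map_smul, LinearMap.sum_apply, LinearMap.smul_apply, smul_eq_mul]
    exact Finset.sum_congr rfl fun i _ => mul_comm _ _
  -- L may be infinite-dimensional over K; only finitely many basis elements occur in x.
  let J := Finset.univ.biUnion fun i => (c.repr (e'.repr x i)).support
  have hx' : x = ∑ j ∈ J, c j • extensionMap e e' (y j) := by
    have h4 : ∀ i, e'.repr x i = ∑ j ∈ J, c.repr (e'.repr x i) j • c j := by
      intro i
      conv_lhs => rw [← c.linearCombination_repr (e'.repr x i), Finsupp.linearCombination_apply]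
      refine Finsupp.sum_of_support_subset _ ?_ _ (by simp)
      exact Finset.subset_biUnion_of_mem (fun i => (c.repr (e'.repr x i)).support)
        (Finset.mem_univ i)
    conv_lhs => rw [← e'.sum_repr x]
    simp only [y, map_sum, map_smulₛₗ, extensionMap_basis, Finset.smul_sum]
    rw [Finset.sum_comm]
    refine Finset.sum_congr rfl fun i _ => ?_
    conv_lhs => rw [h4 i]
    rw [Finset.sum_smul]
    refine Finset.sum_congr rfl fun j _ => ?_
    rw [Algebra.smul_def, mul_comm, mul_smul]
  rw [hx']
  exact Submodule.sum_mem _ fun j _ => Submodule.smul_mem _ _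
    (Submodule.subset_span ⟨y j, hy j, rfl⟩)

end BaseChange

/-! ### The least closed subspace and the normal form at a point -/

theorem LinearMap.BilinForm.skew_of_basis {L V I : Type*} [CommRing L] [AddCommGroup V] [Module L V]
    (e : Basis I L V) {b : LinearMap.BilinForm L V}
    (h : ∀ i j, b (e i) (e j) = - b (e j) (e i)) (x y : V) : b x y = - b y x := by
  have : b = - b.flip := e.ext fun i => e.ext fun j => by simpa using h i j
  conv_lhs => rw [this]
  rfl

/-- The least subspace closed under `S ↦ b₂⁻¹ (b₁ S)`. -/
noncomputable def leastClosed {K V : Type*} [Field K] [AddCommGroup V] [Module K V]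
    (b₁ b₂ : LinearMap.BilinForm K V) : Submodule K V :=
  OrderHom.lfp ⟨fun S => (S.map b₁).comap b₂, fun _ _ h => Submodule.comap_mono (Submodule.map_mono h)⟩

theorem leastClosed_eq {K V : Type*} [Field K] [AddCommGroup V] [Module K V]
    (b₁ b₂ : LinearMap.BilinForm K V) :
    ((leastClosed b₁ b₂).map b₁).comap b₂ = leastClosed b₁ b₂ :=
  OrderHom.map_lfp (⟨fun S => (S.map b₁).comap b₂,
    fun _ _ h => Submodule.comap_mono (Submodule.map_mono h)⟩ : Submodule K V →o Submodule K V)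

theorem leastClosed_le {K V : Type*} [Field K] [AddCommGroup V] [Module K V]
    {b₁ b₂ : LinearMap.BilinForm K V} {S : Submodule K V} (h : (S.map b₁).comap b₂ ≤ S) :
    leastClosed b₁ b₂ ≤ S :=
  OrderHom.lfp_le _ h

open Bihamiltonian in
-- The maps b₁, b₂ from W to b₂ W meet the chain criterion because W is minimal: if T₁ (T₂⁻¹ S) ≤ S,
-- then T₂⁻¹ S is closed under b₂⁻¹ b₁, hence is all of W.
theorem exists_kronecker_basis_of_leastClosed {K V : Type*} [Field K] (two_ne : (2 : K) ≠ 0)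
    [AddCommGroup V] [Module K V] [FiniteDimensional K V] (b₁ b₂ : LinearMap.BilinForm K V)
    (sk₁ : ∀ x y, b₁ x y = - b₁ y x) (sk₂ : ∀ x y, b₂ x y = - b₂ y x) (R : ℕ)
    (iso₁ : ∀ x ∈ leastClosed b₁ b₂, ∀ y ∈ leastClosed b₁ b₂, b₁ x y = 0)
    (iso₂ : ∀ x ∈ leastClosed b₁ b₂, ∀ y ∈ leastClosed b₁ b₂, b₂ x y = 0)
    (hle : (leastClosed b₁ b₂).map b₁ ≤ (leastClosed b₁ b₂).map b₂)
    (hann : (leastClosed b₁ b₂).map b₂ = (leastClosed b₁ b₂).dualAnnihilator)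
    (hdim : 2 * finrank K (leastClosed b₁ b₂) = finrank K V + R) :
    ∃ (d : Fin R → ℕ) (e : Basis (Σ k, Fin (2 * d k + 1)) K V), ∀ x y,
      b₁ (e x) (e y) = (if x.1 = y.1 then kronecker₁ K x.2 y.2 else 0) ∧
      b₂ (e x) (e y) = (if x.1 = y.1 then kronecker₂ K x.2 y.2 else 0) := by
  classical
  set W := leastClosed b₁ b₂ with hW
  let T₂ : W →ₗ[K] W.map b₂ := b₂.submoduleMap W
  let T₁ : W →ₗ[K] W.map b₂ := (b₁.domRestrict W).codRestrict _ fun x => hle ⟨x, x.2, rfl⟩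
  obtain ⟨ι, _, d, n, h1, h2, h3, h4, h5, h6, h7⟩ := exists_chain_family_of_surjective
    (W := W) (Z := W.map b₂) T₁ T₂
    (b₂.submoduleMap_surjective W) (by
      intro S hS
      have hcl : W ≤ (S.comap T₂).map W.subtype := by
        refine leastClosed_le ?_
        rintro x ⟨_, ⟨y, hy, rfl⟩, hxy⟩
        have hx : x ∈ W := by
          rw [hW, ← leastClosed_eq]
          exact ⟨(y : V), y.2, hxy⟩
        refine ⟨⟨x, hx⟩, ?_, rfl⟩
        have h1 : T₂ ⟨x, hx⟩ = T₁ y := Subtype.ext hxy.symm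
        change T₂ ⟨x, hx⟩ ∈ S
        rw [h1]
        exact hS ⟨y, hy, rfl⟩
      rw [eq_top_iff]
      rintro z -
      obtain ⟨w, rfl⟩ := b₂.submoduleMap_surjective W z
      obtain ⟨w', hw', hww⟩ := hcl w.2
      obtain rfl : w' = w := Subtype.ext hww
      exact hw')
  obtain ⟨r, hr⟩ : ∃ r, r = finrank K (W.dualAnnihilator : Submodule K (Dual K V)) := ⟨_, rfl⟩
  have e3 : finrank K W + r = _ := hr ▸ Subspace.finrank_add_finrank_dualAnnihilator_eq W
  have e4 : finrank K (W.map b₂) = r := by rw [hr, hann]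
  have e5 : ∑ k, (d k + 1) = ∑ k, d k + Fintype.card ι := by simp [Finset.sum_add_distrib]
  have e6 : ∑ k, (2 * d k + 1) = 2 * ∑ k, d k + Fintype.card ι := by
    simp [Finset.sum_add_distrib, Finset.mul_sum]
  -- The number of chains is dim W minus the dimension of its annihilator, that is 2 dim W - dim V =
  -- R.
  have hcard : Fintype.card ι = R := by omega
  let σ : Fin R ≃ ι := (Fintype.equivFinOfCardEq hcard).symm
  obtain ⟨e, he⟩ := exists_kronecker_basis_of_chains two_ne b₁ b₂ sk₁ sk₂ d
    (fun k j => (n k j : V)) (fun k j h => by rw [h1 k j h]; rfl)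
    (fun k => congrArg Subtype.val (h2 k)) (fun k j => congrArg Subtype.val (h3 k j))
    (fun k i l j => iso₁ _ (n k i).2 _ (n l j).2) (fun k i l j => iso₂ _ (n k i).2 _ (n l j).2)
    (h4.map' W.subtype W.ker_subtype)
    (by
      refine LinearIndependent.of_comp (-LinearMap.id) ?_
      convert h5.map' (W.map b₂).subtype (Submodule.ker_subtype _) using 1
      · funext q
        have h8 := congrArg Subtype.val (h3 q.1 q.2)
        exact (eq_neg_of_add_eq_zero_right h8).symm
      all_goals rfl)
    (by omega)
  refine ⟨fun k => d (σ k), e.reindex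
    (Equiv.sigmaCongrLeft (β := fun k => Fin (2 * d k + 1)) σ).symm, fun x y => ?_⟩
  rw [Basis.reindex_apply, Basis.reindex_apply, Equiv.symm_symm]
  obtain ⟨h8, h9⟩ := he (Equiv.sigmaCongrLeft σ x) (Equiv.sigmaCongrLeft σ y)
  rw [h8, h9]
  simp [Equiv.sigmaCongrLeft]

open Bihamiltonian in
-- X lives over L while the normal form is wanted over K. The least closed subspace W over K
-- provides the descent: its L-span contains X, so it is at least as large, while W is isotropic and
-- cannot be larger than X.
theorem exists_kronecker_basis_of_isotropic {K L V V' I : Type*} [Field K] [Field L] [Algebra K L]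
    (two_ne : (2 : K) ≠ 0) [AddCommGroup V] [Module K V] [AddCommGroup V'] [Module L V']
    [Fintype I] (e : Basis I K V) (e' : Basis I L V')
    {b₁ b₂ : LinearMap.BilinForm K V} {b₁' b₂' : LinearMap.BilinForm L V'}
    (h₁ : ∀ i j, b₁' (e' i) (e' j) = algebraMap K L (b₁ (e i) (e j)))
    (h₂ : ∀ i j, b₂' (e' i) (e' j) = algebraMap K L (b₂ (e i) (e j)))
    (sk₁ : ∀ x y, b₁ x y = - b₁ y x) (sk₂ : ∀ x y, b₂ x y = - b₂ y x)
    {X : Submodule L V'} (iso₁ : ∀ x ∈ X, ∀ y ∈ X, b₁' x y = 0)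
    (iso₂ : ∀ x ∈ X, ∀ y ∈ X, b₂' x y = 0) {R : ℕ} {a b : K}
    (hR : finrank K (LinearMap.ker (a • b₁ + b • b₂)) ≤ R)
    (hX : finrank K V + R ≤ 2 * finrank L X)
    (hspan : ∀ s : Set L, s.Finite →
      X ≤ Submodule.span L {w | w ∈ X ∧ ∃ z ∉ s, z • b₁' w + b₂' w = 0}) :
    2 * finrank L X = finrank K V + R ∧
    ∃ (d : Fin R → ℕ) (e : Basis (Σ k, Fin (2 * d k + 1)) K V), ∀ x y,
      b₁ (e x) (e y) = (if x.1 = y.1 then kronecker₁ K x.2 y.2 else 0) ∧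
      b₂ (e x) (e y) = (if x.1 = y.1 then kronecker₂ K x.2 y.2 else 0) := by
  have : FiniteDimensional K V := e.finiteDimensional_of_finite
  have : FiniteDimensional L V' := e'.finiteDimensional_of_finite
  have hVV : finrank L V' = finrank K V := by
    rw [finrank_eq_card_basis e, finrank_eq_card_basis e']
  have sk₂' : ∀ x y, b₂' x y = - b₂' y x := LinearMap.BilinForm.skew_of_basis e' fun i j => by
    rw [h₂, h₂, sk₂, map_neg]
  let ι := extensionMap e e'
  have hι₁ : ∀ x y, b₁' (ι x) (ι y) = algebraMap K L (b₁ x y) := extensionMap_form h₁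
  have hι₂ : ∀ x y, b₂' (ι x) (ι y) = algebraMap K L (b₂ x y) := extensionMap_form h₂
  let c' := algebraMap K L a • b₁' + algebraMap K L b • b₂'
  have hc' : finrank L (LinearMap.ker c') ≤ R := by
    have h : ∀ i j, c' (e' i) (e' j) = algebraMap K L ((a • b₁ + b • b₂) (e i) (e j)) := by
      intro i j; simp [c', h₁, h₂, Algebra.smul_def]
    exact ((Submodule.finrank_mono (ker_le_span_image_ker h)).trans
      (finrank_span_image_le _ _)).trans hR
  have isoc : ∀ x ∈ X, ∀ y ∈ X, c' x y = 0 := fun x hx y hy => by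
    simp [c', iso₁ x hx y hy, iso₂ x hx y hy]
  have hc'X := map_eq_dualAnnihilator_of_isotropic isoc hc' (by omega)
  -- On a kernel vector of z b₁' + b₂' the values of c' and b₁' are proportional, and those of b₁'
  -- and b₂' too if z ≠ 0. Since such vectors span X, the equality c' X = X⁰ passes to b₁' and then
  -- to b₂'.
  have hX1 : X.map b₁' = X.dualAnnihilator := by
    refine le_antisymm (map_le_dualAnnihilator_of_isotropic iso₁) ?_
    rw [← hc'X, Submodule.map_le_iff_le_comap]
    refine (hspan ∅ Set.finite_empty).trans (Submodule.span_le.mpr ?_)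
    rintro w ⟨hw, z, -, hz⟩
    change c' w ∈ X.map b₁'
    have : c' w = (algebraMap K L a - algebraMap K L b * z) • b₁' w := by
      simp only [c', LinearMap.add_apply, LinearMap.smul_apply,
        eq_neg_of_add_eq_zero_right hz]
      module
    rw [this]
    exact Submodule.smul_mem _ _ ⟨w, hw, rfl⟩
  have hX12 : X.map b₁' ≤ X.map b₂' := by
    rw [Submodule.map_le_iff_le_comap]
    refine (hspan {0} (Set.finite_singleton 0)).trans (Submodule.span_le.mpr ?_)
    rintro w ⟨hw, z, hz0, hz⟩
    have : b₁' w = (-z⁻¹) • b₂' w := by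
      rw [eq_neg_of_add_eq_zero_right hz, smul_neg, neg_smul, neg_neg, smul_smul,
        inv_mul_cancel₀ hz0, one_smul]
    change b₁' w ∈ X.map b₂'
    rw [this]
    exact Submodule.smul_mem _ _ ⟨w, hw, rfl⟩
  have hX2 : X.map b₂' = X.dualAnnihilator :=
    le_antisymm (map_le_dualAnnihilator_of_isotropic iso₂) (hX1 ▸ hX12)
  -- X is the common zero space of b₂' X, and by skewness ker b₂' pairs to zero with everything.
  have hkerX : LinearMap.ker b₂' ≤ X := by
    intro x hx
    rw [← Subspace.dualAnnihilator_dualCoannihilator_eq (W := X), ← hX2,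
      Submodule.mem_dualCoannihilator]
    rintro _ ⟨y, -, rfl⟩
    rw [sk₂', LinearMap.mem_ker.mp hx, LinearMap.zero_apply, neg_zero]
  have hmem : ∀ x, b₂' x ∈ X.map b₁' → x ∈ X := by
    intro x hx
    obtain ⟨y, hy, hxy⟩ := hX12 hx
    have : x - y ∈ X := hkerX (by rw [LinearMap.mem_ker, map_sub, hxy, sub_self])
    simpa using X.add_mem this hy
  have htrans : ∀ x y, b₂ x = b₁ y → b₂' (ι x) = b₁' (ι y) := by
    intro x y hxy
    refine e'.ext fun k => ?_
    rw [← extensionMap_basis e e' k]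
    change b₂' (ι x) (ι _) = b₁' (ι y) (ι _)
    rw [hι₁, hι₂, hxy]
  let W := leastClosed b₁ b₂
  -- The K-points of X are closed under b₂⁻¹ b₁, so they contain W; this makes W isotropic.
  have hWX : W ≤ X.comap ι := by
    refine leastClosed_le ?_
    rintro x ⟨y, hy, hxy⟩
    exact hmem _ ⟨ι y, hy, (htrans x y hxy.symm).symm⟩
  have hinj := FaithfulSMul.algebraMap_injective K L
  have isoW₁ : ∀ x ∈ W, ∀ y ∈ W, b₁ x y = 0 := fun x hx y hy => hinj (by
    rw [← hι₁, map_zero]; exact iso₁ _ (hWX hx) _ (hWX hy))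
  have isoW₂ : ∀ x ∈ W, ∀ y ∈ W, b₂ x y = 0 := fun x hx y hy => hinj (by
    rw [← hι₂, map_zero]; exact iso₂ _ (hWX hx) _ (hWX hy))
  have hfix : (W.map b₁).comap b₂ = W := leastClosed_eq b₁ b₂
  have hkerW : LinearMap.ker b₂ ≤ W := by
    intro x hx
    rw [← hfix, Submodule.mem_comap, LinearMap.mem_ker.mp hx]
    exact Submodule.zero_mem _
  have hle : W.map b₁ ≤ W.map b₂ := by
    rintro _ ⟨x, hx, rfl⟩
    obtain ⟨y, hy⟩ := mem_range_of_skew sk₂ (f := b₁ x) fun z hz => isoW₁ x hx z (hkerW hz)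
    refine ⟨y, ?_, hy⟩
    rw [← hfix]
    exact ⟨x, hx, hy.symm⟩
  let Y := Submodule.span L (ι '' W)
  have hXY : X ≤ Y := by
    refine le_of_span_kernels ((ker_le_span_image_ker h₂).trans
      (Submodule.span_mono (Set.image_mono hkerW))) ?_ hX12 hspan
    rw [Submodule.map_le_iff_le_comap, Submodule.span_le]
    rintro _ ⟨x, hx, rfl⟩
    obtain ⟨y, hy, hxy⟩ := hle ⟨x, hx, rfl⟩
    exact ⟨ι y, Submodule.subset_span ⟨y, hy, rfl⟩, htrans y x hxy⟩
  have hd1 : finrank L X ≤ finrank K W :=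
    (Submodule.finrank_mono hXY).trans (finrank_span_image_le _ _)
  have isoWc : ∀ x ∈ W, ∀ y ∈ W, (a • b₁ + b • b₂) x y = 0 := fun x hx y hy => by
    simp [isoW₁ x hx y hy, isoW₂ x hx y hy]
  -- With hd1 and hX this pins down dim W = dim X and the equality 2 dim W = dim V + R.
  have hd2 := two_mul_finrank_le_of_isotropic isoWc hR
  have hann : W.map b₂ = W.dualAnnihilator := by
    refine le_antisymm (map_le_dualAnnihilator_of_isotropic isoW₂) ?_
    rw [← map_eq_dualAnnihilator_of_isotropic isoWc hR (by omega), Submodule.map_le_iff_le_comap]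
    intro x hx
    exact Submodule.add_mem _ (Submodule.smul_mem _ _ (hle ⟨x, hx, rfl⟩))
      (Submodule.smul_mem _ _ ⟨x, hx, rfl⟩)
  exact ⟨by omega, exists_kronecker_basis_of_leastClosed two_ne b₁ b₂ sk₁ sk₂ R isoW₁ isoW₂ hle
    hann (show 2 * finrank K W = _ by omega)⟩

/-! ### Indecomposability of Kronecker blocks -/

open Bihamiltonian in
-- The kernel of b₂ on the block is the line of w₀. In an orthogonal splitting this line lies in one
-- summand, and that summand then absorbs every w_{2j}, which leaves nothing for the other.
theorem isIndecomposableBlock_of_kronecker_basis {K V : Type*} [Field K] [AddCommGroup V]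
    [Module K V] {b₁ b₂ : LinearMap.BilinForm K V}
    (sk₁ : ∀ x y, b₁ x y = - b₁ y x) (sk₂ : ∀ x y, b₂ x y = - b₂ y x)
    (S : Submodule K V) (d : ℕ) (w : Basis (Fin (2 * d + 1)) K S)
    (h₁ : ∀ p q, b₁ (w p : V) (w q : V) = kronecker₁ K p q)
    (h₂ : ∀ p q, b₂ (w p : V) (w q : V) = kronecker₂ K p q) : IsIndecomposableBlock b₁ b₂ S := by
  have expand : ∀ (b : LinearMap.BilinForm K V) (p) (x : S),
      b (w p : V) (x : V) = ∑ q, w.repr x q * b (w p : V) (w q : V) := by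
    intro b p x
    have := congrArg (fun y : S => b (w p : V) (y : V)) (w.sum_repr x)
    simp only [AddSubmonoidClass.coe_finsetSum, map_sum, Submodule.coe_smul, map_smul,
      smul_eq_mul] at this
    exact this.symm
  have c₂o : ∀ (j : ℕ) (hj : 2 * j + 2 < 2 * d + 1) (x : S),
      b₂ (w ⟨2 * j + 1, by omega⟩ : V) (x : V) = w.repr x ⟨2 * j + 2, hj⟩ := by
    intro j hj x
    rw [expand, Finset.sum_eq_single ⟨2 * j + 2, hj⟩]
    · rw [h₂, kronecker₂, if_pos ⟨by simp, rfl⟩, mul_one]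
    · intro q _ hq
      rw [h₂, kronecker₂, if_neg, if_neg, mul_zero]
      · rintro ⟨h3, h4⟩
        simp only at h4
        obtain ⟨m, hm⟩ := h3
        omega
      · rintro ⟨h3, h4⟩
        exact hq (Fin.ext h4)
    · simp
  have c₂e : ∀ (j : ℕ) (hj : 2 * j + 1 < 2 * d + 1) (x : S),
      b₂ (w ⟨2 * j + 2, by omega⟩ : V) (x : V) = - w.repr x ⟨2 * j + 1, hj⟩ := by
    intro j hj x
    rw [expand, Finset.sum_eq_single ⟨2 * j + 1, hj⟩]
    · rw [h₂, kronecker₂, if_neg (by grind), if_pos ⟨by simp, rfl⟩, mul_neg_one]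
    · intro q _ hq
      rw [h₂, kronecker₂, if_neg, if_neg, mul_zero]
      · rintro ⟨h3, h4⟩
        simp only at h4
        exact hq (Fin.ext (by simp only; omega))
      · rintro ⟨⟨m, hm⟩, h4⟩
        simp only at hm
        omega
    · simp
  have c₁e : ∀ (j : ℕ) (hj : 2 * j + 1 < 2 * d + 1) (x : S),
      b₁ (w ⟨2 * j, by omega⟩ : V) (x : V) = w.repr x ⟨2 * j + 1, hj⟩ := by
    intro j hj x
    rw [expand, Finset.sum_eq_single ⟨2 * j + 1, hj⟩]
    · rw [h₁, kronecker₁, if_pos ⟨by simp, rfl⟩, mul_one]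
    · intro q _ hq
      rw [h₁, kronecker₁, if_neg, if_neg, mul_zero]
      · rintro ⟨⟨m, hm⟩, h4⟩
        simp only at h4
        omega
      · rintro ⟨h3, h4⟩
        exact hq (Fin.ext h4)
    · simp
  have w0 : ∀ q : Fin (2 * d + 1), b₂ (w 0 : V) (w q : V) = 0 := by
    intro q
    rw [h₂, kronecker₂, if_neg, if_neg]
    · rintro ⟨-, h⟩; simp at h
    · rintro ⟨h, -⟩; simp at h
  have w0' : ∀ x ∈ S, b₂ (w 0 : V) x = 0 := by
    intro x hx
    rw [expand b₂ 0 ⟨x, hx⟩]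
    simp [w0]
  have ker₂ : ∀ x ∈ S, (∀ y ∈ S, b₂ y x = 0) → ∃ c : K, x = c • (w 0 : V) := by
    intro x hx hy
    refine ⟨w.repr ⟨x, hx⟩ 0, ?_⟩
    have := congrArg Subtype.val (w.sum_repr ⟨x, hx⟩)
    rw [Finset.sum_eq_single 0] at this
    · exact this.symm
    · intro q _ hq
      have hq0 : (q : ℕ) ≠ 0 := fun h => hq (Fin.ext h)
      have hq2 := q.2
      obtain ⟨j, hj | hj⟩ := Nat.even_or_odd' (q : ℕ)
      · obtain ⟨i, rfl⟩ : ∃ i, j = i + 1 := ⟨j - 1, by omega⟩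
        have h5 := c₂o i (by omega) ⟨x, hx⟩
        rw [hy _ (w _).2] at h5
        have : q = ⟨2 * i + 2, by omega⟩ := Fin.ext hj
        rw [this, ← h5, zero_smul]
      · have h5 := c₂e j (by omega) ⟨x, hx⟩
        rw [hy _ (w _).2] at h5
        have : q = ⟨2 * j + 1, by omega⟩ := Fin.ext hj
        rw [this, neg_eq_zero.mp h5.symm, zero_smul]
    · simp
  have hw0 : (w 0 : V) ≠ 0 := fun h => w.ne_zero 0 (Subtype.ext h)
  refine ⟨fun h => hw0 ((Submodule.eq_bot_iff _).mp h _ (w 0).2), ?_⟩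
  -- The A-component of w₀ is again in the kernel of b₂, hence a multiple c w₀; w₀ is in B if c = 0
  -- and in A otherwise.
  suffices key : ∀ A B : Submodule K V, A ⊔ B = S → Disjoint A B → Orthogonal₂ b₁ b₂ A B →
      (w 0 : V) ∈ A → B = ⊥ by
    intro A B hS hd ho
    have hsup : ∀ y ∈ S, ∃ a ∈ A, ∃ b ∈ B, a + b = y := fun y hy =>
      Submodule.mem_sup.mp (by rw [hS]; exact hy)
    have hA : A ≤ S := hS ▸ le_sup_left
    have hB : B ≤ S := hS ▸ le_sup_right
    have hd' : ∀ x, x ∈ A → x ∈ B → x = 0 := fun x => Submodule.disjoint_def.mp hd x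
    obtain ⟨a, ha, b, hb, hab⟩ := hsup _ (w 0).2
    have hker : ∀ y ∈ S, b₂ y a = 0 := by
      intro y hy
      obtain ⟨a', ha', b', hb', rfl⟩ := hsup y hy
      have e1 : b₂ a' b = 0 := (ho a' ha' b hb).2
      have e2 : b₂ b' a = 0 := by rw [sk₂, (ho a ha b' hb').2, neg_zero]
      have e3 := w0' a' (hA ha')
      rw [sk₂, ← hab, map_add, e1, add_zero, neg_eq_zero] at e3
      rw [map_add, LinearMap.add_apply, e2, e3, add_zero]
    obtain ⟨c, hc⟩ := ker₂ a (hA ha) hker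
    by_cases hc0 : c = 0
    · left
      refine key B A (sup_comm A B ▸ hS) hd.symm (fun x hx y hy => ?_) ?_
      · rw [sk₁, sk₂, (ho y hy x hx).1, (ho y hy x hx).2]; simp
      · rw [← hab, hc, hc0, zero_smul, zero_add]; exact hb
    · right
      refine key A B hS hd ho ?_
      have : (w 0 : V) = c⁻¹ • a := by rw [hc, smul_smul, inv_mul_cancel₀ hc0, one_smul]
      rw [this]; exact A.smul_mem _ ha
  intro A B hS hd ho hwA
  have hsup : ∀ y ∈ S, ∃ a ∈ A, ∃ b ∈ B, a + b = y := fun y hy =>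
    Submodule.mem_sup.mp (by rw [hS]; exact hy)
  have hA : A ≤ S := hS ▸ le_sup_left
  have hB : B ≤ S := hS ▸ le_sup_right
  have hd' : ∀ x, x ∈ A → x ∈ B → x = 0 := fun x => Submodule.disjoint_def.mp hd x
  -- For b' in B, b₂ (w_{2j+2}, b') = -b₁ (w_{2j}, b') = 0 once w_{2j} is in A. So the B-component
  -- of w_{2j+2} is in the kernel line of b₂, which lies in A, and is therefore 0.
  have heven : ∀ j (hj : 2 * j < 2 * d + 1), (w ⟨2 * j, hj⟩ : V) ∈ A := by
    intro j
    induction j with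
    | zero => intro _; exact hwA
    | succ j ih =>
      intro hj
      have hAj := ih (by omega)
      obtain ⟨a, ha, b, hb, hab⟩ := hsup _ (w ⟨2 * (j + 1), hj⟩).2
      have hker : ∀ y ∈ S, b₂ y b = 0 := by
        intro y hy
        obtain ⟨a', ha', b', hb', rfl⟩ := hsup y hy
        have e1 := c₂e j (by omega) ⟨b', hB hb'⟩
        rw [← c₁e j (by omega) ⟨b', hB hb'⟩, (ho _ hAj b' hb').1, neg_zero] at e1
        change b₂ (w ⟨2 * (j + 1), hj⟩ : V) b' = 0 at e1
        rw [← hab, map_add, LinearMap.add_apply, (ho a ha b' hb').2, zero_add] at e1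
        rw [map_add, LinearMap.add_apply, (ho a' ha' b hb).2, sk₂, e1]; simp
      obtain ⟨c, hc⟩ := ker₂ b (hB hb) hker
      have hb0 : b = 0 := hd' b (hc ▸ A.smul_mem c hwA) hb
      rw [← hab, hb0, add_zero]; exact ha
  rw [Submodule.eq_bot_iff]
  intro b hb
  refine hd' b ?_ hb
  have := congrArg Subtype.val (w.sum_repr ⟨b, hB hb⟩)
  rw [AddSubmonoidClass.coe_finsetSum] at this
  change _ = b at this
  rw [← this]
  -- The odd coordinates of b are b₁ (w_{2j}, b) = 0, so b is a combination of vectors of A.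
  refine A.sum_mem fun q _ => ?_
  obtain ⟨j, hj | hj⟩ := Nat.even_or_odd' (q : ℕ)
  · have hq : q = ⟨2 * j, by omega⟩ := Fin.ext hj
    rw [hq]
    exact A.smul_mem _ (heven j _)
  · have hq : q = ⟨2 * j + 1, by omega⟩ := Fin.ext hj
    rw [hq, ← c₁e j (by omega), (ho _ (heven j (by omega)) b hb).1, zero_smul]
    exact A.zero_mem

open Bihamiltonian in
theorem decomposesWithType_of_isKroneckerSum {K V : Type*} [Field K] [AddCommGroup V]
    [Module K V] {b₁ b₂ : LinearMap.BilinForm K V}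
    (sk₁ : ∀ x y, b₁ x y = - b₁ y x) (sk₂ : ∀ x y, b₂ x y = - b₂ y x)
    {R : ℕ} {t : Fin R → ℕ} (h : IsKroneckerSum b₁ b₂ t) : DecomposesWithType b₁ b₂ t := by
  classical
  obtain ⟨hodd, e, he⟩ := h
  let s : Fin R → Set (Σ i, Fin (t i)) := fun i => {x | x.1 = i}
  let S : Fin R → Submodule K V := fun i => Submodule.span K (e '' s i)
  have hS : ∀ i, S i = Submodule.span K (Set.range fun q : Fin (t i) => e ⟨i, q⟩) := by
    intro i
    refine congrArg (Submodule.span K) (Set.ext fun x => ⟨?_, ?_⟩)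
    · rintro ⟨⟨j, q⟩, rfl, rfl⟩; exact ⟨q, rfl⟩
    · rintro ⟨q, rfl⟩; exact ⟨⟨i, q⟩, rfl, rfl⟩
  have hli : ∀ i, LinearIndependent K fun q : Fin (t i) => e ⟨i, q⟩ := fun i =>
    e.linearIndependent.comp (Sigma.mk i) sigma_mk_injective
  refine ⟨S, ?_, ?_, ?_⟩
  · refine DirectSum.isInternal_submodule_of_iSupIndep_of_iSup_eq_top ?_ ?_
    · intro i
      refine (e.linearIndependent.disjoint_span_image (s := s i) (t := (s i)ᶜ)
        disjoint_compl_right).mono_right ?_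
      refine iSup₂_le fun j hj => Submodule.span_mono (Set.image_mono ?_)
      intro x hx hxi
      exact hj (hx.symm.trans hxi)
    · rw [eq_top_iff, ← e.span_eq, Submodule.span_le]
      rintro _ ⟨x, rfl⟩
      exact Submodule.mem_iSup_of_mem x.1 (Submodule.subset_span ⟨x, rfl, rfl⟩)
  · intro i j hij x hx y hy
    have aux : ∀ b : LinearMap.BilinForm K V,
        (∀ x y : (Σ i, Fin (t i)), x.1 ≠ y.1 → b (e x) (e y) = 0) → b x y = 0 := by
      intro b hb
      have h1 : S j ≤ LinearMap.ker (b x) := by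
        rw [Submodule.span_le]
        rintro _ ⟨q, rfl, rfl⟩
        have h2 : S i ≤ LinearMap.ker (b.flip (e q)) := by
          rw [Submodule.span_le]
          rintro _ ⟨p, rfl, rfl⟩
          exact hb p q hij
        exact h2 hx
      exact h1 hy
    exact ⟨aux b₁ fun x y h => by rw [(he x y).1, if_neg h],
      aux b₂ fun x y h => by rw [(he x y).2, if_neg h]⟩
  · intro i
    have hfin : finrank K (S i) = t i := by
      rw [hS, finrank_span_eq_card (hli i), Fintype.card_fin]
    refine ⟨hodd i, hfin, ?_⟩
    obtain ⟨d, hd⟩ := hodd i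
    let w := (Basis.span (hli i)).reindex (finCongr hd)
    have hw : ∀ q, (w q : V) = e ⟨i, Fin.cast hd.symm q⟩ := by
      intro q
      rw [Basis.reindex_apply]
      exact congrArg Subtype.val (Basis.span_apply (hli i) _)
    rw [hS]
    refine isIndecomposableBlock_of_kronecker_basis sk₁ sk₂ _ d w ?_ ?_
    · intro p q
      rw [hw, hw, (he _ _).1, if_pos rfl]
      rfl
    · intro p q
      rw [hw, hw, (he _ _).2, if_pos rfl]
      rfl

/-! ### Recovering the block sizes from polynomial kernels -/

/-- The sequences `x` supported in `[0, q)` such that `(X T₁ + T₂) ∑ x j X ^ j = 0`. -/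
def polynomialKernel {K V Z : Type*} [Field K] [AddCommGroup V] [Module K V] [AddCommGroup Z]
    [Module K Z] (T₁ T₂ : V →ₗ[K] Z) (q : ℕ) : Submodule K (ℕ → V) where
  carrier := {x | (∀ j, q ≤ j → x j = 0) ∧ T₂ (x 0) = 0 ∧ ∀ j, T₁ (x j) + T₂ (x (j + 1)) = 0}
  zero_mem' := by simp
  add_mem' := by
    rintro x y ⟨hx, hx0, hx1⟩ ⟨hy, hy0, hy1⟩
    refine ⟨fun j hj => by simp [hx j hj, hy j hj], by simp [hx0, hy0], fun j => ?_⟩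
    have := congrArg₂ (· + ·) (hx1 j) (hy1 j)
    simp only [Pi.add_apply, map_add]
    rw [← add_zero (0 : Z), ← this]
    abel
  smul_mem' := by
    rintro c x ⟨hx, hx0, hx1⟩
    refine ⟨fun j hj => by simp [hx j hj], by simp [hx0], fun j => ?_⟩
    simp only [Pi.smul_apply, map_smul]
    rw [← smul_add, hx1, smul_zero]

open Bihamiltonian in
-- In a block of dimension 2d + 1 the polynomial solutions of (X b₁ + b₂) x = 0 are the products
-- p(X) ∑ w_{2i} X^i. The degree bound leaves deg p < q - d (truncated subtraction), and the
-- coordinate along w₀ recovers p.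
theorem finrank_polynomialKernel_of_kronecker_basis {K V : Type*} [Field K] [AddCommGroup V]
    [Module K V] {b₁ b₂ : LinearMap.BilinForm K V} {R : ℕ} {d : Fin R → ℕ}
    (e : Basis (Σ k, Fin (2 * d k + 1)) K V)
    (he : ∀ x y, b₁ (e x) (e y) = (if x.1 = y.1 then kronecker₁ K x.2 y.2 else 0) ∧
      b₂ (e x) (e y) = (if x.1 = y.1 then kronecker₂ K x.2 y.2 else 0)) (q : ℕ) :
    finrank K (polynomialKernel b₁ b₂ q) = ∑ k, (q - d k) := by
  classical
  have expand : ∀ (b : LinearMap.BilinForm K V) (x y : V),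
      b x y = ∑ p, e.repr x p * b (e p) y := by
    intro b x y
    conv_lhs => rw [← e.sum_repr x]
    simp only [map_sum, map_smul, LinearMap.sum_apply, LinearMap.smul_apply, smul_eq_mul]
  -- evaluation of the forms on basis vectors
  have ev : ∀ (b : LinearMap.BilinForm K V) (x y : V) (p₀ : Σ k, Fin (2 * d k + 1)),
      (∀ p, p ≠ p₀ → b (e p) y = 0) → b x y = e.repr x p₀ * b (e p₀) y := by
    intro b x y p₀ h
    rw [expand, Finset.sum_eq_single p₀]
    · intro p _ hp; rw [h p hp, mul_zero]
    · simp
  have sig : ∀ (k : Fin R) (i : ℕ) (hi : i < 2 * d k + 1) (p : Σ k, Fin (2 * d k + 1)),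
      p ≠ ⟨k, ⟨i, hi⟩⟩ → p.1 = k → (p.2 : ℕ) ≠ i := by
    rintro k i hi ⟨k', p⟩ hp rfl rfl
    exact hp rfl
  have e1o : ∀ x k i (hi : 2 * i + 1 < 2 * d k + 1),
      b₁ x (e ⟨k, ⟨2 * i + 1, hi⟩⟩) = e.repr x ⟨k, ⟨2 * i, by omega⟩⟩ := by
    intro x k i hi
    rw [ev b₁ x _ ⟨k, ⟨2 * i, by omega⟩⟩, (he _ _).1, if_pos rfl, kronecker₁]
    · simp
    · intro p hp
      rw [(he _ _).1]
      split_ifs with hpk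
      · have := sig _ _ _ p hp hpk
        rw [kronecker₁, if_neg, if_neg]
        · rintro ⟨⟨m, hm⟩, -⟩; simp only at hm; omega
        · rintro ⟨-, h⟩; simp only at h; omega
      · rfl
  have e1e : ∀ x k i (hi : 2 * i + 1 < 2 * d k + 1),
      b₁ x (e ⟨k, ⟨2 * i, by omega⟩⟩) = - e.repr x ⟨k, ⟨2 * i + 1, hi⟩⟩ := by
    intro x k i hi
    rw [ev b₁ x _ ⟨k, ⟨2 * i + 1, hi⟩⟩, (he _ _).1, if_pos rfl, kronecker₁, if_neg (by grind),
      if_pos ⟨by simp, rfl⟩, mul_neg_one]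
    · intro p hp
      rw [(he _ _).1]
      split_ifs with hpk
      · have := sig _ _ _ p hp hpk
        rw [kronecker₁, if_neg, if_neg]
        · rintro ⟨-, h⟩; simp only at h; omega
        · rintro ⟨⟨m, hm⟩, h⟩; simp only at h; omega
      · rfl
  have e2o : ∀ x k i (hi : 2 * i + 2 < 2 * d k + 1),
      b₂ x (e ⟨k, ⟨2 * i + 1, by omega⟩⟩) = - e.repr x ⟨k, ⟨2 * i + 2, hi⟩⟩ := by
    intro x k i hi
    rw [ev b₂ x _ ⟨k, ⟨2 * i + 2, hi⟩⟩, (he _ _).2, if_pos rfl, kronecker₂, if_neg (by grind),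
      if_pos ⟨by simp, rfl⟩, mul_neg_one]
    · intro p hp
      rw [(he _ _).2]
      split_ifs with hpk
      · have := sig _ _ _ p hp hpk
        rw [kronecker₂, if_neg, if_neg]
        · rintro ⟨-, h⟩; simp only at h; omega
        · rintro ⟨⟨m, hm⟩, h⟩; simp only at h; omega
      · rfl
  have e2e : ∀ x k i (hi : 2 * i + 2 < 2 * d k + 1),
      b₂ x (e ⟨k, ⟨2 * i + 2, hi⟩⟩) = e.repr x ⟨k, ⟨2 * i + 1, by omega⟩⟩ := by
    intro x k i hi
    rw [ev b₂ x _ ⟨k, ⟨2 * i + 1, by omega⟩⟩, (he _ _).2, if_pos rfl, kronecker₂,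
      if_pos ⟨by simp, rfl⟩, mul_one]
    · intro p hp
      rw [(he _ _).2]
      split_ifs with hpk
      · have := sig _ _ _ p hp hpk
        rw [kronecker₂, if_neg, if_neg]
        · rintro ⟨⟨m, hm⟩, -⟩; simp only at hm; omega
        · rintro ⟨-, h⟩; simp only at h; omega
      · rfl
  have e20 : ∀ x k, b₂ x (e ⟨k, ⟨0, by omega⟩⟩) = 0 := by
    intro x k
    rw [expand]
    refine Finset.sum_eq_zero fun p _ => ?_
    rw [(he _ _).2]
    split_ifs with hpk
    · rw [kronecker₂, if_neg, if_neg, mul_zero]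
      · rintro ⟨h, -⟩; simp at h
      · rintro ⟨-, h⟩; simp at h
    · exact mul_zero _
  -- the coordinates of an element of the kernel
  let f : polynomialKernel b₁ b₂ q →ₗ[K] ((Σ k, Fin (q - d k)) → K) :=
    { toFun := fun x s => e.repr ((x : ℕ → V) s.2) ⟨s.1, ⟨0, by omega⟩⟩
      map_add' := fun x y => by ext s; simp
      map_smul' := fun c x => by ext s; simp }
  have coord : ∀ x : polynomialKernel b₁ b₂ q, ∀ k,
      (∀ i (hi : 2 * i + 1 < 2 * d k + 1), ∀ j, e.repr ((x : ℕ → V) j) ⟨k, ⟨2 * i + 1, hi⟩⟩ = 0) ∧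
      (∀ i (hi : 2 * i < 2 * d k + 1), ∀ j, e.repr ((x : ℕ → V) j) ⟨k, ⟨2 * i, hi⟩⟩ =
        if i ≤ j then e.repr ((x : ℕ → V) (j - i)) ⟨k, ⟨0, by omega⟩⟩ else 0) := by
    rintro ⟨x, hx, hx0, hx1⟩ k
    have hx1' : ∀ j y, b₁ (x j) y + b₂ (x (j + 1)) y = 0 := fun j y =>
      LinearMap.congr_fun (hx1 j) y
    have hx0' : ∀ y, b₂ (x 0) y = 0 := fun y => LinearMap.congr_fun hx0 y
    constructor
    · intro i
      induction i with
      | zero =>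
        intro hi j
        have h := hx1' j (e ⟨k, ⟨2 * 0, by omega⟩⟩)
        rw [e1e _ _ _ hi] at h
        have h' := e20 (x (j + 1)) k
        simp only [mul_zero, zero_add] at h ⊢
        rw [h', add_zero, neg_eq_zero] at h
        exact h
      | succ i ih =>
        intro hi j
        have h := hx1' j (e ⟨k, ⟨2 * (i + 1), by omega⟩⟩)
        rw [e1e _ _ _ hi] at h
        have h' := e2e (x (j + 1)) k i (by omega)
        rw [ih] at h'
        change _ + b₂ (x (j + 1)) (e ⟨k, ⟨2 * i + 2, _⟩⟩) = 0 at h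
        rw [h', add_zero, neg_eq_zero] at h
        exact h
    · intro i
      induction i with
      | zero => intro hi j; simp
      | succ i ih =>
        intro hi j
        cases j with
        | zero =>
          have h := hx0' (e ⟨k, ⟨2 * i + 1, by omega⟩⟩)
          rw [e2o _ _ _ hi, neg_eq_zero] at h
          rw [if_neg (by omega)]
          exact h
        | succ j =>
          have h := hx1' j (e ⟨k, ⟨2 * i + 1, by omega⟩⟩)
          rw [e2o _ _ _ hi, e1o _ _ _ (by omega), ih, ← sub_eq_add_neg, sub_eq_zero] at h
          simp only [add_le_add_iff_right, Nat.add_sub_add_right]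
          exact h.symm
  have hinj : Function.Injective f := by
    rw [injective_iff_map_eq_zero]
    intro x hfx
    -- A coordinate along w₀ in degree j reappears along w_{2d} in degree j + d, where x vanishes if
    -- j + d ≥ q.
    have h0 : ∀ k j, e.repr ((x : ℕ → V) j) ⟨k, ⟨0, by omega⟩⟩ = 0 := by
      intro k j
      by_cases hj : j < q - d k
      · exact congrFun hfx ⟨k, ⟨j, hj⟩⟩
      · have h := (coord x k).2 (d k) (by omega) (j + d k)
        rw [if_pos (by omega), Nat.add_sub_cancel, x.2.1 _ (by omega)] at h
        simpa using h.symm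
    apply Subtype.ext
    funext j
    refine e.ext_elem fun ⟨k, p⟩ => ?_
    have hp2 := p.2
    change e.repr ((x : ℕ → V) j) ⟨k, p⟩ = e.repr (0 : V) ⟨k, p⟩
    rw [map_zero, Finsupp.zero_apply]
    obtain ⟨i, hi | hi⟩ := Nat.even_or_odd' (p : ℕ)
    · have hp : p = ⟨2 * i, by omega⟩ := Fin.ext hi
      rw [hp, (coord x k).2, h0, ite_self]
    · have hp : p = ⟨2 * i + 1, by omega⟩ := Fin.ext hi
      rw [hp, (coord x k).1]
  have hsurj : Function.Surjective f := by
    let n : Fin R → ℕ → V := fun k i => if h : i ≤ d k then e ⟨k, ⟨2 * i, by omega⟩⟩ else 0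
    have n_le : ∀ k i (h : i ≤ d k), n k i = e ⟨k, ⟨2 * i, by omega⟩⟩ := fun k i h => dif_pos h
    have hb : ∀ b b' : V →ₗ[K] K, (∀ p, b (e p) = b' (e p)) → b = b' := fun b b' h => e.ext h
    have n20 : ∀ k, b₂ (n k 0) = 0 := by
      intro k
      rw [n_le k 0 (by omega)]
      refine hb _ _ fun p => ?_
      rw [(he _ _).2, LinearMap.zero_apply]
      split_ifs
      · rw [kronecker₂, if_neg, if_neg]
        · rintro ⟨-, h⟩; simp at h
        · rintro ⟨h, -⟩; simp at h
      · rfl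
    have n1 : ∀ k i, b₁ (n k i) + b₂ (n k (i + 1)) = 0 := by
      intro k i
      refine hb _ _ fun p => ?_
      rw [LinearMap.add_apply, LinearMap.zero_apply]
      rcases lt_trichotomy i (d k) with h | h | h
      · rw [n_le k i h.le, n_le k (i + 1) h, (he _ _).1, (he _ _).2]
        split_ifs
        · simp only [kronecker₁, kronecker₂]
          grind
        · simp
      · rw [n_le k i h.le]
        have : n k (i + 1) = 0 := dif_neg (by omega)
        rw [this, (he _ _).1]
        split_ifs with hk
        · have hp2 := p.2.2
          have hdk : d k = d p.1 := congrArg d hk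
          rw [kronecker₁, if_neg, if_neg]
          · simp
          · rintro ⟨⟨m, hm⟩, h⟩; simp only at h; omega
          · rintro ⟨-, h⟩; simp only at h hp2; omega
        · simp
      · have h3 : n k (i + 1) = 0 := dif_neg (by omega)
        have h4 : n k i = 0 := dif_neg (by omega)
        simp [h3, h4]
    -- The generator of the k-th block multiplied by X^s.
    have hmem : ∀ s : (Σ k, Fin (q - d k)),
        (fun j => if (s.2 : ℕ) ≤ j then n s.1 (j - s.2) else 0) ∈ polynomialKernel b₁ b₂ q := by
      rintro ⟨k, s⟩
      have hs := s.2
      refine ⟨fun j hj => ?_, ?_, fun j => ?_⟩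
      · simp only
        split_ifs
        · exact dif_neg (by omega)
        · rfl
      · simp only
        split_ifs
        · rw [Nat.zero_sub]; exact n20 k
        · exact map_zero _
      · simp only
        rcases lt_trichotomy (j + 1) s with h | h | h
        · rw [if_neg (by omega), if_neg (by omega), map_zero, map_zero, add_zero]
        · rw [if_neg (by omega), if_pos (by omega), map_zero, zero_add,
            show j + 1 - (s : ℕ) = 0 by omega, n20]
        · rw [if_pos (by omega), if_pos (by omega),
            show j + 1 - (s : ℕ) = (j - s) + 1 by omega, n1]
    rw [← LinearMap.range_eq_top, eq_top_iff, ← (Pi.basisFun K _).span_eq, Submodule.span_le]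
    rintro _ ⟨s, rfl⟩
    refine ⟨⟨_, hmem s⟩, ?_⟩
    funext s'
    rw [Pi.basisFun_apply]
    obtain ⟨k, s⟩ := s
    obtain ⟨k', s'⟩ := s'
    change e.repr (if (s : ℕ) ≤ s' then n k (s' - s) else 0) ⟨k', ⟨0, _⟩⟩ = _
    rw [Pi.single_apply]
    split_ifs with h3 h4 h4
    · obtain rfl : k' = k := congrArg Sigma.fst h4
      have : s' = s := eq_of_heq (Sigma.mk.inj h4).2
      rw [this, Nat.sub_self, n_le _ _ (by omega)]
      simp
    · simp only [n]
      split_ifs with h5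
      · rw [e.repr_self, Finsupp.single_apply, if_neg]
        intro h6
        apply h4
        obtain rfl : k = k' := congrArg Sigma.fst h6
        have h7 := Fin.ext_iff.mp (eq_of_heq (Sigma.mk.inj h6).2)
        simp only at h7
        congr 1
        exact Fin.ext (by omega)
      · simp
    · exfalso
      obtain rfl : k' = k := congrArg Sigma.fst h4
      have : s' = s := eq_of_heq (Sigma.mk.inj h4).2
      exact h3 (this ▸ le_rfl)
    · simp
  rw [(LinearEquiv.ofBijective f ⟨hinj, hsurj⟩).finrank_eq]
  simp

/-- The first difference in q of ∑ (q - d k) counts the k with d k ≤ q, and the second difference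
counts those with a given value. -/
theorem exists_perm_of_sum_sub_eq {R Q : ℕ} {d d' : Fin R → ℕ} (hd : ∀ k, d k ≤ Q)
    (hd' : ∀ k, d' k ≤ Q) (h : ∀ q ≤ Q + 1, ∑ k, (q - d k) = ∑ k, (q - d' k)) :
    ∃ σ : Equiv.Perm (Fin R), ∀ k, d' (σ k) = d k := by
  have step : ∀ (d : Fin R → ℕ) q, ∑ k, (q + 1 - d k) =
      ∑ k, (q - d k) + (Finset.univ.filter fun k => d k ≤ q).card := by
    intro d q
    rw [Finset.card_filter, ← Finset.sum_add_distrib]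
    refine Finset.sum_congr rfl fun k _ => ?_
    split_ifs <;> omega
  have hle : ∀ q, (Finset.univ.filter fun k => d k ≤ q).card =
      (Finset.univ.filter fun k => d' k ≤ q).card := by
    intro q
    by_cases hq : q ≤ Q
    · have h1 := step d q
      have h2 := step d' q
      rw [h q (by omega), h (q + 1) (by omega)] at h1
      omega
    · rw [Finset.filter_true_of_mem fun k _ => (hd k).trans (by omega),
        Finset.filter_true_of_mem fun k _ => (hd' k).trans (by omega)]
  have split : ∀ (d : Fin R → ℕ) q, (Finset.univ.filter fun k => d k ≤ q + 1).card =
      (Finset.univ.filter fun k => d k ≤ q).card +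
        (Finset.univ.filter fun k => d k = q + 1).card := by
    intro d q
    simp only [Finset.card_filter]
    rw [← Finset.sum_add_distrib]
    refine Finset.sum_congr rfl fun k _ => ?_
    split_ifs <;> omega
  have heq : ∀ q, (Finset.univ.filter fun k => d k = q).card =
      (Finset.univ.filter fun k => d' k = q).card := by
    intro q
    cases q with
    | zero => simpa using hle 0
    | succ q =>
      have h1 := split d q
      have h2 := split d' q
      rw [hle, hle] at h1
      omega
  have key : ∀ q, Nonempty ({k // d k = q} ≃ {k // d' k = q}) := fun q =>
    Fintype.card_eq.mp (by rw [Fintype.card_subtype, Fintype.card_subtype, heq])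
  refine ⟨(Equiv.sigmaFiberEquiv d).symm.trans ((Equiv.sigmaCongrRight fun q => (key q).some).trans
    (Equiv.sigmaFiberEquiv d')), fun k => ?_⟩
  exact ((key (d k)).some ⟨k, rfl⟩).2

open Bihamiltonian in
theorem IsKroneckerSum.perm {K V : Type*} [Field K] [AddCommGroup V] [Module K V]
    {b₁ b₂ : LinearMap.BilinForm K V} {R : ℕ} {t t' : Fin R → ℕ} (h : IsKroneckerSum b₁ b₂ t')
    (σ : Equiv.Perm (Fin R)) (hσ : ∀ k, t' (σ k) = t k) : IsKroneckerSum b₁ b₂ t := by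
  obtain rfl : (fun k => t' (σ k)) = t := funext hσ
  obtain ⟨hodd, e, he⟩ := h
  refine ⟨fun k => hodd _, e.reindex (Equiv.sigmaCongrLeft (β := fun k => Fin (t' k)) σ).symm,
    fun x y => ?_⟩
  rw [Basis.reindex_apply, Basis.reindex_apply, Equiv.symm_symm]
  obtain ⟨h8, h9⟩ := he (Equiv.sigmaCongrLeft σ x) (Equiv.sigmaCongrLeft σ y)
  rw [h8, h9]
  simp [Equiv.sigmaCongrLeft]

/-! ### Smoothness of superposition operators -/

section Superposition

open Topology

universe w

/-- Pointwise evaluation of a continuous family of continuous linear maps. -/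
noncomputable def pointwiseApply (𝕜 K : Type*) [RCLike 𝕜] [TopologicalSpace K] [CompactSpace K]
    (A B : Type*) [NormedAddCommGroup A] [NormedSpace 𝕜 A] [NormedAddCommGroup B]
    [NormedSpace 𝕜 B] : C(K, A →L[𝕜] B) →L[𝕜] C(K, A) →L[𝕜] C(K, B) :=
  LinearMap.mkContinuous₂
    (LinearMap.mk₂ 𝕜 (fun (T : C(K, A →L[𝕜] B)) (a : C(K, A)) =>
        (⟨fun s => T s (a s), T.continuous.clm_apply a.continuous⟩ : C(K, B)))
      (fun _ _ _ => by ext; simp) (fun _ _ _ => by ext; simp) (fun _ _ _ => by ext; simp)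
      (fun _ _ _ => by ext; simp)) 1 (fun T a => by
      rw [one_mul]
      refine (ContinuousMap.norm_le _ (by positivity)).mpr fun s => ?_
      exact ((T s).le_opNorm _).trans
        (mul_le_mul (T.norm_coe_le_norm s) (a.norm_coe_le_norm s) (norm_nonneg _) (norm_nonneg T)))

variable {𝕜 : Type*} [RCLike 𝕜] {K : Type*} [TopologicalSpace K]

section Compact

variable [CompactSpace K]

@[simp]
theorem pointwiseApply_apply {A B : Type*} [NormedAddCommGroup A] [NormedSpace 𝕜 A]
    [NormedAddCommGroup B] [NormedSpace 𝕜 B] (T : C(K, A →L[𝕜] B)) (a : C(K, A)) (s : K) :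
    pointwiseApply 𝕜 K A B T a s = T s (a s) := rfl

end Compact

open Classical in
/-- The superposition operator `x ↦ g ∘ x` on continuous maps, with junk value `0`. -/
noncomputable def superpose {A B : Type*} [TopologicalSpace A] [TopologicalSpace B] [Zero B]
    (g : A → B) (x : C(K, A)) : C(K, B) :=
  if h : Continuous fun s => g (x s) then ⟨_, h⟩ else 0

theorem superpose_apply {A B : Type*} [TopologicalSpace A] [TopologicalSpace B] [Zero B]
    {g : A → B} {O : Set A} (hg : ContinuousOn g O) {x : C(K, A)} (hx : ∀ s, x s ∈ O) (s : K) :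
    superpose g x s = g (x s) := by
  have : Continuous fun s => g (x s) := hg.comp_continuous x.continuous hx
  simp [superpose, this]

variable [CompactSpace K]

theorem isOpen_forall_mem {A : Type*} [TopologicalSpace A] {O : Set A} (hO : IsOpen O) :
    IsOpen {x : C(K, A) | ∀ s, x s ∈ O} := by
  have := ContinuousMap.isOpen_setOfPred_mapsTo (X := K) isCompact_univ hO
  simpa [Set.MapsTo] using this

variable {E : Type w} [NormedAddCommGroup E] [NormedSpace 𝕜 E]

/-- Compactness of the range of x makes the first-order expansion of g uniform along x. -/
theorem hasFDerivAt_superpose {F : Type*} [NormedAddCommGroup F] [NormedSpace 𝕜 F] {O : Set E}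
    (hO : IsOpen O) {g : E → F} (hg : ContDiffOn 𝕜 ∞ g O) {x : C(K, E)} (hx : ∀ s, x s ∈ O) :
    HasFDerivAt (superpose g : C(K, E) → C(K, F))
      (pointwiseApply 𝕜 K E F (superpose (fderiv 𝕜 g) x)) x := by
  have hg' : ContinuousOn (fderiv 𝕜 g) O := hg.continuousOn_fderiv_of_isOpen hO (by simp)
  rw [hasFDerivAt_iff_isLittleO_nhds_zero, Asymptotics.isLittleO_iff]
  intro ε hε
  have key : ∀ᶠ h : E in 𝓝 0, ∀ y ∈ Set.range x,
      ‖g (y + h) - g y - fderiv 𝕜 g y h‖ ≤ ε * ‖h‖ := by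
    refine (isCompact_range x.continuous).eventually_forall_of_forall_eventually ?_
    rintro _ ⟨s, rfl⟩
    have hs : O ∈ 𝓝 (x s) := hO.mem_nhds (hx s)
    have h1 : HasStrictFDerivAt g (fderiv 𝕜 g (x s)) (x s) :=
      (hg.contDiffAt hs).hasStrictFDerivAt (by simp)
    have h2 := h1.isLittleO.def (half_pos hε)
    have h3 : ∀ᶠ y in 𝓝 (x s), ‖fderiv 𝕜 g y - fderiv 𝕜 g (x s)‖ < ε / 2 := by
      have := (hg'.continuousAt hs).tendsto
      rw [tendsto_iff_norm_sub_tendsto_zero] at this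
      exact this.eventually_lt_const (half_pos hε)
    have t1 : Filter.Tendsto (fun z : E × E => (z.2 + z.1, z.2)) (𝓝 (0, x s))
        (𝓝 (x s, x s)) := by
      have : Continuous fun z : E × E => (z.2 + z.1, z.2) := by fun_prop
      simpa using this.tendsto (0, x s)
    have t2 : Filter.Tendsto (fun z : E × E => z.2) (𝓝 (0, x s)) (𝓝 (x s)) :=
      continuous_snd.tendsto _
    filter_upwards [t1.eventually h2, t2.eventually h3] with z hz1 hz2
    simp only [add_sub_cancel_left] at hz1
    have e : g (z.2 + z.1) - g z.2 - fderiv 𝕜 g z.2 z.1 =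
        (g (z.2 + z.1) - g z.2 - fderiv 𝕜 g (x s) z.1) -
          (fderiv 𝕜 g z.2 - fderiv 𝕜 g (x s)) z.1 := by
      rw [sub_apply]; abel
    rw [e]
    refine (norm_sub_le _ _).trans ?_
    have h4 := ((fderiv 𝕜 g z.2 - fderiv 𝕜 g (x s)).le_opNorm z.1).trans
      (mul_le_mul_of_nonneg_right hz2.le (norm_nonneg _))
    linarith
  obtain ⟨δ, hδ, hball⟩ := Metric.eventually_nhds_iff.mp key
  have hopen : ∀ᶠ h : C(K, E) in 𝓝 0, ∀ s, (x + h) s ∈ O := by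
    have : Filter.Tendsto (fun h : C(K, E) => x + h) (𝓝 0) (𝓝 x) := by
      have : Continuous fun h : C(K, E) => x + h := by fun_prop
      simpa using this.tendsto 0
    exact this.eventually ((isOpen_forall_mem hO).mem_nhds hx)
  filter_upwards [hopen, Metric.ball_mem_nhds 0 hδ] with h hh hhδ
  rw [ContinuousMap.norm_le _ (by positivity)]
  intro s
  have hs : ‖h s‖ ≤ ‖h‖ := h.norm_coe_le_norm s
  have h5 := hball (y := h s) (by
    rw [dist_zero_right]; exact hs.trans_lt (by simpa using hhδ)) (x s) ⟨s, rfl⟩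
  simp only [ContinuousMap.sub_apply, pointwiseApply_apply]
  rw [superpose_apply hg.continuousOn hh, superpose_apply hg.continuousOn hx,
    superpose_apply hg' hx, ContinuousMap.add_apply]
  exact h5.trans (mul_le_mul_of_nonneg_left hs hε.le)

/-- The derivative of superposition by g is superposition by `fderiv 𝕜 g` followed by the fixed
linear map `pointwiseApply`, so induction applies with a new target space. -/
theorem contDiffOn_superpose {O : Set E} (hO : IsOpen O) (n : ℕ) :
    ∀ {F : Type w} [NormedAddCommGroup F] [NormedSpace 𝕜 F] {g : E → F}, ContDiffOn 𝕜 ∞ g O →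
      ContDiffOn 𝕜 n (superpose g : C(K, E) → C(K, F)) {x | ∀ s, x s ∈ O} := by
  induction n with
  | zero =>
    intro F _ _ g hg
    refine contDiffOn_zero.mpr fun x hx => ?_
    exact (hasFDerivAt_superpose hO hg hx).continuousAt.continuousWithinAt
  | succ n ih =>
    intro F _ _ g hg
    have hd := fun x hx => hasFDerivAt_superpose (K := K) hO hg (x := x) hx
    rw [Nat.cast_succ, contDiffOn_succ_iff_fderiv_of_isOpen (isOpen_forall_mem hO)]
    refine ⟨fun x hx => (hd x hx).differentiableAt.differentiableWithinAt, ?_, ?_⟩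
    · intro h
      exact absurd h (by simp)
    · have h1 := ih (g := fderiv 𝕜 g) ((contDiffOn_infty_iff_fderiv_of_isOpen hO).mp hg).2
      refine ContDiffOn.congr ((pointwiseApply 𝕜 K E F).contDiff.comp_contDiffOn h1) ?_
      intro x hx
      exact (hd x hx).fderiv

end Superposition

/-! ### Inverse function theorem on an open set -/

section InverseFunction

open Topology

variable {𝕜 : Type*} [RCLike 𝕜] {X Y : Type*} [NormedAddCommGroup X] [NormedSpace 𝕜 X]
  [NormedAddCommGroup Y] [NormedSpace 𝕜 Y] [CompleteSpace X]

/-- Invertible derivatives form an open set, so the local inverse is smooth on a whole neighbourhood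
and not only at f a. -/
theorem exists_smooth_local_inverse {f : X → Y} {U : Set X} (hU : IsOpen U)
    (hf : ContDiffOn 𝕜 ∞ f U) {a : X} (ha : a ∈ U) {f' : X ≃L[𝕜] Y}
    (hf' : HasFDerivAt f (f' : X →L[𝕜] Y) a) :
    ∃ (g : Y → X) (V : Set Y), IsOpen V ∧ f a ∈ V ∧ ContDiffOn 𝕜 ∞ g V ∧ g (f a) = a ∧
      ∀ y ∈ V, g y ∈ U ∧ f (g y) = y := by
  have hfa := hf.contDiffAt (hU.mem_nhds ha)
  let e := hfa.toOpenPartialHomeomorph f hf' (by simp)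
  have hecoe : (e : X → Y) = f := rfl
  have hasrc : a ∈ e.source := hfa.mem_toOpenPartialHomeomorph_source hf' (by simp)
  have hc : ContinuousAt (fderiv 𝕜 f) a :=
    (hf.continuousOn_fderiv_of_isOpen hU (by simp)).continuousAt (hU.mem_nhds ha)
  have hinv : ∀ᶠ x in 𝓝 a, fderiv 𝕜 f x ∈
      Set.range (ContinuousLinearEquiv.toContinuousLinearMap : (X ≃L[𝕜] Y) → X →L[𝕜] Y) := by
    apply hc.eventually
    rw [hf'.fderiv]
    exact f'.nhds
  have hev : ∀ᶠ x in 𝓝 a, x ∈ U ∧ fderiv 𝕜 f x ∈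
      Set.range (ContinuousLinearEquiv.toContinuousLinearMap : (X ≃L[𝕜] Y) → X →L[𝕜] Y) :=
    Filter.Eventually.and (hU.mem_nhds ha) hinv
  obtain ⟨U', hU', hU'o, haU'⟩ := eventually_nhds_iff.mp hev
  refine ⟨e.symm, e.target ∩ e.symm ⁻¹' U', e.isOpen_inter_preimage_symm hU'o, ?_, ?_, ?_, ?_⟩
  · refine ⟨e.map_source hasrc, ?_⟩
    change e.symm (e a) ∈ U'
    rw [e.left_inv hasrc]; exact haU'
  · rintro y ⟨hy, hyU⟩
    obtain ⟨hyU1, L, hL⟩ := hU' _ hyU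
    have hd := hf.contDiffAt (hU.mem_nhds hyU1)
    refine (e.contDiffAt_symm (f₀' := L) hy ?_ hd).contDiffWithinAt
    rw [hL]
    exact (hd.differentiableAt (by simp)).hasFDerivAt
  · exact e.left_inv hasrc
  · rintro y ⟨hy, hyU⟩
    exact ⟨(hU' _ hyU).1, e.right_inv hy⟩

end InverseFunction

/-! ### Dependence of solutions on parameters -/

section Flow

open Topology

universe w

section Extend

variable {E : Type*} [TopologicalSpace E]

/-- The extension of a continuous map on the unit interval to the line. -/
noncomputable def extendUnit (u : C(unitInterval, E)) (t : ℝ) : E :=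
  u (Set.projIcc 0 1 zero_le_one t)

theorem continuous_extendUnit (u : C(unitInterval, E)) : Continuous (extendUnit u) :=
  u.continuous.comp continuous_projIcc

theorem extendUnit_of_mem (u : C(unitInterval, E)) {t : ℝ} (ht : t ∈ unitInterval) :
    extendUnit u t = u ⟨t, ht⟩ := by
  rw [extendUnit, Set.projIcc_of_mem _ ht]

end Extend

variable {𝕜 : Type*} [RCLike 𝕜]

variable {E : Type w} [NormedAddCommGroup E] [NormedSpace 𝕜 E]
  {F : Type w} [NormedAddCommGroup F] [NormedSpace 𝕜 F]

variable (𝕜 E F) in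
/-- A vector and a path as a path of pairs. -/
noncomputable def pairPath : F × C(unitInterval, E) →L[𝕜] C(unitInterval, F × E) :=
  LinearMap.mkContinuous
    { toFun := fun z => (ContinuousMap.const unitInterval z.1).prodMk z.2
      map_add' := fun _ _ => rfl
      map_smul' := fun _ _ => rfl } 1 (fun z => by
    rw [one_mul]
    refine (ContinuousMap.norm_le _ (norm_nonneg z)).mpr fun t => ?_
    exact max_le_max le_rfl (z.2.norm_coe_le_norm t))

theorem pairPath_apply (z : F × C(unitInterval, E)) (t : unitInterval) :
    pairPath 𝕜 E F z t = (z.1, z.2 t) := rfl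

theorem hasFDerivAt_apply_fst {S : E → F →L[𝕜] E} {q : F × E} (h : DifferentiableAt 𝕜 S q.2) :
    HasFDerivAt (fun q : F × E => S q.2 q.1)
      (S q.2 ∘L ContinuousLinearMap.fst 𝕜 F E +
        (fderiv 𝕜 S q.2).flip q.1 ∘L ContinuousLinearMap.snd 𝕜 F E) q := by
  have h1 : HasFDerivAt (fun q : F × E => S q.2) _ q := h.hasFDerivAt.comp q hasFDerivAt_snd
  refine (h1.clm_apply hasFDerivAt_fst).congr_fderiv ?_
  ext <;> simp

variable [NormedSpace ℝ E] [IsScalarTower ℝ 𝕜 E]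

variable (𝕜 E) in
/-- The operator `u ↦ ∫₀ᵗ u`. -/
noncomputable def primitive : C(unitInterval, E) →L[𝕜] C(unitInterval, E) :=
  LinearMap.mkContinuous
    { toFun := fun u => ⟨fun t => ∫ s in (0 : ℝ)..t, extendUnit u s,
        (intervalIntegral.continuous_primitive
          (fun _ _ => (continuous_extendUnit u).intervalIntegrable _ _) 0).comp
          continuous_subtype_val⟩
      map_add' := fun u v => by
        ext t
        exact intervalIntegral.integral_add ((continuous_extendUnit u).intervalIntegrable _ _)
          ((continuous_extendUnit v).intervalIntegrable _ _)
      map_smul' := fun c u => by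
        ext t
        exact intervalIntegral.integral_smul c (extendUnit u) } 1 (fun u => by
    rw [one_mul]
    refine (ContinuousMap.norm_le _ (norm_nonneg u)).mpr fun t => ?_
    have h := intervalIntegral.norm_integral_le_of_norm_le_const (a := 0) (b := (t : ℝ))
      (f := extendUnit u) (C := ‖u‖) (fun s _ => u.norm_coe_le_norm _)
    refine h.trans ?_
    rw [sub_zero, abs_of_nonneg t.2.1]
    exact mul_le_of_le_one_right (norm_nonneg u) t.2.2)

/-- The solutions of `β' = S β ξ`, `β 0 = y` on the unit interval depend smoothly on `(ξ, y)`. -/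
theorem exists_smooth_solution [CompleteSpace E] [CompleteSpace F] {O : Set E} (hO : IsOpen O)
    {S : E → F →L[𝕜] E} (hS : ContDiffOn 𝕜 ∞ S O) {x₀ : E} (hx₀ : x₀ ∈ O) :
    ∃ (B : F × E → C(unitInterval, E)) (N : Set (F × E)), IsOpen N ∧ (0, x₀) ∈ N ∧
      ContDiffOn 𝕜 ∞ B N ∧ ∀ p ∈ N, (∀ t, B p t ∈ O) ∧
        B p = ContinuousLinearMap.const 𝕜 unitInterval p.2 +
          primitive 𝕜 E (superpose (fun q : F × E => S q.2 q.1)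
            (pairPath 𝕜 E F (p.1, B p))) := by
  let c : E →L[𝕜] C(unitInterval, E) := ContinuousLinearMap.const 𝕜 unitInterval
  let J := primitive 𝕜 E
  let G : F × E → E := fun q => S q.2 q.1
  let O' : Set (F × E) := Prod.snd ⁻¹' O
  have hO' : IsOpen O' := hO.preimage continuous_snd
  have hG : ContDiffOn 𝕜 ∞ G O' :=
    (hS.comp contDiff_snd.contDiffOn fun q hq => hq).clm_apply contDiff_fst.contDiffOn
  let Q : (F × E) × C(unitInterval, E) →L[𝕜] C(unitInterval, F × E) :=
    pairPath 𝕜 E F ∘L (ContinuousLinearMap.fst 𝕜 F E).prodMap (.id 𝕜 C(unitInterval, E))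
  -- Zeros of Φ are solutions of the integral equation. H keeps the parameters as a component, so
  -- inverting it solves Φ = 0 for the path.
  let Φ : (F × E) × C(unitInterval, E) → C(unitInterval, E) := fun z =>
    z.2 - (c z.1.2 + J (superpose G (Q z)))
  let H : (F × E) × C(unitInterval, E) → (F × E) × C(unitInterval, E) := fun z => (z.1, Φ z)
  let U : Set ((F × E) × C(unitInterval, E)) := {z | ∀ t, z.2 t ∈ O}
  have hU : IsOpen U := (isOpen_forall_mem hO).preimage continuous_snd
  have hsup : ContDiffOn 𝕜 ∞ (fun z : (F × E) × C(unitInterval, E) => superpose G (Q z)) U :=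
    (contDiffOn_infty.mpr fun n => contDiffOn_superpose (K := unitInterval) hO' n hG).comp
      Q.contDiff.contDiffOn fun z hz => hz
  have hH : ContDiffOn 𝕜 ∞ H U := by
    refine contDiff_fst.contDiffOn.prodMk (contDiff_snd.contDiffOn.sub (ContDiffOn.add ?_ ?_))
    · exact (c.contDiff.comp (contDiff_snd.comp contDiff_fst)).contDiffOn
    · exact J.contDiff.comp_contDiffOn hsup
  let a : (F × E) × C(unitInterval, E) := ((0, x₀), c x₀)
  have ha : a ∈ U := fun t => hx₀
  let G' := pointwiseApply 𝕜 unitInterval (F × E) E (superpose (fderiv 𝕜 G) (Q a))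
  -- G is linear in its first argument, which is 0 at a, so its derivative there ignores the path
  -- direction. Hence Φ has identity derivative in the path, and the derivative of H is a shear.
  have hG' : ∀ v w, G' (pairPath 𝕜 E F (v, w)) = G' (pairPath 𝕜 E F (v, 0)) := by
    intro v w
    ext t
    have h1 : ContinuousOn (fderiv 𝕜 G) O' := hG.continuousOn_fderiv_of_isOpen hO' (by simp)
    simp only [G', pointwiseApply_apply]
    rw [superpose_apply h1 (fun t => hx₀)]
    have h2 := hasFDerivAt_apply_fst (S := S) (q := Q a t)
      ((hS.contDiffAt (hO.mem_nhds hx₀)).differentiableAt (by simp))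
    rw [h2.fderiv]
    simp [pairPath_apply, Q, a]
  let L : (F × E) →L[𝕜] C(unitInterval, E) :=
    -(c ∘L ContinuousLinearMap.snd 𝕜 F E + J ∘L G' ∘L pairPath 𝕜 E F ∘L
      ContinuousLinearMap.inl 𝕜 F C(unitInterval, E) ∘L ContinuousLinearMap.fst 𝕜 F E)
  let f' := ContinuousLinearEquiv.skewProd (ContinuousLinearEquiv.refl 𝕜 (F × E))
    (ContinuousLinearEquiv.refl 𝕜 C(unitInterval, E)) L
  have hf' : HasFDerivAt H (f' : ((F × E) × C(unitInterval, E)) →L[𝕜] _) a := by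
    have hs : HasFDerivAt (fun z : (F × E) × C(unitInterval, E) => superpose G (Q z)) (G' ∘L Q) a :=
      (hasFDerivAt_superpose hO' hG (x := Q a) fun t => hx₀).comp a Q.hasFDerivAt
    have h2 : HasFDerivAt (fun z : (F × E) × C(unitInterval, E) => c z.1.2) _ a :=
      (c ∘L ContinuousLinearMap.snd 𝕜 F E ∘L
        ContinuousLinearMap.fst 𝕜 (F × E) C(unitInterval, E)).hasFDerivAt
    have h3 := hasFDerivAt_snd.sub (h2.add (J.hasFDerivAt.comp a hs))
    have h4 := (hasFDerivAt_fst (𝕜 := 𝕜) (p := a)).prodMk h3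
    refine h4.congr_fderiv ?_
    refine ContinuousLinearMap.ext fun z => ?_
    refine Prod.ext rfl ?_
    have h5 : G' (Q z) = G' (pairPath 𝕜 E F (z.1.1, 0)) := hG' _ _
    simp [f', L, h5]
    abel
  obtain ⟨g, V, hV, haV, hg, -, hgV⟩ := exists_smooth_local_inverse hU hH ha hf'
  have hsup0 : superpose G (Q a) = 0 := by
    ext t
    rw [superpose_apply hG.continuousOn (fun t => hx₀)]
    simp [Q, pairPath_apply, G, a]
  have hHa : H a = ((0, x₀), 0) := by
    refine Prod.ext rfl ?_
    change c x₀ - (c x₀ + J (superpose G (Q a))) = 0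
    rw [hsup0, map_zero, add_zero, sub_self]
  have hemb : ContDiff 𝕜 ∞ fun p : F × E => (p, (0 : C(unitInterval, E))) :=
    contDiff_id.prodMk contDiff_const
  refine ⟨fun p => (g (p, 0)).2, (fun p => (p, 0)) ⁻¹' V, hV.preimage hemb.continuous, ?_, ?_, ?_⟩
  · rw [hHa] at haV; exact haV
  · exact contDiff_snd.comp_contDiffOn (hg.comp hemb.contDiffOn fun p hp => hp)
  · intro p hp
    obtain ⟨h1, h2⟩ := hgV _ hp
    have h3 : (g (p, 0)).1 = p := congrArg Prod.fst h2
    have h4 : Φ (g (p, 0)) = 0 := congrArg Prod.snd h2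
    refine ⟨h1, ?_⟩
    have h5 := sub_eq_zero.mp h4
    have h6 : Q (g (p, 0)) = pairPath 𝕜 E F (p.1, (g (p, 0)).2) := by
      change pairPath 𝕜 E F ((g (p, 0)).1.1, (g (p, 0)).2) = _
      rw [h3]
    rw [h3, h6] at h5
    exact h5

/-- If the fields `x ↦ S x v` satisfy the Frobenius condition, the time-one map
`(ξ, y) ↦ β 1` is tangent to them. -/
theorem exists_tangent_map [CompleteSpace E] [CompleteSpace F] {O : Set E} (hO : IsOpen O)
    {S : E → F →L[𝕜] E} (hS : ContDiffOn 𝕜 ∞ S O)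
    (hint : ∀ x ∈ O, ∀ u v, fderiv 𝕜 S x (S x u) v = fderiv 𝕜 S x (S x v) u)
    {x₀ : E} (hx₀ : x₀ ∈ O) :
    ∃ (Ψ : F × E → E) (N : Set (F × E)), IsOpen N ∧ (0, x₀) ∈ N ∧ ContDiffOn 𝕜 ∞ Ψ N ∧
      (∀ p ∈ N, Ψ p ∈ O) ∧ (∀ y, (0, y) ∈ N → Ψ (0, y) = y) ∧
      ∀ p ∈ N, ∀ v, fderiv 𝕜 Ψ p (v, 0) = S (Ψ p) v := by
  obtain ⟨B, N, hN, h0N, hB, hBN⟩ := exists_smooth_solution hO hS hx₀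
  let ev : C(unitInterval, E) →L[𝕜] E := ContinuousMap.evalCLM 𝕜 (1 : unitInterval)
  let G : F × E → E := fun q => S q.2 q.1
  let O' : Set (F × E) := Prod.snd ⁻¹' O
  have hO' : IsOpen O' := hO.preimage continuous_snd
  have hG : ContDiffOn 𝕜 ∞ G O' :=
    (hS.comp contDiff_snd.contDiffOn fun q hq => hq).clm_apply contDiff_fst.contDiffOn
  refine ⟨fun p => ev (B p), N, hN, h0N, ev.contDiff.comp_contDiffOn hB,
    fun p hp => (hBN p hp).1 1, ?_, ?_⟩
  · intro y hy
    obtain ⟨hBO, h1⟩ := hBN _ hy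
    have h2 : superpose G (pairPath 𝕜 E F (0, B (0, y))) = 0 := by
      ext t
      rw [superpose_apply hG.continuousOn hBO]
      simp [pairPath_apply, G]
    change ev (B (0, y)) = y
    rw [h1]
    change ev (_ + primitive 𝕜 E (superpose G _)) = y
    rw [h2, map_zero, add_zero]
    rfl
  intro p hp v
  have hBd : HasFDerivAt B (fderiv 𝕜 B p) p :=
    ((hB.contDiffAt (hN.mem_nhds hp)).differentiableAt (by simp)).hasFDerivAt
  have hfd : fderiv 𝕜 (fun p => ev (B p)) p (v, 0) = fderiv 𝕜 B p (v, 0) 1 := by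
    have := (ev.hasFDerivAt.comp p hBd).fderiv
    change fderiv 𝕜 (ev ∘ B) p (v, 0) = _
    rw [this]
    rfl
  rw [hfd]
  change _ = S (B p 1) v
  obtain ⟨hBO, hBeq⟩ := hBN p hp
  set η := fderiv 𝕜 B p (v, 0) with hη
  obtain ⟨ξ, y⟩ := p
  have hScont : ContinuousOn (fderiv 𝕜 S) O := hS.continuousOn_fderiv_of_isOpen hO (by simp)
  have hSd : ∀ x ∈ O, HasFDerivAt S (fderiv 𝕜 S x) x := fun x hx =>
    ((hS.contDiffAt (hO.mem_nhds hx)).differentiableAt (by simp)).hasFDerivAt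
  -- The integral equation differentiated in the direction (v, 0).
  have hlin : η = primitive 𝕜 E (pointwiseApply 𝕜 unitInterval (F × E) E
      (superpose (fderiv 𝕜 G) (pairPath 𝕜 E F (ξ, B (ξ, y)))) (pairPath 𝕜 E F (v, η))) := by
    have h1 : HasFDerivAt (fun p : F × E => pairPath 𝕜 E F (p.1, B p)) _ (ξ, y) :=
      (pairPath 𝕜 E F).hasFDerivAt.comp (ξ, y) (hasFDerivAt_fst.prodMk hBd)
    have hs := (hasFDerivAt_superpose hO' hG (x := pairPath 𝕜 E F (ξ, B (ξ, y))) hBO).comp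
      (ξ, y) h1
    have h2 := ((ContinuousLinearMap.const 𝕜 unitInterval : E →L[𝕜] _) ∘L
      ContinuousLinearMap.snd 𝕜 F E).hasFDerivAt (x := (ξ, y))
    have h3 := h2.add ((primitive 𝕜 E).hasFDerivAt.comp (ξ, y) hs)
    have h4 : B =ᶠ[𝓝 (ξ, y)] _ := Filter.mem_of_superset (hN.mem_nhds hp)
      fun p hp => (hBN p hp).2
    have h5 := (h3.congr_of_eventuallyEq h4).fderiv
    conv_lhs => rw [hη, h5]
    simp [← hη]
  -- extensions to the line
  set β := B (ξ, y) with hβ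
  let u₁ := superpose G (pairPath 𝕜 E F (ξ, β))
  let u₂ := pointwiseApply 𝕜 unitInterval (F × E) E (superpose (fderiv 𝕜 G)
    (pairPath 𝕜 E F (ξ, β))) (pairPath 𝕜 E F (v, η))
  let b : ℝ → E := fun t => y + ∫ s in (0 : ℝ)..t, extendUnit u₁ s
  let h : ℝ → E := fun t => ∫ s in (0 : ℝ)..t, extendUnit u₂ s
  have hb : ∀ t (ht : t ∈ unitInterval), b t = β ⟨t, ht⟩ := fun t ht => by
    rw [hBeq]; rfl
  have hh : ∀ t (ht : t ∈ unitInterval), h t = η ⟨t, ht⟩ := fun t ht => by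
    rw [hlin]; rfl
  have hbd : ∀ t ∈ unitInterval, HasDerivAt b (S (b t) ξ) t := by
    intro t ht
    have h1 : extendUnit u₁ t = S (b t) ξ := by
      rw [extendUnit_of_mem _ ht, hb t ht]
      simp only [u₁]
      rw [superpose_apply hG.continuousOn hBO]
      rfl
    rw [← h1]
    exact ((continuous_extendUnit u₁).integral_hasStrictDerivAt 0 t).hasDerivAt.const_add y
  have hhd : ∀ t ∈ unitInterval,
      HasDerivAt h (fderiv 𝕜 S (b t) (h t) ξ + S (b t) v) t := by
    intro t ht
    have h1 : extendUnit u₂ t = fderiv 𝕜 S (b t) (h t) ξ + S (b t) v := by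
      rw [extendUnit_of_mem _ ht, hb t ht, hh t ht]
      simp only [u₂, pointwiseApply_apply]
      rw [superpose_apply (hG.continuousOn_fderiv_of_isOpen hO' (by simp)) hBO,
        (hasFDerivAt_apply_fst (S := S) (hSd _ (hBO ⟨t, ht⟩)).differentiableAt).fderiv]
      simp [pairPath_apply, add_comm]
    rw [← h1]
    exact ((continuous_extendUnit u₂).integral_hasStrictDerivAt 0 t).hasDerivAt
  have hbO : ∀ t ∈ unitInterval, b t ∈ O := fun t ht => hb t ht ▸ hBO _
  -- Both h and t S(b) v solve y' = DS(b)(y) ξ + S(b) v with y(0) = 0, the second by the symmetry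
  -- `hint`. Their difference k solves the homogeneous equation and vanishes by Grönwall; t = 1 is
  -- the claim.
  let k : ℝ → E := fun t => h t - t • S (b t) v
  have hkd : ∀ t ∈ unitInterval, HasDerivAt k (fderiv 𝕜 S (b t) (k t) ξ) t := by
    intro t ht
    have h1 : HasFDerivAt (fun x => S x v) ((fderiv 𝕜 S (b t)).flip v) (b t) := by
      have := (hSd _ (hbO t ht)).clm_apply (hasFDerivAt_const v (b t))
      refine this.congr_fderiv ?_
      ext; simp
    have h2 := (h1.restrictScalars ℝ).comp_hasDerivAt t (hbd t ht)
    have h3 := (hhd t ht).sub ((hasDerivAt_id t).smul h2)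
    refine h3.congr_deriv ?_
    simp only [id, k, ContinuousLinearMap.coe_restrictScalars', ContinuousLinearMap.flip_apply,
      Function.comp, one_smul]
    rw [hint _ (hbO t ht), map_sub, sub_apply,
      ← algebraMap_smul 𝕜 t (S (b t) v), map_smul, smul_apply,
      algebraMap_smul]
    abel
  have hScont' : Continuous fun t => fderiv 𝕜 S (β t) :=
    hScont.comp_continuous β.continuous hBO
  have hScont'' : Continuous fun t => ‖fderiv 𝕜 S (β t)‖ :=
    (continuous_norm (E := E →L[𝕜] F →L[𝕜] E)).comp hScont'
  obtain ⟨C, hC⟩ := isCompact_univ.exists_bound_of_continuousOn hScont''.continuousOn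
  have hk0 : k 0 = 0 := by simp [k, h]
  have hk1 := eq_zero_of_abs_deriv_le_mul_abs_self_of_eq_zero_right (a := 0) (b := 1)
    (K := C * ‖ξ‖) (fun t ht => (hkd t ht).continuousAt.continuousWithinAt)
    (fun t ht => (hkd t ⟨ht.1, ht.2.le⟩).hasDerivWithinAt) hk0 (fun t ht => by
      have ht' : t ∈ unitInterval := ⟨ht.1, ht.2.le⟩
      have h1 : ‖fderiv 𝕜 S (b t)‖ ≤ C := by
        rw [hb t ht']
        exact (le_abs_self _).trans (hC ⟨t, ht'⟩ trivial)
      calc ‖fderiv 𝕜 S (b t) (k t) ξ‖ ≤ ‖fderiv 𝕜 S (b t)‖ * ‖k t‖ * ‖ξ‖ :=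
            (fderiv 𝕜 S (b t)).le_opNorm₂ _ _
        _ ≤ C * ‖k t‖ * ‖ξ‖ := by gcongr
        _ = C * ‖ξ‖ * ‖k t‖ := by ring) 1 ⟨zero_le_one, le_rfl⟩
  have h1 : (1 : ℝ) ∈ unitInterval := ⟨zero_le_one, le_rfl⟩
  simp only [k, one_smul] at hk1
  rw [hb 1 h1, hh 1 h1] at hk1
  exact sub_eq_zero.mp hk1

end Flow

/-! ### Frobenius' theorem and existence of Casimir functions -/

section Frobenius

open Topology

universe w

variable {𝕜 : Type*} [RCLike 𝕜] {E : Type w} [NormedAddCommGroup E] [NormedSpace 𝕜 E]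

theorem fderiv_clm_comp_apply {X Y Z W : Type*} [NormedAddCommGroup X] [NormedSpace 𝕜 X]
    [NormedAddCommGroup Y] [NormedSpace 𝕜 Y] [NormedAddCommGroup Z] [NormedSpace 𝕜 Z]
    [NormedAddCommGroup W] [NormedSpace 𝕜 W] {c : X → Z →L[𝕜] W} {d : X → Y →L[𝕜] Z} {x : X}
    (hc : DifferentiableAt 𝕜 c x) (hd : DifferentiableAt 𝕜 d x) (h : X) (v : Y) :
    fderiv 𝕜 (fun x => c x ∘L d x) x h v =
      fderiv 𝕜 c x h (d x v) + c x (fderiv 𝕜 d x h v) := by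
  rw [fderiv_clm_comp hc hd, add_comm]
  rfl

theorem fderiv_skew {O : Set E} (hO : IsOpen O) {Q : E → (E →L[𝕜] 𝕜) →L[𝕜] E}
    (hQ : DifferentiableOn 𝕜 Q O) (skew : ∀ x ∈ O, ∀ α β : E →L[𝕜] 𝕜, α (Q x β) = -β (Q x α))
    {x : E} (hx : x ∈ O) (h : E) (α β : E →L[𝕜] 𝕜) :
    α (fderiv 𝕜 Q x h β) = -β (fderiv 𝕜 Q x h α) := by
  have key : ∀ α β : E →L[𝕜] 𝕜, HasFDerivAt (fun x => α (Q x β))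
      (α ∘L (fderiv 𝕜 Q x).flip β) x := fun α β => by
    have h1 := α.hasFDerivAt.comp x (((hQ x hx).differentiableAt
      (hO.mem_nhds hx)).hasFDerivAt.clm_apply (hasFDerivAt_const β x))
    refine h1.congr_fderiv ?_
    ext; simp
  have h2 : (fun x => α (Q x β)) =ᶠ[𝓝 x] fun x => -β (Q x α) :=
    Filter.mem_of_superset (hO.mem_nhds hx) fun y hy => skew y hy α β
  exact congrArg (fun T : E →L[𝕜] 𝕜 => T h)
    ((key α β).unique ((key β α).neg.congr_of_eventuallyEq h2))

variable [FiniteDimensional 𝕜 E]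

/-- Frobenius' theorem: a distribution spanned by fields `x ↦ S x v` with symmetric
`DS(S u) v` is annihilated by as many independent functions as its codimension. -/
theorem exists_first_integrals {F : Submodule 𝕜 E} {O : Set E} (hO : IsOpen O)
    {S : E → F →L[𝕜] E} (hS : ContDiffOn 𝕜 ∞ S O)
    (hint : ∀ x ∈ O, ∀ u v, fderiv 𝕜 S x (S x u) v = fderiv 𝕜 S x (S x v) u)
    {x₀ : E} (hx₀ : x₀ ∈ O) (hS₀ : ∀ v, S x₀ v = v) {r : ℕ} (hr : finrank 𝕜 F + r = finrank 𝕜 E) :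
    ∃ (c : Fin r → E → 𝕜) (V : Set E), IsOpen V ∧ x₀ ∈ V ∧ V ⊆ O ∧
      (∀ i, ContDiffOn 𝕜 ∞ (c i) V) ∧ (∀ i, ∀ x ∈ V, ∀ v, fderiv 𝕜 (c i) x (S x v) = 0) ∧
      LinearIndependent 𝕜 fun i => fderiv 𝕜 (c i) x₀ := by
  let _ : NormedSpace ℝ E := NormedSpace.restrictScalars ℝ 𝕜 E
  have : IsScalarTower ℝ 𝕜 E := ⟨fun a k x => by
    change (a • k) • x = algebraMap ℝ 𝕜 a • k • x
    rw [Algebra.smul_def, mul_smul]⟩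
  have : CompleteSpace E := FiniteDimensional.complete 𝕜 E
  have : CompleteSpace F := FiniteDimensional.complete 𝕜 F
  obtain ⟨Ψ, N, hN, h0N, hΨ, hΨO, hΨ0, hΨS⟩ := exists_tangent_map hO hS hint hx₀
  obtain ⟨G, hG⟩ := F.exists_isCompl
  have : CompleteSpace G := FiniteDimensional.complete 𝕜 G
  let ι : F × G → F × E := fun p => (p.1, x₀ + p.2)
  let ι' : F × G →L[𝕜] F × E := (ContinuousLinearMap.id 𝕜 F).prodMap G.subtypeL
  have hι : ∀ p, HasFDerivAt ι ι' p := by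
    intro p
    have h1 : HasFDerivAt (fun p => (0, x₀) + ι' p) ι' p := ι'.hasFDerivAt.const_add _
    refine h1.congr_of_eventuallyEq (Filter.Eventually.of_forall fun p => ?_)
    exact Prod.ext (zero_add _).symm rfl
  have hιs : ContDiff 𝕜 ∞ ι :=
    contDiff_fst.prodMk (contDiff_const.add (G.subtypeL.contDiff.comp contDiff_snd))
  -- Θ straightens the distribution: the slices in the F direction are tangent to it, so the
  -- G-coordinates of the inverse of Θ are first integrals.
  let Θ : F × G → E := Ψ ∘ ι
  let U : Set (F × G) := ι ⁻¹' N
  have hU : IsOpen U := hN.preimage hιs.continuous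
  have h0U : (0 : F × G) ∈ U := by
    change ((0 : F), x₀ + ((0 : G) : E)) ∈ N
    simpa using h0N
  have hΘ : ContDiffOn 𝕜 ∞ Θ U := hΨ.comp hιs.contDiffOn fun p hp => hp
  have hΨd : ∀ p ∈ N, HasFDerivAt Ψ (fderiv 𝕜 Ψ p) p := fun p hp =>
    ((hΨ.contDiffAt (hN.mem_nhds hp)).differentiableAt (by simp)).hasFDerivAt
  have hΘd : ∀ p ∈ U, HasFDerivAt Θ (fderiv 𝕜 Ψ (ι p) ∘L ι') p := fun p hp =>
    (hΨd (ι p) hp).comp p (hι p)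
  have hΘS : ∀ p ∈ U, ∀ v, fderiv 𝕜 Θ p (v, 0) = S (Θ p) v := fun p hp v => by
    rw [(hΘd p hp).fderiv]
    exact hΨS (ι p) hp v
  let f' : (F × G) ≃L[𝕜] E := (Submodule.prodEquivOfIsCompl F G hG).toContinuousLinearEquiv
  have hι0 : ι 0 = (0, x₀) := by simp [ι]
  have hΘ0 : Θ 0 = x₀ := by
    change Ψ (ι 0) = x₀
    rw [hι0]
    exact hΨ0 _ h0N
  have hf' : HasFDerivAt Θ (f' : F × G →L[𝕜] E) 0 := by
    refine (hΘd 0 h0U).congr_fderiv ?_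
    rw [hι0]
    refine ContinuousLinearMap.ext fun p => ?_
    have h1 : fderiv 𝕜 Ψ (0, x₀) (0, (p.2 : E)) = p.2 := by
      have h2 : HasFDerivAt (fun y : E => Ψ (0, y)) _ x₀ :=
        (hΨd _ h0N).comp x₀ (hasFDerivAt_prodMk_right (0 : F) x₀)
      have h3 : (fun y : E => Ψ (0, y)) =ᶠ[𝓝 x₀] id := by
        have h4 : {y : E | ((0 : F), y) ∈ N} ∈ 𝓝 x₀ :=
          (hN.preimage (Continuous.prodMk_right (0 : F))).mem_nhds h0N
        exact Filter.mem_of_superset h4 fun y hy => hΨ0 y hy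
      have h5 := (h2.congr_of_eventuallyEq h3.symm).unique (hasFDerivAt_id x₀)
      exact congrArg (fun T : E →L[𝕜] E => T p.2) h5
    have h2 : fderiv 𝕜 Ψ (0, x₀) (p.1, 0) = p.1 := by
      rw [hΨS _ h0N, hΨ0 _ h0N, hS₀]
    have h3 : ι' p = (p.1, 0) + (0, (p.2 : E)) :=
      Prod.ext (add_zero _).symm (zero_add _).symm
    change fderiv 𝕜 Ψ (0, x₀) (ι' p) = (p.1 : E) + p.2
    rw [h3, map_add, h1, h2]
  obtain ⟨g, V, hV, h0V, hg, -, hgV⟩ := exists_smooth_local_inverse hU hΘ h0U hf'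
  rw [hΘ0] at h0V
  have hdim : finrank 𝕜 (F × G) = finrank 𝕜 E := f'.toLinearEquiv.finrank_eq
  have hgd : ∀ x ∈ V, HasFDerivAt g (fderiv 𝕜 g x) x := fun x hx =>
    ((hg.contDiffAt (hV.mem_nhds hx)).differentiableAt (by simp)).hasFDerivAt
  have hgl : ∀ x ∈ V, ∀ p, fderiv 𝕜 g x (fderiv 𝕜 Θ (g x) p) = p := by
    intro x hx
    have h1 : HasFDerivAt (Θ ∘ g) _ x := ((hΘd _ (hgV x hx).1).differentiableAt.hasFDerivAt).comp x
      (hgd x hx)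
    have h2 : Θ ∘ g =ᶠ[𝓝 x] id := Filter.mem_of_superset (hV.mem_nhds hx) fun y hy => (hgV y hy).2
    have h3 := (h1.congr_of_eventuallyEq h2.symm).unique (hasFDerivAt_id x)
    have h4 : ∀ y, fderiv 𝕜 Θ (g x) (fderiv 𝕜 g x y) = y := fun y =>
      congrArg (fun T : E →L[𝕜] E => T y) h3
    have h5 : Function.Surjective (fderiv 𝕜 Θ (g x)) := fun y => ⟨_, h4 y⟩
    have h6 : Function.Injective (fderiv 𝕜 Θ (g x)) :=
      (LinearMap.injective_iff_surjective_of_finrank_eq_finrank hdim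
        (f := (fderiv 𝕜 Θ (g x) : F × G →ₗ[𝕜] E))).mpr h5
    exact fun p => h6 (h4 _)
  have hGr : finrank 𝕜 G = r := by
    have := Submodule.finrank_add_eq_of_isCompl hG
    omega
  let b : Basis (Fin r) 𝕜 G := finBasisOfFinrankEq 𝕜 G hGr
  let π : Fin r → F × G →L[𝕜] 𝕜 := fun i =>
    LinearMap.toContinuousLinearMap (b.coord i) ∘L ContinuousLinearMap.snd 𝕜 F G
  have hcd : ∀ i, ∀ x ∈ V, fderiv 𝕜 (π i ∘ g) x = π i ∘L fderiv 𝕜 g x := fun i x hx =>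
    ((π i).hasFDerivAt.comp x (hgd x hx)).fderiv
  refine ⟨fun i => π i ∘ g, V, hV, h0V, fun x hx => ?_, fun i => (π i).contDiff.comp_contDiffOn hg,
    fun i x hx v => ?_, ?_⟩
  · rw [← (hgV x hx).2]
    exact hΨO _ (hgV x hx).1
  · rw [hcd i x hx]
    have h1 := hgl x hx (v, 0)
    rw [hΘS _ (hgV x hx).1, (hgV x hx).2] at h1
    simp [h1, π]
  · rw [Fintype.linearIndependent_iff]
    intro a ha i
    have h1 := congrArg (fun T : E →L[𝕜] 𝕜 => T (fderiv 𝕜 Θ (g x₀) (0, b i))) ha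
    simp only [hcd _ x₀ h0V, sum_apply, smul_apply, ContinuousLinearMap.comp_apply,
      hgl x₀ h0V] at h1
    simpa [π, Finsupp.single_apply] using h1

/-- The image of a field of skew-symmetric maps of constant rank satisfying the Jacobi identity
is spanned by fields as in `exists_first_integrals`. -/
theorem exists_frame {O : Set E} (hO : IsOpen O) {Q : E → (E →L[𝕜] 𝕜) →L[𝕜] E}
    (hQ : ContDiffOn 𝕜 ∞ Q O) (skew : ∀ x ∈ O, ∀ α β : E →L[𝕜] 𝕜, α (Q x β) = -β (Q x α))
    (jac : ∀ x ∈ O, ∀ α β γ : E →L[𝕜] 𝕜, β (fderiv 𝕜 Q x (Q x α) γ) +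
      γ (fderiv 𝕜 Q x (Q x β) α) + α (fderiv 𝕜 Q x (Q x γ) β) = 0)
    {x₀ : E} (hx₀ : x₀ ∈ O) {F : Submodule 𝕜 E}
    (hF : F = LinearMap.range (Q x₀ : (E →L[𝕜] 𝕜) →ₗ[𝕜] E))
    (hrank : ∀ x ∈ O, finrank 𝕜 (LinearMap.range (Q x : (E →L[𝕜] 𝕜) →ₗ[𝕜] E)) = finrank 𝕜 F) :
    ∃ (S : E → F →L[𝕜] E) (O₁ : Set E), IsOpen O₁ ∧ x₀ ∈ O₁ ∧ O₁ ⊆ O ∧ ContDiffOn 𝕜 ∞ S O₁ ∧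
      (∀ x ∈ O₁, ∀ u v, fderiv 𝕜 S x (S x u) v = fderiv 𝕜 S x (S x v) u) ∧
      (∀ v, S x₀ v = v) ∧ ∀ x ∈ O₁, LinearMap.range (S x : F →ₗ[𝕜] E) =
        LinearMap.range (Q x : (E →L[𝕜] 𝕜) →ₗ[𝕜] E) := by
  have : CompleteSpace F := FiniteDimensional.complete 𝕜 F
  obtain ⟨π₀, hπ₀⟩ := F.subtype.exists_leftInverse_of_injective
    (LinearMap.ker_eq_bot.mpr F.subtype_injective)
  obtain ⟨σ₀, hσ₀⟩ : ∃ σ₀ : F →ₗ[𝕜] (E →L[𝕜] 𝕜), ∀ v, Q x₀ (σ₀ v) = v := by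
    subst hF
    obtain ⟨σ₀, hσ₀⟩ := LinearMap.exists_rightInverse_of_surjective
      (Q x₀ : (E →L[𝕜] 𝕜) →ₗ[𝕜] E).rangeRestrict (LinearMap.range_rangeRestrict _)
    exact ⟨σ₀, fun v => congrArg Subtype.val (LinearMap.congr_fun hσ₀ v)⟩
  let π : E →L[𝕜] F := LinearMap.toContinuousLinearMap π₀
  let σ : F →L[𝕜] E →L[𝕜] 𝕜 := LinearMap.toContinuousLinearMap σ₀
  have hπ : ∀ v : F, π v = v := fun v => congrArg (fun T : F →ₗ[𝕜] F => T v) hπ₀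
  have hσ : ∀ v : F, Q x₀ (σ v) = v := hσ₀
  -- The frame Q σ is normalized by A⁻¹ so that π S = id; brackets of such fields have zero
  -- π-component.
  let A : E → F →L[𝕜] F := fun x => π ∘L Q x ∘L σ
  have hA : ContDiffOn 𝕜 ∞ A O := contDiffOn_const.clm_comp (hQ.clm_comp contDiffOn_const)
  have hA₀ : A x₀ = 1 := by
    ext v
    simp [A, hσ, hπ]
  let O₁ : Set E := O ∩ A ⁻¹' {T | IsUnit T}
  have hO₁ : IsOpen O₁ := hA.continuousOn.isOpen_inter_preimage hO Units.isOpen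
  have hx₁ : x₀ ∈ O₁ := ⟨hx₀, by simp [hA₀]⟩
  let θ : E → F →L[𝕜] E →L[𝕜] 𝕜 := fun x => σ ∘L Ring.inverse (A x)
  have hθ : ContDiffOn 𝕜 ∞ θ O₁ := contDiffOn_const.clm_comp fun x hx => by
    obtain ⟨u, hu⟩ := hx.2
    have h1 : ContDiffAt 𝕜 ∞ Ring.inverse (A x) := hu ▸ contDiffAt_ringInverse 𝕜 u
    exact h1.comp_contDiffWithinAt x ((hA x hx.1).mono Set.inter_subset_left)
  let S : E → F →L[𝕜] E := fun x => Q x ∘L θ x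
  have hS : ContDiffOn 𝕜 ∞ S O₁ := (hQ.mono Set.inter_subset_left).clm_comp hθ
  have hπS : ∀ x ∈ O₁, ∀ v, π (S x v) = v := fun x hx v =>
    congrArg (fun T : F →L[𝕜] F => T v) (Ring.mul_inverse_cancel _ hx.2)
  have hrange : ∀ x ∈ O₁, LinearMap.range (S x : F →ₗ[𝕜] E) =
      LinearMap.range (Q x : (E →L[𝕜] 𝕜) →ₗ[𝕜] E) := by
    intro x hx
    refine Submodule.eq_of_le_of_finrank_eq ?_ ?_
    · rintro _ ⟨v, rfl⟩
      exact ⟨θ x v, rfl⟩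
    · rw [hrank x hx.1]
      refine LinearMap.finrank_range_of_inj fun u v huv => ?_
      rw [← hπS x hx u, ← hπS x hx v]
      exact congrArg π huv
  have hSd : ∀ x ∈ O₁, HasFDerivAt S (fderiv 𝕜 S x) x := fun x hx =>
    ((hS.contDiffAt (hO₁.mem_nhds hx)).differentiableAt (by simp)).hasFDerivAt
  have hQd : ∀ x ∈ O, HasFDerivAt Q (fderiv 𝕜 Q x) x := fun x hx =>
    ((hQ.contDiffAt (hO.mem_nhds hx)).differentiableAt (by simp)).hasFDerivAt
  have hθd : ∀ x ∈ O₁, HasFDerivAt θ (fderiv 𝕜 θ x) x := fun x hx =>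
    ((hθ.contDiffAt (hO₁.mem_nhds hx)).differentiableAt (by simp)).hasFDerivAt
  have hSh : ∀ x ∈ O₁, ∀ h v, fderiv 𝕜 S x h v =
      fderiv 𝕜 Q x h (θ x v) + Q x (fderiv 𝕜 θ x h v) := fun x hx h v =>
    fderiv_clm_comp_apply (hQd x hx.1).differentiableAt (hθd x hx).differentiableAt h v
  have hint : ∀ x ∈ O₁, ∀ u v, fderiv 𝕜 S x (S x u) v = fderiv 𝕜 S x (S x v) u := by
    intro x hx u v
    set w := fderiv 𝕜 S x (S x u) v - fderiv 𝕜 S x (S x v) u with hw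
    have h1 : ∀ h v, π (fderiv 𝕜 S x h v) = 0 := by
      intro h v
      have h2 : HasFDerivAt (fun x => π (S x v)) (π ∘L (fderiv 𝕜 S x).flip v) x := by
        refine (π.hasFDerivAt.comp x
          ((hSd x hx).clm_apply (hasFDerivAt_const v x))).congr_fderiv ?_
        ext; simp
      have h3 : (fun x => π (S x v)) =ᶠ[𝓝 x] fun _ => v :=
        Filter.mem_of_superset (hO₁.mem_nhds hx) fun y hy => hπS y hy v
      exact congrArg (fun T : E →L[𝕜] F => T h)
        ((h2.congr_of_eventuallyEq h3.symm).unique (hasFDerivAt_const v x))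
    -- A covector α vanishing on the image of Q x satisfies Q x α = 0 by skewness; the Jacobi
    -- identity with this α gives α w = 0. So w is in the image of S x, and π w = 0 forces w = 0.
    have h2 : w ∈ LinearMap.range (Q x : (E →L[𝕜] 𝕜) →ₗ[𝕜] E) := by
      by_contra hcon
      obtain ⟨f, hf, hfr⟩ := Submodule.exists_dual_map_eq_bot_of_notMem hcon inferInstance
      let α : E →L[𝕜] 𝕜 := LinearMap.toContinuousLinearMap f
      have hαQ : ∀ β, α (Q x β) = 0 := fun β => by
        have : f (Q x β) ∈ (LinearMap.range (Q x : (E →L[𝕜] 𝕜) →ₗ[𝕜] E)).map f :=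
          Submodule.mem_map_of_mem ⟨β, rfl⟩
        rw [hfr] at this
        exact (Submodule.mem_bot 𝕜).mp this
      have hQα : Q x α = 0 := (SeparatingDual.eq_zero_iff_forall_dual_eq_zero (R := 𝕜) _).mpr
        fun g => by rw [skew x hx.1, hαQ, neg_zero]
      apply hf
      change α w = 0
      rw [hw, map_sub, hSh x hx, hSh x hx, map_add, map_add, hαQ, hαQ, add_zero, add_zero]
      have h3 := jac x hx.1 α (θ x u) (θ x v)
      rw [hQα, map_zero, zero_apply, map_zero, zero_add, fderiv_skew hO (hQ.differentiableOn (by simp)) skew hx.1 _ (θ x v) α] at h3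
      change α (fderiv 𝕜 Q x (Q x (θ x u)) (θ x v)) - α (fderiv 𝕜 Q x (Q x (θ x v)) (θ x u)) = 0
      linear_combination -h3
    rw [← hrange x hx] at h2
    obtain ⟨z, hz⟩ := h2
    have h3 : π w = 0 := by rw [hw, map_sub, h1, h1, sub_zero]
    have h4 : z = 0 := by rw [← hπS x hx z, ← h3]; exact congrArg π hz
    rw [h4, map_zero] at hz
    exact sub_eq_zero.mp hz.symm
  have hS₀ : ∀ v, S x₀ v = v := fun v => by
    change Q x₀ (σ (Ring.inverse (A x₀) v)) = v
    rw [hσ, hA₀, Ring.inverse_one]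
    rfl
  exact ⟨S, O₁, hO₁, hx₁, Set.inter_subset_left, hS, hint, hS₀, hrange⟩

/-- The functions whose differentials span the kernel of a field of skew-symmetric maps of constant
rank satisfying the Jacobi identity. -/
theorem exists_casimirs {O : Set E} (hO : IsOpen O) {Q : E → (E →L[𝕜] 𝕜) →L[𝕜] E}
    (hQ : ContDiffOn 𝕜 ∞ Q O) (skew : ∀ x ∈ O, ∀ α β : E →L[𝕜] 𝕜, α (Q x β) = -β (Q x α))
    (jac : ∀ x ∈ O, ∀ α β γ : E →L[𝕜] 𝕜, β (fderiv 𝕜 Q x (Q x α) γ) +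
      γ (fderiv 𝕜 Q x (Q x β) α) + α (fderiv 𝕜 Q x (Q x γ) β) = 0)
    {x₀ : E} (hx₀ : x₀ ∈ O)
    (hrank : ∀ x ∈ O, finrank 𝕜 (LinearMap.range (Q x : (E →L[𝕜] 𝕜) →ₗ[𝕜] E)) =
      finrank 𝕜 (LinearMap.range (Q x₀ : (E →L[𝕜] 𝕜) →ₗ[𝕜] E))) {r : ℕ}
    (hr : finrank 𝕜 (LinearMap.ker (Q x₀ : (E →L[𝕜] 𝕜) →ₗ[𝕜] E)) = r) :
    ∃ (c : Fin r → E → 𝕜) (V : Set E), IsOpen V ∧ x₀ ∈ V ∧ V ⊆ O ∧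
      (∀ i, ContDiffOn 𝕜 ∞ (c i) V) ∧ (∀ i, ∀ x ∈ V, ∀ β, fderiv 𝕜 (c i) x (Q x β) = 0) ∧
      LinearIndependent 𝕜 fun i => fderiv 𝕜 (c i) x₀ := by
  have hdual : finrank 𝕜 (E →L[𝕜] 𝕜) = finrank 𝕜 E :=
    (LinearMap.toContinuousLinearMap (𝕜 := 𝕜) (E := E) (F' := 𝕜)).symm.finrank_eq.trans
      Subspace.dual_finrank_eq
  have hdim : finrank 𝕜 (LinearMap.range (Q x₀ : (E →L[𝕜] 𝕜) →ₗ[𝕜] E)) + r = finrank 𝕜 E := by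
    rw [← hr, ← hdual]
    exact LinearMap.finrank_range_add_finrank_ker _
  obtain ⟨S, O₁, hO₁, hx₁, hO₁O, hS, hint, hS₀, hrange⟩ :=
    exists_frame hO hQ skew jac hx₀ rfl hrank
  obtain ⟨c, V, hV, hxV, hVO, hc, hcS, hli⟩ := exists_first_integrals hO₁ hS hint hx₁ hS₀ hdim
  refine ⟨c, V, hV, hxV, hVO.trans hO₁O, hc, fun i x hx β => ?_, hli⟩
  have h1 : Q x β ∈ LinearMap.range (S x).toLinearMap := by
    rw [hrange x (hVO hx)]
    exact ⟨β, rfl⟩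
  obtain ⟨v, hv⟩ := h1
  rw [← hv]
  exact hcS i x hx v

end Frobenius

/-! ### Poisson structures in a chart -/

section Chart

open Topology Bihamiltonian

variable {𝕜 : Type*} [RCLike 𝕜] {E : Type*} [NormedAddCommGroup E] [NormedSpace 𝕜 E]
  {M : Type*} [TopologicalSpace M] [ChartedSpace E M]
  {A : Type*} [NormedAddCommGroup A] [NormedSpace 𝕜 A]

theorem differential_congr {f g : M → A} {m : M} (h : f =ᶠ[𝓝 m] g) :
    differential 𝕜 E f m = differential 𝕜 E g m :=
  h.mfderiv_eq

/-- A tensor field in a chart. -/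
noncomputable def chartField [FiniteDimensional 𝕜 E] (P : TensorField 𝕜 E M) (m₀ : M) (x : E) : (E →L[𝕜] 𝕜) →L[𝕜] E :=
  LinearMap.toContinuousLinearMap
    { toFun := fun α => differential 𝕜 E (chartAt E m₀) ((chartAt E m₀).symm x)
        (P _ (α ∘L differential 𝕜 E (chartAt E m₀) ((chartAt E m₀).symm x)))
      map_add' := fun α β => by
        rw [ContinuousLinearMap.add_comp, map_add, map_add]
      map_smul' := fun c α => by
        rw [ContinuousLinearMap.smul_comp, map_smul, map_smul]; rfl }

theorem chartField_apply [FiniteDimensional 𝕜 E] (P : TensorField 𝕜 E M) (m₀ : M) (x : E) (α : E →L[𝕜] 𝕜) :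
    chartField P m₀ x α = differential 𝕜 E (chartAt E m₀) ((chartAt E m₀).symm x)
      (P _ (α ∘L differential 𝕜 E (chartAt E m₀) ((chartAt E m₀).symm x))) := rfl

theorem chartField_skew [FiniteDimensional 𝕜 E] {P : TensorField 𝕜 E M} (hP : IsPoisson P)
    (m₀ : M) (x : E) (α β : E →L[𝕜] 𝕜) :
    α (chartField P m₀ x β) = -β (chartField P m₀ x α) :=
  hP.skew _ (α ∘L differential 𝕜 E (chartAt E m₀) ((chartAt E m₀).symm x))
    (β ∘L differential 𝕜 E (chartAt E m₀) ((chartAt E m₀).symm x))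

variable [IsManifold 𝓘(𝕜, E) ∞ M]

theorem differential_comp_chart (m₀ : M) {c : E → A} {m : M} (hm : m ∈ (chartAt E m₀).source)
    (hc : DifferentiableAt 𝕜 c (chartAt E m₀ m)) :
    differential 𝕜 E (c ∘ chartAt E m₀) m =
      fderiv 𝕜 c (chartAt E m₀ m) ∘L differential 𝕜 E (chartAt E m₀) m := by
  have h1 : MDifferentiableAt 𝓘(𝕜, E) 𝓘(𝕜, E) (chartAt E m₀) m :=
    (mdifferentiable_chart (I := 𝓘(𝕜, E)) m₀).mdifferentiableAt hm
  have h2 := mfderiv_comp (I'' := 𝓘(𝕜, A)) m hc.mdifferentiableAt h1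
  rw [mfderiv_eq_fderiv] at h2
  exact h2

theorem smoothOn_comp_chart (m₀ : M) {c : E → A} {V : Set E} (hc : ContDiffOn 𝕜 ∞ c V) :
    SmoothOn 𝕜 E (c ∘ chartAt E m₀) ((chartAt E m₀).source ∩ chartAt E m₀ ⁻¹' V) :=
  hc.contMDiffOn.comp ((contMDiffOn_chart (I := 𝓘(𝕜, E)) (n := ∞) (x := m₀)).mono
    Set.inter_subset_left) fun _ hm => hm.2

theorem contDiffOn_comp_chart_symm {m₀ : M} {f : M → A}
    (hf : SmoothOn 𝕜 E f (chartAt E m₀).source) :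
    ContDiffOn 𝕜 ∞ (f ∘ (chartAt E m₀).symm) (chartAt E m₀).target :=
  (ContMDiffOn.comp hf (contMDiffOn_chart_symm (I := 𝓘(𝕜, E)) (n := ∞) (x := m₀))
    fun _ hx => (chartAt E m₀).map_target hx).contDiffOn

/-- Covectors at a point of a chart are covectors of the model space. -/
theorem exists_covector_equiv (S A : Type*) [NormedAddCommGroup A] [NormedSpace 𝕜 A] [Semiring S]
    [Module S A] [SMulCommClass 𝕜 S A] [ContinuousConstSMul S A] (m₀ : M) {m : M}
    (hm : m ∈ (chartAt E m₀).source) :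
    ∃ f : (E →L[𝕜] A) ≃ₗ[S] Covector 𝕜 E A m,
      (∀ α, f α = α ∘L differential 𝕜 E (chartAt E m₀) m) ∧ Continuous f.symm := by
  let D : TangentSpace 𝓘(𝕜, E) m ≃L[𝕜] E := (mdifferentiable_chart (I := 𝓘(𝕜, E)) m₀).mfderiv hm
  refine ⟨LinearEquiv.ofLinearMap
    { toFun := fun α => α ∘L (D : TangentSpace 𝓘(𝕜, E) m →L[𝕜] E)
      map_add' := fun _ _ => rfl
      map_smul' := fun _ _ => rfl }
    { toFun := fun α => α ∘L (D.symm : E →L[𝕜] TangentSpace 𝓘(𝕜, E) m)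
      map_add' := fun _ _ => rfl
      map_smul' := fun _ _ => rfl } ?_ ?_, fun α => rfl,
    (ContinuousLinearMap.precomp A (D.symm : E →L[𝕜] TangentSpace 𝓘(𝕜, E) m)).continuous⟩
  · ext α v
    exact congrArg α (D.symm_apply_apply v)
  · ext α v
    exact congrArg α (D.apply_symm_apply v)

theorem differential_eq_fderiv_comp_chart_symm {m₀ : M} {f : M → A}
    (hf : SmoothOn 𝕜 E f (chartAt E m₀).source) {x : E} (hx : x ∈ (chartAt E m₀).target) :
    differential 𝕜 E f ((chartAt E m₀).symm x) = fderiv 𝕜 (f ∘ (chartAt E m₀).symm) x ∘L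
      differential 𝕜 E (chartAt E m₀) ((chartAt E m₀).symm x) := by
  have hm := (chartAt E m₀).map_target hx
  have hr := (chartAt E m₀).right_inv hx
  have h1 : f =ᶠ[𝓝 ((chartAt E m₀).symm x)] (f ∘ (chartAt E m₀).symm) ∘ chartAt E m₀ :=
    Filter.mem_of_superset ((chartAt E m₀).open_source.mem_nhds hm) fun m hm =>
      congrArg f ((chartAt E m₀).left_inv hm).symm
  have h2 : DifferentiableAt 𝕜 (f ∘ (chartAt E m₀).symm) x :=
    ((contDiffOn_comp_chart_symm hf).contDiffAt
      ((chartAt E m₀).open_target.mem_nhds hx)).differentiableAt (by simp)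
  rw [differential_congr h1, differential_comp_chart m₀ hm (hr.symm ▸ h2), hr]

theorem smoothOn_bracket_chart {P : TensorField 𝕜 E M} (hP : IsPoisson P) (m₀ : M)
    (α β : E →L[𝕜] 𝕜) :
    SmoothOn 𝕜 E (bracket P (α ∘ chartAt E m₀) (β ∘ chartAt E m₀)) (chartAt E m₀).source := by
  have h : ∀ α : E →L[𝕜] 𝕜, SmoothOn 𝕜 E (α ∘ chartAt E m₀) (chartAt E m₀).source := fun α => by
    have := smoothOn_comp_chart m₀ (V := Set.univ) α.contDiff.contDiffOn
    rwa [Set.preimage_univ, Set.inter_univ] at this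
  exact hP.smooth _ (chartAt E m₀).open_source _ _ (h α) (h β)

variable [FiniteDimensional 𝕜 E]

theorem bracket_comp_chart (P : TensorField 𝕜 E M) (m₀ : M) {x : E}
    (hx : x ∈ (chartAt E m₀).target) {c : E → A} (hc : DifferentiableAt 𝕜 c x)
    {c' : E → 𝕜} (hc' : DifferentiableAt 𝕜 c' x) :
    bracket P (c ∘ chartAt E m₀) (c' ∘ chartAt E m₀) ((chartAt E m₀).symm x) =
      fderiv 𝕜 c x (chartField P m₀ x (fderiv 𝕜 c' x)) := by
  have hm := (chartAt E m₀).map_target hx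
  have hr := (chartAt E m₀).right_inv hx
  rw [bracket, differential_comp_chart m₀ hm (hr.symm ▸ hc),
    differential_comp_chart m₀ hm (hr.symm ▸ hc'), hr]
  rfl

/-- The components of the field are brackets of linear chart coordinates, smooth by assumption. -/
theorem contDiffOn_chartField {P : TensorField 𝕜 E M} (hP : IsPoisson P) (m₀ : M) :
    ContDiffOn 𝕜 ∞ (chartField P m₀) (chartAt E m₀).target := by
  rw [contDiffOn_clm_apply]
  intro β
  let e := (finBasis 𝕜 E).equivFunL
  have h : ContDiffOn 𝕜 ∞ (fun x => e (chartField P m₀ x β)) (chartAt E m₀).target := by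
    refine contDiffOn_pi.mpr fun i => ?_
    let α : E →L[𝕜] 𝕜 := ContinuousLinearMap.proj i ∘L (e : E →L[𝕜] Fin (finrank 𝕜 E) → 𝕜)
    refine (contDiffOn_comp_chart_symm (smoothOn_bracket_chart hP m₀ α β)).congr
      fun x hx => ?_
    have := bracket_comp_chart P m₀ hx α.differentiableAt β.differentiableAt
    rw [α.fderiv, β.fderiv] at this
    exact this.symm
  have h2 := e.symm.contDiff.comp_contDiffOn h
  exact h2.congr fun x hx => (e.symm_apply_apply _).symm

/-- This is the Jacobi identity for linear functions of the chart, since {β, γ} is x ↦ β (Q x γ) and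
{α, ·} differentiates along -Q x α. -/
theorem chartField_jacobi {P : TensorField 𝕜 E M} (hP : IsPoisson P) (m₀ : M)
    {x : E} (hx : x ∈ (chartAt E m₀).target) (α β γ : E →L[𝕜] 𝕜) :
    β (fderiv 𝕜 (chartField P m₀) x (chartField P m₀ x α) γ) +
      γ (fderiv 𝕜 (chartField P m₀) x (chartField P m₀ x β) α) +
      α (fderiv 𝕜 (chartField P m₀) x (chartField P m₀ x γ) β) = 0 := by
  have hm := (chartAt E m₀).map_target hx
  have h : ∀ α : E →L[𝕜] 𝕜, SmoothOn 𝕜 E (α ∘ chartAt E m₀) (chartAt E m₀).source := fun α => by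
    have := smoothOn_comp_chart m₀ (V := Set.univ) α.contDiff.contDiffOn
    rwa [Set.preimage_univ, Set.inter_univ] at this
  have key : ∀ α β γ : E →L[𝕜] 𝕜, bracket P (α ∘ chartAt E m₀)
      (bracket P (β ∘ chartAt E m₀) (γ ∘ chartAt E m₀)) ((chartAt E m₀).symm x) =
      -β (fderiv 𝕜 (chartField P m₀) x (chartField P m₀ x α) γ) := by
    intro α β γ
    let c : E → 𝕜 := fun x => β (chartField P m₀ x γ)
    have hd : DifferentiableAt 𝕜 (chartField P m₀) x :=
      ((contDiffOn_chartField hP m₀).contDiffAt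
        ((chartAt E m₀).open_target.mem_nhds hx)).differentiableAt (by simp)
    have h1 : HasFDerivAt c (β ∘L (fderiv 𝕜 (chartField P m₀) x).flip γ) x := by
      refine (β.hasFDerivAt.comp x
        (hd.hasFDerivAt.clm_apply (hasFDerivAt_const γ x))).congr_fderiv ?_
      ext; simp
    have h2 : bracket P (β ∘ chartAt E m₀) (γ ∘ chartAt E m₀) =ᶠ[𝓝 ((chartAt E m₀).symm x)]
        c ∘ chartAt E m₀ := by
      refine Filter.mem_of_superset ((chartAt E m₀).open_source.mem_nhds hm) fun m hm => ?_
      have h3 := bracket_comp_chart P m₀ ((chartAt E m₀).map_source hm)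
        β.differentiableAt γ.differentiableAt
      rw [β.fderiv, γ.fderiv, (chartAt E m₀).left_inv hm] at h3
      exact h3
    rw [bracket, differential_congr h2]
    have h3 := bracket_comp_chart P m₀ hx α.differentiableAt h1.differentiableAt
    rw [α.fderiv, h1.fderiv] at h3
    refine h3.trans ?_
    rw [chartField_skew hP]
    rfl
  have hj := hP.jacobi _ (chartAt E m₀).open_source _ _ _ (h α) (h β) (h γ) _ hm
  rw [key, key, key] at hj
  linear_combination -hj

end Chart

/-! ### Casimir functions bound the corank -/

section Casimir

open Topology Bihamiltonian

variable {𝕜 : Type*} [RCLike 𝕜] [NormedAlgebra 𝕜 ℂ]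
  {E : Type*} [NormedAddCommGroup E] [NormedSpace 𝕜 E]
  {M : Type*} [TopologicalSpace M] [ChartedSpace E M] [IsManifold 𝓘(𝕜, E) ∞ M]

theorem differential_algebraMap_comp_chart (m₀ : M) {c : E → 𝕜} {m : M}
    (hm : m ∈ (chartAt E m₀).source) (hc : DifferentiableAt 𝕜 c (chartAt E m₀ m))
    (v : TangentSpace 𝓘(𝕜, E) m) :
    differential 𝕜 E ((fun x => algebraMap 𝕜 ℂ (c x)) ∘ chartAt E m₀) m v =
      algebraMap 𝕜 ℂ (fderiv 𝕜 c (chartAt E m₀ m) (differential 𝕜 E (chartAt E m₀) m v)) := by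
  have h1 : HasFDerivAt (fun x => algebraMap 𝕜 ℂ (c x)) _ (chartAt E m₀ m) :=
    (algebraMapCLM 𝕜 ℂ).hasFDerivAt.comp _ hc.hasFDerivAt
  rw [differential_comp_chart m₀ hm h1.differentiableAt, h1.fderiv]
  rfl

/-- Vectors dual to the differentials over 𝕜 also detect the coefficients of a complex relation. -/
theorem linearIndependent_differential_comp_chart (m₀ : M) {r : ℕ} {c : Fin r → E → 𝕜} {m : M}
    (hm : m ∈ (chartAt E m₀).source) (hc : ∀ i, DifferentiableAt 𝕜 (c i) (chartAt E m₀ m))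
    (hli : LinearIndependent 𝕜 fun i => fderiv 𝕜 (c i) (chartAt E m₀ m)) :
    LinearIndependent ℂ fun i =>
      differential 𝕜 E ((fun x => algebraMap 𝕜 ℂ (c i x)) ∘ chartAt E m₀) m := by
  obtain ⟨v, hv⟩ := exists_dual_vectors
    (f := fun i => (fderiv 𝕜 (c i) (chartAt E m₀ m) : E →ₗ[𝕜] 𝕜))
    (hli.map' (ContinuousLinearMap.coeLM 𝕜)
      (LinearMap.ker_eq_bot.mpr ContinuousLinearMap.coe_injective))
  have hs := (mdifferentiable_chart (I := 𝓘(𝕜, E)) m₀).mfderiv_surjective hm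
  choose w hw using fun i => hs (v i)
  rw [Fintype.linearIndependent_iff]
  intro z hz j
  have h1 := congrArg (fun T : Covector 𝕜 E ℂ m => T (w j)) hz
  have h2 : ∀ i, differential 𝕜 E ((fun x => algebraMap 𝕜 ℂ (c i x)) ∘ chartAt E m₀) m (w j) =
      if i = j then 1 else 0 := by
    intro i
    rw [differential_algebraMap_comp_chart m₀ hm (hc i)]
    have h3 : differential 𝕜 E (chartAt E m₀) m (w j) = v j := hw j
    have h4 : fderiv 𝕜 (c i) (chartAt E m₀ m) (v j) = _ := hv i j
    rw [h3, h4]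
    split_ifs <;> simp
  simp only [sum_apply, smul_apply, h2] at h1
  simpa using h1

variable [FiniteDimensional 𝕜 E]

theorem isCasimirOn_comp_chart {P₁ P₂ : TensorField 𝕜 E M} {a b : 𝕜} (m₀ : M) {V : Set E}
    (hV : IsOpen V) {c : E → 𝕜} (hc : ContDiffOn 𝕜 ∞ c V)
    (h : ∀ x ∈ V, ∀ β, fderiv 𝕜 c x (chartField (a • P₁ + b • P₂) m₀ x β) = 0) :
    IsCasimirOn P₁ P₂ (algebraMap 𝕜 ℂ a) (algebraMap 𝕜 ℂ b)
      ((fun x => algebraMap 𝕜 ℂ (c x)) ∘ chartAt E m₀)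
      ((chartAt E m₀).source ∩ chartAt E m₀ ⁻¹' V) := by
  refine ⟨smoothOn_comp_chart m₀ ((algebraMapCLM 𝕜 ℂ).contDiff.comp_contDiffOn hc), ?_⟩
  intro V' _ hV' g _ m hm
  obtain ⟨hms, hmV⟩ := hV' hm
  have hd : DifferentiableAt 𝕜 c (chartAt E m₀ m) :=
    (hc.contDiffAt (hV.mem_nhds hmV)).differentiableAt (by simp)
  obtain ⟨f, hf, -⟩ := exists_covector_equiv (𝕜 := 𝕜) 𝕜 𝕜 m₀ hms
  have h1 := h _ hmV (f.symm (differential 𝕜 E (A := 𝕜) g m))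
  rw [chartField_apply, (chartAt E m₀).left_inv hms, ← hf, f.apply_symm_apply] at h1
  rw [bracket, bracket, differential_algebraMap_comp_chart m₀ hms hd,
    differential_algebraMap_comp_chart m₀ hms hd, ← map_mul, ← map_mul, ← map_add]
  refine (congrArg (algebraMap 𝕜 ℂ) ?_).trans (map_zero (algebraMap 𝕜 ℂ))
  rw [← h1]
  simp only [Pi.add_apply, Pi.smul_apply, LinearMap.add_apply, LinearMap.smul_apply, map_add,
    map_smul, smul_eq_mul]

/-- Where the rank of a Poisson structure is locally constant, its corank is bounded by the number
of independent Casimir functions. -/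
theorem finrank_ker_le_of_casimirs {P₁ P₂ : TensorField 𝕜 E M} (hP : IsBihamiltonian P₁ P₂)
    {a b : 𝕜} {R : ℕ} {N : Set M} (hN : IsOpen N)
    (hCas : ∀ V : Set M, IsOpen V → V ⊆ N → ∀ G : Fin (R + 1) → M → ℂ,
      (∀ i, IsCasimirOn P₁ P₂ (algebraMap 𝕜 ℂ a) (algebraMap 𝕜 ℂ b) (G i) V) →
        DependentOn 𝕜 E G V)
    (m₀ : M) {x : E} (hx : x ∈ (chartAt E m₀).target) (hxN : (chartAt E m₀).symm x ∈ N)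
    (hconst : ∀ᶠ y in 𝓝 x,
      finrank 𝕜 (LinearMap.range (chartField (a • P₁ + b • P₂) m₀ y).toLinearMap) =
        finrank 𝕜 (LinearMap.range (chartField (a • P₁ + b • P₂) m₀ x).toLinearMap)) :
    finrank 𝕜 (LinearMap.ker (chartField (a • P₁ + b • P₂) m₀ x).toLinearMap) ≤ R := by
  by_contra! hlt
  have hPab := hP.2.2 a b
  obtain ⟨W, hW, hWo, hxW⟩ := eventually_nhds_iff.mp hconst
  let O : Set E := (chartAt E m₀).target ∩ (chartAt E m₀).symm ⁻¹' N ∩ W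
  have hO : IsOpen O := ((chartAt E m₀).isOpen_inter_preimage_symm hN).inter hWo
  obtain ⟨c, V, hV, hxV, hVO, hc, hcQ, hli⟩ := exists_casimirs hO
    ((contDiffOn_chartField hPab m₀).mono fun y hy => hy.1.1)
    (fun y _ => chartField_skew hPab m₀ y) (fun y hy => chartField_jacobi hPab m₀ hy.1.1)
    (x₀ := x) ⟨⟨hx, hxN⟩, hxW⟩ (fun y hy => hW y hy.2) rfl
  have hd : ∀ i, DifferentiableAt 𝕜 (c i) x := fun i =>
    ((hc i).contDiffAt (hV.mem_nhds hxV)).differentiableAt (by simp)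
  have hm := (chartAt E m₀).map_target hx
  have hr := (chartAt E m₀).right_inv hx
  -- If the corank exceeded R, the first R + 1 of the functions found would be Casimir functions
  -- with independent differentials at x.
  refine hCas ((chartAt E m₀).source ∩ chartAt E m₀ ⁻¹' V)
    ((chartAt E m₀).isOpen_inter_preimage hV) (fun m hm => ?_)
    (fun i => (fun x => algebraMap 𝕜 ℂ (c (Fin.castLE hlt i) x)) ∘ chartAt E m₀)
    (fun i => isCasimirOn_comp_chart m₀ hV (hc _) (hcQ _)) ((chartAt E m₀).symm x)
    ⟨hm, by rw [Set.mem_preimage, hr]; exact hxV⟩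
    (linearIndependent_differential_comp_chart m₀ hm (fun i => by rw [hr]; exact hd _) ?_)
  · have := (hVO hm.2).1.2
    rwa [Set.mem_preimage, (chartAt E m₀).left_inv hm.1] at this
  · rw [hr]
    exact hli.comp _ (Fin.castLE_injective hlt)

end Casimir

/-! ### Generic constancy of ranks -/

section LowerSemicontinuous

open Topology

/-- In any nonempty open set take a point where the bounded sum ∑ f i is maximal. Nearby no integer
f i drops and the sum cannot grow, so every f i is constant. -/
theorem dense_eventually_eq_of_lowerSemicontinuous {X ι : Type*} [TopologicalSpace X] [Fintype ι]
    {f : ι → X → ℕ} (hf : ∀ i, LowerSemicontinuous (f i)) {C : ℕ} (hC : ∀ i x, f i x ≤ C) :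
    Dense {x | ∀ i, ∀ᶠ y in 𝓝 x, f i y = f i x} := by
  rw [dense_iff_inter_open]
  intro W hW hne
  let s : Set ℕ := (fun x => ∑ i, f i x) '' W
  have hs : BddAbove s := ⟨∑ _ : ι, C, by
    rintro _ ⟨x, -, rfl⟩
    exact Finset.sum_le_sum fun i _ => hC i x⟩
  obtain ⟨x, hx, hmax⟩ := Nat.sSup_mem (hne.image _) hs
  refine ⟨x, hx, fun i => ?_⟩
  have h1 : ∀ᶠ y in 𝓝 x, ∀ j, f j x ≤ f j y := by
    refine Filter.eventually_all.mpr fun j => ?_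
    rcases Nat.eq_zero_or_pos (f j x) with h0 | h0
    · exact Filter.Eventually.of_forall fun y => h0 ▸ Nat.zero_le _
    · filter_upwards [hf j x (f j x - 1) (by omega)] with y hy
      omega
  filter_upwards [h1, hW.mem_nhds hx] with y hy hyW
  have h2 : ∑ j, f j y ≤ ∑ j, f j x := (le_csSup hs ⟨y, hyW, rfl⟩).trans hmax.ge
  have h3 := (Finset.sum_eq_sum_iff_of_le fun j _ => hy j).mp
    (le_antisymm (Finset.sum_le_sum fun j _ => hy j) h2)
  exact (h3 i (Finset.mem_univ i)).symm

end LowerSemicontinuous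

section PolynomialMap

variable {𝕜 : Type*} [RCLike 𝕜] {V Z : Type*} [NormedAddCommGroup V] [NormedSpace 𝕜 V]
  [NormedAddCommGroup Z] [NormedSpace 𝕜 Z]

variable (𝕜 V) in
/-- The `j`-th coefficient of a polynomial of degree less than `q`. -/
noncomputable def polynomialCoeff (q j : ℕ) : (Fin q → V) →L[𝕜] V :=
  if h : j < q then ContinuousLinearMap.proj ⟨j, h⟩ else 0

/-- Multiplication of polynomials of degree less than `q` by `T₂ + λ T₁`. -/
noncomputable def polynomialMap (T₁ T₂ : V →L[𝕜] Z) (q : ℕ) : (Fin q → V) →L[𝕜] (Fin (q + 1) → Z) :=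
  ContinuousLinearMap.pi fun i => Fin.cases (T₂ ∘L polynomialCoeff 𝕜 V q 0)
    (fun j => T₁ ∘L polynomialCoeff 𝕜 V q j + T₂ ∘L polynomialCoeff 𝕜 V q (j + 1)) i

/-- Extension by zero identifies the two kernels; the equations with j ≥ q are void. This expresses
the kernel dimension through the rank of a map that varies continuously with T₁ and T₂. -/
theorem finrank_ker_polynomialMap (T₁ T₂ : V →L[𝕜] Z) (q : ℕ) :
    finrank 𝕜 (LinearMap.ker (polynomialMap T₁ T₂ q).toLinearMap) =
      finrank 𝕜 (polynomialKernel (T₁ : V →ₗ[𝕜] Z) (T₂ : V →ₗ[𝕜] Z) q) := by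
  let ext : (Fin q → V) →ₗ[𝕜] (ℕ → V) :=
    LinearMap.pi fun j => (polynomialCoeff 𝕜 V q j).toLinearMap
  have hext : Function.Injective ext := by
    intro x y h
    funext i
    have h1 := congrFun h i
    simpa [ext, polynomialCoeff] using h1
  have hmap : (LinearMap.ker (polynomialMap T₁ T₂ q).toLinearMap).map ext =
      polynomialKernel (T₁ : V →ₗ[𝕜] Z) (T₂ : V →ₗ[𝕜] Z) q := by
    ext y
    constructor
    · rintro ⟨x, hx, rfl⟩
      have h0 := congrFun hx 0
      refine ⟨fun j hj => ?_, h0, fun j => ?_⟩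
      · simp [ext, polynomialCoeff, hj.not_gt]
      · by_cases hj : j < q
        · exact congrFun hx (Fin.succ ⟨j, hj⟩)
        · have hj' : ¬ j + 1 < q := by omega
          simp [ext, polynomialCoeff, hj, hj']
    · rintro ⟨hy, h0, h1⟩
      have hc : ∀ j, polynomialCoeff 𝕜 V q j (fun i => y i) = y j := by
        intro j
        by_cases hj : j < q
        · simp [polynomialCoeff, hj]
        · simp [polynomialCoeff, hj, hy j (by omega)]
      refine ⟨fun i => y i, ?_, funext hc⟩
      refine funext fun i => ?_
      refine Fin.cases ?_ (fun j => ?_) i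
      · exact (congrArg T₂ (hc 0)).trans h0
      · exact (congrArg₂ (fun u v => T₁ u + T₂ v) (hc j) (hc (j + 1))).trans (h1 j)
  rw [← hmap]
  exact (Submodule.equivMapOfInjective ext hext _).finrank_eq

theorem continuous_polynomialMap {X : Type*} [TopologicalSpace X] [FiniteDimensional 𝕜 V]
    {T₁ T₂ : X → V →L[𝕜] Z} (h₁ : Continuous T₁) (h₂ : Continuous T₂) (q : ℕ) :
    Continuous fun x => polynomialMap (T₁ x) (T₂ x) q := by
  refine continuous_clm_apply.mpr fun v => continuous_pi fun i => ?_
  refine Fin.cases ?_ (fun j => ?_) i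
  · exact h₂.clm_apply continuous_const
  · exact (h₁.clm_apply continuous_const).add (h₂.clm_apply continuous_const)

theorem lowerSemicontinuous_finrank_range {X : Type*} [TopologicalSpace X]
    [FiniteDimensional 𝕜 V] {T : X → V →L[𝕜] Z} (h : Continuous T) :
    LowerSemicontinuous fun x => finrank 𝕜 (LinearMap.range (T x).toLinearMap) := by
  rw [lowerSemicontinuous_iff_isOpen_preimage]
  intro n
  have h1 := (isOpen_setOfPred_nat_le_rank (𝕜 := 𝕜) (E := V) (F := Z) (n + 1)).preimage h
  convert! h1 using 1
  ext x
  have h2 : (T x).toLinearMap.rank = finrank 𝕜 (LinearMap.range (T x).toLinearMap) :=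
    (finrank_eq_rank 𝕜 _).symm
  simp only [Set.mem_preimage, Set.mem_Ioi, Set.mem_ofPred_eq, h2]
  norm_cast

end PolynomialMap

/-! ### Open sets of constant type -/

section ConstantType

open Topology Bihamiltonian

variable {𝕜 : Type*} [RCLike 𝕜] {E : Type*} [NormedAddCommGroup E] [NormedSpace 𝕜 E]

/-- The form `(α, β) ↦ α (Q β)` on covectors. -/
def dualForm (Q : (E →L[𝕜] 𝕜) →L[𝕜] E) : LinearMap.BilinForm 𝕜 (E →L[𝕜] 𝕜) :=
  LinearMap.mk₂ 𝕜 (fun α β => α (Q β)) (fun _ _ _ => rfl) (fun _ _ _ => rfl)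
    (fun _ _ _ => by simp only [map_add]) (fun _ _ _ => by simp only [map_smul])

@[simp]
theorem dualForm_apply (Q : (E →L[𝕜] 𝕜) →L[𝕜] E) (α β : E →L[𝕜] 𝕜) :
    dualForm Q α β = α (Q β) := rfl

/-- By skewness `dualForm Q α` is evaluation at -Q α, so the forms and the maps satisfy the same
relations. -/
theorem polynomialKernel_dualForm {Q₁ Q₂ : (E →L[𝕜] 𝕜) →L[𝕜] E}
    (sk₁ : ∀ α β : E →L[𝕜] 𝕜, α (Q₁ β) = -β (Q₁ α))
    (sk₂ : ∀ α β : E →L[𝕜] 𝕜, α (Q₂ β) = -β (Q₂ α)) (q : ℕ) :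
    polynomialKernel (dualForm Q₁) (dualForm Q₂) q =
      polynomialKernel Q₁.toLinearMap Q₂.toLinearMap q := by
  have key : ∀ α β, dualForm Q₁ α + dualForm Q₂ β = 0 ↔ Q₁ α + Q₂ β = 0 := by
    intro α β
    rw [SeparatingDual.eq_zero_iff_forall_dual_eq_zero (R := 𝕜) (V := E), LinearMap.ext_iff]
    refine forall_congr' fun γ => ?_
    rw [LinearMap.add_apply, dualForm_apply, dualForm_apply, sk₁, sk₂, map_add,
      LinearMap.zero_apply, ← neg_add, neg_eq_zero]
  have key' : ∀ β, dualForm Q₂ β = 0 ↔ Q₂ β = 0 := by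
    intro β
    have := key 0 β
    simpa using this
  ext x
  refine and_congr Iff.rfl (and_congr (key' _) (forall_congr' fun j => key _ _))

variable [FiniteDimensional 𝕜 E]

/-- If a continuous pair of forms is a sum of Kronecker pairs wherever the rank of some combination
is locally constant, then every point is in the closure of an open set where the type is constant. -/
theorem exists_isKroneckerSum_constant_type {X : Type*} [TopologicalSpace X]
    {Q₁ Q₂ : X → (E →L[𝕜] 𝕜) →L[𝕜] E} (hQ₁ : Continuous Q₁) (hQ₂ : Continuous Q₂)
    (sk₁ : ∀ x, ∀ α β : E →L[𝕜] 𝕜, α (Q₁ x β) = -β (Q₁ x α))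
    (sk₂ : ∀ x, ∀ α β : E →L[𝕜] 𝕜, α (Q₂ x β) = -β (Q₂ x α)) {a b : 𝕜} {R : ℕ}
    (h : ∀ x, (∀ᶠ y in 𝓝 x, finrank 𝕜 (LinearMap.range (a • Q₁ y + b • Q₂ y).toLinearMap) =
      finrank 𝕜 (LinearMap.range (a • Q₁ x + b • Q₂ x).toLinearMap)) →
      ∃ d : Fin R → ℕ, IsKroneckerSum (dualForm (Q₁ x)) (dualForm (Q₂ x)) fun k => 2 * d k + 1)
    (x₀ : X) :
    ∃ (d : Fin R → ℕ) (D : Set X), IsOpen D ∧ x₀ ∈ closure D ∧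
      ∀ x ∈ D, (∀ᶠ y in 𝓝 x, finrank 𝕜 (LinearMap.range (a • Q₁ y + b • Q₂ y).toLinearMap) =
        finrank 𝕜 (LinearMap.range (a • Q₁ x + b • Q₂ x).toLinearMap)) ∧
        IsKroneckerSum (dualForm (Q₁ x)) (dualForm (Q₂ x)) fun k => 2 * d k + 1 := by
  set n := finrank 𝕜 (E →L[𝕜] 𝕜) with hn
  -- `none` records the rank that h needs to be locally constant; `some q`, q ≤ n + 1, records the
  -- ranks that recover block sizes d k ≤ n.
  let f : Option (Fin (n + 2)) → X → ℕ := fun i => match i with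
    | none => fun x => finrank 𝕜 (LinearMap.range (a • Q₁ x + b • Q₂ x).toLinearMap)
    | some q => fun x => finrank 𝕜 (LinearMap.range (polynomialMap (Q₁ x) (Q₂ x) q).toLinearMap)
  have hf : ∀ i, LowerSemicontinuous (f i) := by
    rintro (_ | q)
    · exact lowerSemicontinuous_finrank_range (continuous_clm_apply.mpr fun v =>
        ((hQ₁.clm_apply continuous_const).const_smul a).add
          ((hQ₂.clm_apply continuous_const).const_smul b))
    · exact lowerSemicontinuous_finrank_range (continuous_polynomialMap hQ₁ hQ₂ q)
  have hsum : ∀ (x : X) (q : ℕ), finrank 𝕜 (LinearMap.range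
      (polynomialMap (Q₁ x) (Q₂ x) q).toLinearMap) + finrank 𝕜 (polynomialKernel
        (dualForm (Q₁ x)) (dualForm (Q₂ x)) q) = q * n := by
    intro x q
    rw [polynomialKernel_dualForm (sk₁ x) (sk₂ x), ← finrank_ker_polynomialMap,
      LinearMap.finrank_range_add_finrank_ker]
    rw [finrank_pi_fintype, Finset.sum_const, Finset.card_univ, Fintype.card_fin, smul_eq_mul, hn]
  have hC : ∀ i x, f i x ≤ (n + 2) * n + n := by
    rintro (_ | q) x
    · exact (LinearMap.finrank_range_le _).trans (Nat.le_add_left _ _)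
    · have h1 := hsum x q
      have h2 : (q : ℕ) * n ≤ (n + 2) * n := Nat.mul_le_mul_right n q.2.le
      change finrank 𝕜 (LinearMap.range (polynomialMap (Q₁ x) (Q₂ x) q).toLinearMap) ≤ _
      omega
  have hdense := dense_eventually_eq_of_lowerSemicontinuous hf hC
  set G : Set X := {x | ∀ i, ∀ᶠ y in 𝓝 x, f i y = f i x} with hG
  -- Entries bounded by n leave only finitely many types.
  let type : X → (Fin R → Fin (n + 1)) → Prop := fun x d =>
    IsKroneckerSum (dualForm (Q₁ x)) (dualForm (Q₂ x)) fun k => 2 * (d k : ℕ) + 1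
  have htype : ∀ x ∈ G, ∃ d, type x d := by
    intro x hx
    obtain ⟨d, hd⟩ := h x (hx none)
    have hdn : ∀ k, d k < n + 1 := by
      intro k
      obtain ⟨-, e, -⟩ := hd
      have h1 := finrank_eq_card_basis e
      rw [Fintype.card_sigma] at h1
      simp only [Fintype.card_fin] at h1
      have h2 := Finset.single_le_sum (f := fun k => 2 * d k + 1) (fun _ _ => Nat.zero_le _)
        (Finset.mem_univ k)
      have h3 : 2 * d k + 1 ≤ n := h2.trans h1.ge
      omega
    exact ⟨fun k => ⟨d k, hdn k⟩, hd⟩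
  have hker : ∀ x d, type x d → ∀ q, finrank 𝕜 (polynomialKernel (dualForm (Q₁ x))
      (dualForm (Q₂ x)) q) = ∑ k, (q - (d k : ℕ)) := by
    rintro x d ⟨-, e, he⟩ q
    exact finrank_polynomialKernel_of_kronecker_basis e he q
  have hopen : ∀ d, IsOpen {x | x ∈ G ∧ type x d} := by
    intro d
    rw [isOpen_iff_mem_nhds]
    rintro x ⟨hx, hxd⟩
    have h1 : ∀ᶠ y in 𝓝 x, ∀ i, f i y = f i x := Filter.eventually_all.mpr hx
    filter_upwards [h1.eventually_nhds] with y hy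
    have hyx := hy.self_of_nhds
    have hyG : y ∈ G := fun i => by
      filter_upwards [hy] with z hz
      rw [hz i, hyx i]
    refine ⟨hyG, ?_⟩
    -- Equal ranks at x and y mean equal polynomial kernel dimensions, so d' is a permutation of d.
    obtain ⟨d', hd'⟩ := htype y hyG
    obtain ⟨σ, hσ⟩ := exists_perm_of_sum_sub_eq (Q := n) (d := fun k => (d k : ℕ))
      (d' := fun k => (d' k : ℕ)) (fun k => Nat.lt_succ_iff.mp (d k).2)
      (fun k => Nat.lt_succ_iff.mp (d' k).2) fun q hq => by
        rw [← hker x d hxd, ← hker y d' hd']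
        have h2 := hsum x q
        have h3 := hsum y q
        have h4 : finrank 𝕜 (LinearMap.range (polynomialMap (Q₁ y) (Q₂ y) q).toLinearMap) =
            finrank 𝕜 (LinearMap.range (polynomialMap (Q₁ x) (Q₂ x) q).toLinearMap) :=
          hyx (some ⟨q, by omega⟩)
        omega
    exact IsKroneckerSum.perm hd' σ fun k => by simp only [hσ]
  have hcl : x₀ ∈ closure (⋃ d, {x | x ∈ G ∧ type x d}) := by
    have h1 : G = ⋃ d, {x | x ∈ G ∧ type x d} := by
      ext x
      simp only [Set.mem_iUnion, Set.mem_ofPred_eq, exists_and_left]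
      exact ⟨fun hx => ⟨hx, htype x hx⟩, fun hx => hx.1⟩
    rw [← h1]
    exact hdense x₀
  -- The closure of a finite union is the union of the closures, so one type already accumulates at
  -- x₀.
  rw [closure_iUnion_of_finite, Set.mem_iUnion] at hcl
  obtain ⟨d, hd⟩ := hcl
  exact ⟨fun k => d k, _, hopen d, hd, fun x hx => ⟨hx.1 none, hx.2⟩⟩

end ConstantType

/-! ### Isotropy of the span of Casimir differentials -/

section Pointwise

open Topology Bihamiltonian

/-- Neither kind of parameter set has isolated points. -/
theorem subset_closure_diff_finite {U : Set ℂ}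
    (hU : IsOpen U ∨ ∃ V : Set ℝ, IsOpen V ∧ U = (fun x : ℝ => (x : ℂ)) '' V) {s : Set ℂ}
    (hs : s.Finite) : U ⊆ closure (U \ s) := by
  rcases hU with hU | ⟨V, hV, rfl⟩
  · exact (hs.countable.dense_compl ℝ).open_subset_closure_inter hU
  · have h1 : ((fun x : ℝ => (x : ℂ)) ⁻¹' s).Finite :=
      hs.preimage Complex.ofReal_injective.injOn
    rintro _ ⟨x, hx, rfl⟩
    have h2 := (h1.countable.dense_compl ℝ).open_subset_closure_inter hV hx
    have h3 := image_closure_subset_closure_image Complex.continuous_ofReal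
      (Set.mem_image_of_mem _ h2)
    refine closure_mono ?_ h3
    rintro _ ⟨y, ⟨hy, hys⟩, rfl⟩
    exact ⟨⟨y, hy, rfl⟩, hys⟩

variable {𝕜 : Type*} [RCLike 𝕜]
  {E : Type*} [NormedAddCommGroup E] [NormedSpace 𝕜 E]

theorem ker_dualForm_combination {Q₁ Q₂ : (E →L[𝕜] 𝕜) →L[𝕜] E}
    (sk₁ : ∀ α β : E →L[𝕜] 𝕜, α (Q₁ β) = -β (Q₁ α))
    (sk₂ : ∀ α β : E →L[𝕜] 𝕜, α (Q₂ β) = -β (Q₂ α)) (a b : 𝕜) :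
    LinearMap.ker (a • dualForm Q₁ + b • dualForm Q₂) =
      LinearMap.ker (a • Q₁ + b • Q₂).toLinearMap := by
  ext α
  change a • dualForm Q₁ α + b • dualForm Q₂ α = 0 ↔ a • Q₁ α + b • Q₂ α = 0
  rw [SeparatingDual.eq_zero_iff_forall_dual_eq_zero (R := 𝕜) (V := E), LinearMap.ext_iff]
  refine forall_congr' fun γ => ?_
  rw [LinearMap.add_apply, LinearMap.smul_apply, LinearMap.smul_apply, dualForm_apply,
    dualForm_apply, sk₁, sk₂, map_add, map_smul, map_smul, LinearMap.zero_apply, smul_neg, smul_neg,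
    ← neg_add, neg_eq_zero]

variable {I : Type*} [Fintype I]

/-- The dual basis, in the space of continuous functionals. -/
noncomputable def covectorBasis [DecidableEq I] [FiniteDimensional 𝕜 E] (v : Basis I 𝕜 E) :
    Basis I 𝕜 (E →L[𝕜] 𝕜) :=
  v.dualBasis.map LinearMap.toContinuousLinearMap

theorem covectorBasis_apply [DecidableEq I] [FiniteDimensional 𝕜 E] (v : Basis I 𝕜 E) (i j : I) :
    covectorBasis v i (v j) = if j = i then 1 else 0 := by
  simp [covectorBasis, Finsupp.single_apply, eq_comm]

variable [NormedAlgebra 𝕜 ℂ]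

theorem exists_complexCovectorBasis [DecidableEq I] [FiniteDimensional 𝕜 E] (v : Basis I 𝕜 E) :
    ∃ e : Basis I ℂ (E →L[𝕜] ℂ), ∀ i x, e i x = algebraMap 𝕜 ℂ (covectorBasis v i x) := by
  let w : I → E →L[𝕜] ℂ := fun i => algebraMapCLM 𝕜 ℂ ∘L covectorBasis v i
  have hw : ∀ i j, w i (v j) = if j = i then 1 else 0 := fun i j => by
    change algebraMap 𝕜 ℂ (covectorBasis v i (v j)) = _
    rw [covectorBasis_apply]
    split_ifs <;> simp
  have hli : LinearIndependent ℂ w := by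
    rw [Fintype.linearIndependent_iff]
    intro z hz j
    have h1 := congrArg (fun T : E →L[𝕜] ℂ => T (v j)) hz
    simpa [hw] using h1
  have hsp : ⊤ ≤ Submodule.span ℂ (Set.range w) := by
    intro u _
    have h1 : u = ∑ i, u (v i) • w i := by
      refine ContinuousLinearMap.coe_injective (v.ext fun j => ?_)
      change u (v j) = (∑ i, u (v i) • w i) (v j)
      simp [hw]
    rw [h1]
    exact Submodule.sum_mem _ fun i _ =>
      Submodule.smul_mem _ _ (Submodule.subset_span (Set.mem_range_self i))
  refine ⟨Basis.mk hli hsp, fun i x => ?_⟩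
  rw [Basis.mk_apply]
  rfl

/-- The complex bilinear extension of `dualForm Q`. -/
noncomputable def complexDualForm (v : Basis I 𝕜 E) (e : I → E →L[𝕜] 𝕜)
    (Q : (E →L[𝕜] 𝕜) →L[𝕜] E) : LinearMap.BilinForm ℂ (E →L[𝕜] ℂ) :=
  LinearMap.mk₂ ℂ (fun w w' => ∑ j, w (Q (e j)) * w' (v j))
    (fun _ _ _ => by simp [add_mul, Finset.sum_add_distrib])
    (fun _ _ _ => by simp [mul_assoc, Finset.mul_sum])
    (fun _ _ _ => by simp [mul_add, Finset.sum_add_distrib])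
    (fun _ _ _ => by simp [mul_left_comm, Finset.mul_sum])

theorem complexDualForm_apply (v : Basis I 𝕜 E) (e : I → E →L[𝕜] 𝕜)
    (Q : (E →L[𝕜] 𝕜) →L[𝕜] E) (w w' : E →L[𝕜] ℂ) :
    complexDualForm v e Q w w' = ∑ j, w (Q (e j)) * w' (v j) := rfl

theorem continuous_complexDualForm_left (v : Basis I 𝕜 E) (e : I → E →L[𝕜] 𝕜)
    (Q : (E →L[𝕜] 𝕜) →L[𝕜] E) (w' : E →L[𝕜] ℂ) :
    Continuous fun w => complexDualForm v e Q w w' :=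
  continuous_finsetSum _ fun _ _ =>
    ((ContinuousLinearMap.apply 𝕜 ℂ _).continuous).mul continuous_const

variable [FiniteDimensional 𝕜 E]

/-- A large space spanned by continuous families of kernel vectors of the pencil forces the pair to
be a sum of Kronecker pairs. -/
theorem exists_isKroneckerSum_of_span {Q₁ Q₂ : (E →L[𝕜] 𝕜) →L[𝕜] E}
    (sk₁ : ∀ α β : E →L[𝕜] 𝕜, α (Q₁ β) = -β (Q₁ α))
    (sk₂ : ∀ α β : E →L[𝕜] 𝕜, α (Q₂ β) = -β (Q₂ α)) {L : Type*} {U : L → Set ℂ}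
    (hU : ∀ l, ∀ s : Set ℂ, s.Finite → U l ⊆ closure (U l \ s)) {w : L → ℂ → E →L[𝕜] ℂ}
    (hw : ∀ l, ContinuousOn (w l) (U l))
    (hker : ∀ l, ∀ z ∈ U l, ∀ β, z * w l z (Q₁ β) + w l z (Q₂ β) = 0) {a b : 𝕜} {R : ℕ}
    (hR : finrank 𝕜 (LinearMap.ker (a • Q₁ + b • Q₂).toLinearMap) ≤ R)
    (hX : finrank 𝕜 E + R ≤
      2 * finrank ℂ (Submodule.span ℂ {u | ∃ l, ∃ z ∈ U l, u = w l z})) :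
    2 * finrank ℂ (Submodule.span ℂ {u | ∃ l, ∃ z ∈ U l, u = w l z}) = finrank 𝕜 E + R ∧
      ∃ d : Fin R → ℕ, IsKroneckerSum (dualForm Q₁) (dualForm Q₂) fun k => 2 * d k + 1 := by
  set X := Submodule.span ℂ {u | ∃ l, ∃ z ∈ U l, u = w l z} with hXdef
  let v := finBasis 𝕜 E
  let e := covectorBasis v
  obtain ⟨e', he'⟩ := exists_complexCovectorBasis v
  have hdual : finrank 𝕜 (E →L[𝕜] 𝕜) = finrank 𝕜 E := by
    rw [finrank_eq_card_basis e, Fintype.card_fin]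
  have hform : ∀ (Q : (E →L[𝕜] 𝕜) →L[𝕜] E) i j, complexDualForm v e Q (e' i) (e' j) =
      algebraMap 𝕜 ℂ (dualForm Q (e i) (e j)) := by
    intro Q i j
    rw [complexDualForm_apply, Finset.sum_eq_single j]
    · rw [he', he', covectorBasis_apply, if_pos rfl, map_one, mul_one]
      rfl
    · intro k _ hk
      rw [he' j, covectorBasis_apply, if_neg hk, map_zero, mul_zero]
    · simp
  have hsk : ∀ Q : (E →L[𝕜] 𝕜) →L[𝕜] E, (∀ α β : E →L[𝕜] 𝕜, α (Q β) = -β (Q α)) →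
      ∀ x y, complexDualForm v e Q x y = -complexDualForm v e Q y x := fun Q hQ =>
    LinearMap.BilinForm.skew_of_basis e' fun i j => by
      rw [hform, hform, dualForm_apply, hQ, map_neg, dualForm_apply]
  set b₁ := complexDualForm v e Q₁ with hb₁
  set b₂ := complexDualForm v e Q₂ with hb₂
  have hkerb : ∀ l, ∀ z ∈ U l, z • b₁ (w l z) + b₂ (w l z) = 0 := by
    intro l z hz
    ext u
    change z * ∑ j, w l z (Q₁ (e j)) * u (v j) + ∑ j, w l z (Q₂ (e j)) * u (v j) = 0
    rw [Finset.mul_sum, ← Finset.sum_add_distrib]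
    refine Finset.sum_eq_zero fun j _ => ?_
    rw [← mul_assoc, ← add_mul, hker l z hz, zero_mul]
  -- closed conditions may be checked away from a finite set of parameters
  have hclosed : ∀ l, ∀ z ∈ U l, ∀ s : Set ℂ, s.Finite → ∀ C : Set (E →L[𝕜] ℂ), IsClosed C →
      (∀ ζ ∈ U l, ζ ∉ s → w l ζ ∈ C) → w l z ∈ C := by
    intro l z hz s hs C hC h
    have h1 := ((hw l z hz).mono (Set.sdiff_subset (t := s))).mem_closure_image (hU l s hs hz)
    refine hC.closure_subset_iff.mpr ?_ h1
    rintro _ ⟨ζ, hζ, rfl⟩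
    exact h ζ hζ.1 hζ.2
  -- For ζ ≠ z' the two kernel relations and skewness give (ζ - z') b₁ = 0, and then b₂ = 0. The
  -- case of equal parameters follows by letting ζ vary.
  have hiso' : ∀ l, ∀ z ∈ U l, ∀ l', ∀ z' ∈ U l',
      b₁ (w l z) (w l' z') = 0 ∧ b₂ (w l z) (w l' z') = 0 := by
    intro l z hz l' z' hz'
    refine hclosed l z hz {z'} (Set.finite_singleton _)
      {u | b₁ u (w l' z') = 0 ∧ b₂ u (w l' z') = 0}
      ((isClosed_singleton.preimage (continuous_complexDualForm_left v e Q₁ _)).inter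
        (isClosed_singleton.preimage (continuous_complexDualForm_left v e Q₂ _)))
      fun ζ hζ hne => ?_
    have h1 : ζ * b₁ (w l ζ) (w l' z') + b₂ (w l ζ) (w l' z') = 0 :=
      LinearMap.congr_fun (hkerb l ζ hζ) _
    have h2 : z' * b₁ (w l' z') (w l ζ) + b₂ (w l' z') (w l ζ) = 0 :=
      LinearMap.congr_fun (hkerb l' z' hz') _
    rw [hsk Q₁ sk₁, hsk Q₂ sk₂ (w l' z')] at h2
    have h3 : (ζ - z') * b₁ (w l ζ) (w l' z') = 0 := by linear_combination h1 + h2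
    have h4 := (mul_eq_zero.mp h3).resolve_left (sub_ne_zero.mpr hne)
    refine ⟨h4, ?_⟩
    rwa [h4, mul_zero, zero_add] at h1
  have hiso : ∀ c : LinearMap.BilinForm ℂ (E →L[𝕜] ℂ), (∀ l, ∀ z ∈ U l, ∀ l', ∀ z' ∈ U l',
      c (w l z) (w l' z') = 0) → ∀ x ∈ X, ∀ y ∈ X, c x y = 0 := by
    intro c hc x hx y hy
    have h1 : X ≤ LinearMap.ker (c.flip y) := by
      refine Submodule.span_le.mpr ?_
      rintro _ ⟨l, z, hz, rfl⟩
      have h2 : X ≤ LinearMap.ker (c (w l z)) := by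
        refine Submodule.span_le.mpr ?_
        rintro _ ⟨l', z', hz', rfl⟩
        exact hc l z hz l' z' hz'
      exact h2 hy
    exact h1 hx
  obtain ⟨h1, d, f, hf⟩ := exists_kronecker_basis_of_isotropic two_ne_zero e e' (hform Q₁)
    (hform Q₂) (b₁ := dualForm Q₁) (b₂ := dualForm Q₂) sk₁ sk₂ (X := X) (R := R) (a := a) (b := b)
    (hiso b₁ fun l z hz l' z' hz' => (hiso' l z hz l' z' hz').1)
    (hiso b₂ fun l z hz l' z' hz' => (hiso' l z hz l' z' hz').2)
    (by rwa [ker_dualForm_combination sk₁ sk₂]) (by rwa [hdual]) fun s hs => by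
      -- A finite-dimensional span is closed, so omitting finitely many parameters loses nothing.
      refine Submodule.span_le.mpr ?_
      rintro _ ⟨l, z, hz, rfl⟩
      have : FiniteDimensional ℂ (E →L[𝕜] ℂ) := e'.finiteDimensional_of_finite
      refine hclosed l z hz s hs _ (Submodule.closed_of_finiteDimensional _) fun ζ hζ hζs => ?_
      exact Submodule.subset_span
        ⟨Submodule.subset_span ⟨l, ζ, hζ, rfl⟩, ζ, hζs, hkerb l ζ hζ⟩
  rw [hdual] at h1
  exact ⟨h1, d, fun k => ⟨d k, rfl⟩, f, hf⟩

end Pointwise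

/-! ### Transport between the manifold and the chart -/

section Final

open Topology Bihamiltonian

theorem IsKroneckerSum.congr {K W W' : Type*} [Field K] [AddCommGroup W] [Module K W]
    [AddCommGroup W'] [Module K W'] {b₁ b₂ : LinearMap.BilinForm K W}
    {b₁' b₂' : LinearMap.BilinForm K W'} {R : ℕ} {t : Fin R → ℕ} (h : IsKroneckerSum b₁ b₂ t)
    (f : W ≃ₗ[K] W') (h₁ : ∀ x y, b₁' (f x) (f y) = b₁ x y) (h₂ : ∀ x y, b₂' (f x) (f y) = b₂ x y) :
    IsKroneckerSum b₁' b₂' t := by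
  obtain ⟨ht, e, he⟩ := h
  refine ⟨ht, e.map f, fun x y => ?_⟩
  rw [Basis.map_apply, Basis.map_apply, h₁, h₂]
  exact he x y

variable {𝕜 : Type*} [RCLike 𝕜] {E : Type*} [NormedAddCommGroup E] [NormedSpace 𝕜 E]
  {M : Type*} [TopologicalSpace M] [ChartedSpace E M]

theorem chartField_combination [FiniteDimensional 𝕜 E] (P₁ P₂ : TensorField 𝕜 E M) (a b : 𝕜) (m₀ : M) (x : E) :
    chartField (a • P₁ + b • P₂) m₀ x = a • chartField P₁ m₀ x + b • chartField P₂ m₀ x := by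
  ext α
  simp [chartField_apply, map_add, map_smul]

variable [IsManifold 𝓘(𝕜, E) ∞ M]

theorem isKroneckerSum_pairing [FiniteDimensional 𝕜 E] {P₁ P₂ : TensorField 𝕜 E M} {m₀ : M} {x : E}
    (hx : x ∈ (chartAt E m₀).target) {R : ℕ} {t : Fin R → ℕ}
    (h : IsKroneckerSum (dualForm (chartField P₁ m₀ x)) (dualForm (chartField P₂ m₀ x)) t) :
    IsKroneckerSum (pairing P₁ ((chartAt E m₀).symm x)) (pairing P₂ ((chartAt E m₀).symm x)) t := by
  obtain ⟨f, hf, -⟩ := exists_covector_equiv (𝕜 := 𝕜) 𝕜 𝕜 m₀ ((chartAt E m₀).map_target hx)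
  refine IsKroneckerSum.congr h f (fun α β => ?_) fun α β => ?_
  · rw [hf, hf]; rfl
  · rw [hf, hf]; rfl

variable [NormedAlgebra 𝕜 ℂ]

theorem finrank_spanDifferentials_chart {L : Type*} (U : L → Set ℂ) {F : L → ℂ → M → ℂ} {m₀ : M}
    (hF : ∀ l, ∀ z ∈ U l, SmoothOn 𝕜 E (F l z) (chartAt E m₀).source) {x : E}
    (hx : x ∈ (chartAt E m₀).target) :
    finrank ℂ (spanDifferentials 𝕜 E U F ((chartAt E m₀).symm x)) =
      finrank ℂ (Submodule.span ℂ {u | ∃ l, ∃ z ∈ U l,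
        u = fderiv 𝕜 (F l z ∘ (chartAt E m₀).symm) x}) := by
  obtain ⟨f, hf, -⟩ := exists_covector_equiv (𝕜 := 𝕜) ℂ ℂ m₀ ((chartAt E m₀).map_target hx)
  have h1 : spanDifferentials 𝕜 E U F ((chartAt E m₀).symm x) =
      (Submodule.span ℂ {u | ∃ l, ∃ z ∈ U l,
        u = fderiv 𝕜 (F l z ∘ (chartAt E m₀).symm) x}).map (f : _ →ₗ[ℂ] _) := by
    rw [Submodule.map_span, spanDifferentials]
    congr 1
    ext u
    constructor
    · rintro ⟨l, z, hz, rfl⟩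
      refine ⟨_, ⟨l, z, hz, rfl⟩, ?_⟩
      rw [differential_eq_fderiv_comp_chart_symm (hF l z hz) hx]
      exact hf _
    · rintro ⟨_, ⟨l, z, hz, rfl⟩, rfl⟩
      refine ⟨l, z, hz, ?_⟩
      rw [differential_eq_fderiv_comp_chart_symm (hF l z hz) hx]
      exact hf _
  rw [h1]
  exact f.finrank_map_eq _

variable [FiniteDimensional 𝕜 E]

/-- Finitely many differentials with fixed parameters form a basis of the span at x and stay
independent nearby; no joint continuity in point and parameter is needed. -/
theorem isOpen_le_finrank_spanDifferentials {L : Type*} (U : L → Set ℂ) {F : L → ℂ → M → ℂ}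
    {m₀ : M} (hF : ∀ l, ∀ z ∈ U l, SmoothOn 𝕜 E (F l z) (chartAt E m₀).source) (n : ℕ) :
    IsOpen {x | x ∈ (chartAt E m₀).target ∧ n ≤ finrank ℂ (Submodule.span ℂ {u | ∃ l, ∃ z ∈ U l,
      u = fderiv 𝕜 (F l z ∘ (chartAt E m₀).symm) x})} := by
  have : FiniteDimensional ℂ (E →L[𝕜] ℂ) :=
    (exists_complexCovectorBasis (finBasis 𝕜 E)).choose.finiteDimensional_of_finite
  rw [isOpen_iff_mem_nhds]
  rintro x ⟨hx, hn⟩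
  obtain ⟨u, hu, -, hli⟩ := Submodule.exists_fun_fin_finrank_span_eq ℂ {u | ∃ l, ∃ z ∈ U l,
      u = fderiv 𝕜 (F l z ∘ (chartAt E m₀).symm) x}
  choose l z hz hlz using hu
  have hc : ∀ i, ContinuousOn (fderiv 𝕜 (F (l i) (z i) ∘ (chartAt E m₀).symm))
      (chartAt E m₀).target := fun i =>
    (contDiffOn_comp_chart_symm (hF _ _ (hz i))).continuousOn_fderiv_of_isOpen
      (chartAt E m₀).open_target (by simp)
  have hc' : ContinuousOn (fun y i => fderiv 𝕜 (F (l i) (z i) ∘ (chartAt E m₀).symm) y)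
      (chartAt E m₀).target := continuousOn_pi.mpr hc
  have hli' : LinearIndependent ℂ fun i => fderiv 𝕜 (F (l i) (z i) ∘ (chartAt E m₀).symm) x := by
    have : u = fun i => fderiv 𝕜 (F (l i) (z i) ∘ (chartAt E m₀).symm) x := funext hlz
    rwa [← this]
  have hT := (chartAt E m₀).open_target.mem_nhds hx
  filter_upwards [hT, (hc'.continuousAt hT).eventually
    (isOpen_setOfPred_linearIndependent.mem_nhds hli')] with y hy hyl
  refine ⟨hy, hn.trans ?_⟩
  have h1 := finrank_span_eq_card hyl
  rw [Fintype.card_fin] at h1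
  rw [← h1]
  refine Submodule.finrank_mono (Submodule.span_mono ?_)
  rintro _ ⟨i, rfl⟩
  exact ⟨l i, z i, hz i, rfl⟩

theorem casimir_fderiv_comp_chart_symm {P₁ P₂ : TensorField 𝕜 E M} {z : ℂ} {F : M → ℂ}
    (hF : IsCasimirOn P₁ P₂ z 1 F Set.univ) {m₀ : M} {x : E} (hx : x ∈ (chartAt E m₀).target)
    (β : E →L[𝕜] 𝕜) :
    z * fderiv 𝕜 (F ∘ (chartAt E m₀).symm) x (chartField P₁ m₀ x β) +
      fderiv 𝕜 (F ∘ (chartAt E m₀).symm) x (chartField P₂ m₀ x β) = 0 := by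
  have hm := (chartAt E m₀).map_target hx
  have hFs : SmoothOn 𝕜 E F (chartAt E m₀).source := hF.1.mono (Set.subset_univ _)
  have hβ : SmoothOn 𝕜 E (β ∘ chartAt E m₀) (chartAt E m₀).source := by
    have := smoothOn_comp_chart m₀ (V := Set.univ) β.contDiff.contDiffOn
    rwa [Set.preimage_univ, Set.inter_univ] at this
  have h1 := hF.2 _ (chartAt E m₀).open_source (Set.subset_univ _) _ hβ _ hm
  have hd : differential 𝕜 E (β ∘ chartAt E m₀) ((chartAt E m₀).symm x) =
      β ∘L differential 𝕜 E (chartAt E m₀) ((chartAt E m₀).symm x) := by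
    rw [differential_comp_chart m₀ hm β.differentiableAt, β.fderiv]
  rw [bracket, bracket, differential_eq_fderiv_comp_chart_symm hFs hx, hd, one_mul] at h1
  exact h1

end Final

end Auxiliary

/-! ### Proof of the theorem -/

theorem mainTheorem8
    -- `𝕜` is `ℝ` (smooth manifolds) or `ℂ` (complex manifolds); `dim M = finrank 𝕜 E`
    {𝕜 : Type*} [RCLike 𝕜] [NormedAlgebra 𝕜 ℂ]
    {E : Type*} [NormedAddCommGroup E] [NormedSpace 𝕜 E] [FiniteDimensional 𝕜 E]
    {M : Type*} [TopologicalSpace M] [ChartedSpace E M]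
    [IsManifold (modelWithCornersSelf 𝕜 E) ((⊤ : ℕ∞) : WithTop ℕ∞) M]
    (P₁ P₂ : Bihamiltonian.TensorField 𝕜 E M) (hP : Bihamiltonian.IsBihamiltonian P₁ P₂)
    {L : Type*} [Finite L] (U : L → Set ℂ)
    (hU : ∀ l, IsOpen (U l) ∨ ∃ V : Set ℝ, IsOpen V ∧ U l = (fun x : ℝ => (x : ℂ)) '' V)
    (F : L → ℂ → M → ℂ)
    (hF : ∀ l, ∀ z ∈ U l, Bihamiltonian.IsCasimirOn P₁ P₂ z 1 (F l z) Set.univ)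
    (hFcont : ∀ l m,
      ContinuousOn (fun z => Bihamiltonian.differential 𝕜 E (F l z) m) (U l))
    (R : ℕ) (m₀ : M)
    (hdim : Module.finrank 𝕜 E + R
      ≤ 2 * Module.finrank ℂ (Bihamiltonian.spanDifferentials 𝕜 E U F m₀))
    (hCas : ∃ a b : 𝕜, Bihamiltonian.AtMostIndependentCasimirsNear P₁ P₂
      (algebraMap 𝕜 ℂ a) (algebraMap 𝕜 ℂ b) R m₀) :
    Even ((Module.finrank 𝕜 E : ℤ) - (R : ℤ)) ∧
    2 * Module.finrank ℂ (Bihamiltonian.spanDifferentials 𝕜 E U F m₀)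
      = Module.finrank 𝕜 E + R ∧
    ∃ t : Fin R → ℕ, (∀ k, 0 < t k) ∧ ∑ k, t k = Module.finrank 𝕜 E ∧
      ∃ Ω : Set M, IsOpen Ω ∧ m₀ ∈ closure Ω ∧
        Bihamiltonian.IsHomogeneousOn P₁ P₂ t Ω ∧
        ∀ m ∈ Ω, Bihamiltonian.IsKroneckerSum
          (Bihamiltonian.pairing P₁ m) (Bihamiltonian.pairing P₂ m) t := by
  obtain ⟨a, b, N, hN, hm₀N, hCas⟩ := hCas
  have hFs : ∀ l, ∀ z ∈ U l, Bihamiltonian.SmoothOn 𝕜 E (F l z) (chartAt E m₀).source :=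
    fun l z hz => (hF l z hz).1.mono (Set.subset_univ _)
  have hx₀ : chartAt E m₀ m₀ ∈ (chartAt E m₀).target :=
    (chartAt E m₀).map_source (mem_chart_source E m₀)
  have hinv : (chartAt E m₀).symm (chartAt E m₀ m₀) = m₀ :=
    (chartAt E m₀).left_inv (mem_chart_source E m₀)
  let W : E → Submodule ℂ (E →L[𝕜] ℂ) := fun x => Submodule.span ℂ
    {u | ∃ l, ∃ z ∈ U l, u = fderiv 𝕜 (F l z ∘ (chartAt E m₀).symm) x}
  have hW₀ : Module.finrank ℂ (Bihamiltonian.spanDifferentials 𝕜 E U F m₀) =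
      Module.finrank ℂ (W (chartAt E m₀ m₀)) := by
    have h := finrank_spanDifferentials_chart U hFs hx₀
    rwa [hinv] at h
  -- The part of the chart where the dimension bound of condition 1 persists and condition 2
  -- applies.
  let O : Set E := {x | x ∈ (chartAt E m₀).target ∧
    Module.finrank ℂ (W (chartAt E m₀ m₀)) ≤ Module.finrank ℂ (W x)} ∩
      ((chartAt E m₀).target ∩ (chartAt E m₀).symm ⁻¹' N)
  have hO : IsOpen O := (isOpen_le_finrank_spanDifferentials U hFs _).inter
    ((chartAt E m₀).isOpen_inter_preimage_symm hN)
  have hxO : chartAt E m₀ m₀ ∈ O := ⟨⟨hx₀, le_rfl⟩, hx₀, by rwa [Set.mem_preimage, hinv]⟩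
  have hpoint : ∀ x ∈ O, (∀ᶠ y in nhds x, Module.finrank 𝕜 (LinearMap.range
      (a • chartField P₁ m₀ y + b • chartField P₂ m₀ y).toLinearMap) = Module.finrank 𝕜
        (LinearMap.range (a • chartField P₁ m₀ x + b • chartField P₂ m₀ x).toLinearMap)) →
      2 * Module.finrank ℂ (W x) = Module.finrank 𝕜 E + R ∧ ∃ d : Fin R → ℕ,
        Bihamiltonian.IsKroneckerSum (dualForm (chartField P₁ m₀ x))
          (dualForm (chartField P₂ m₀ x)) fun k => 2 * d k + 1 := by
    intro x hx hconst
    have hker := finrank_ker_le_of_casimirs hP hN hCas m₀ hx.1.1 hx.2.2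
      (hconst.mono fun y hy => by rwa [chartField_combination, chartField_combination])
    rw [chartField_combination] at hker
    refine exists_isKroneckerSum_of_span (chartField_skew hP.1 m₀ x)
      (chartField_skew hP.2.1 m₀ x) (fun l s hs => subset_closure_diff_finite (hU l) hs)
      (fun l => ?_) (fun l z hz => casimir_fderiv_comp_chart_symm (hF l z hz) hx.1.1) hker ?_
    · obtain ⟨f, hf, hfc⟩ := exists_covector_equiv (𝕜 := 𝕜) 𝕜 ℂ m₀
        ((chartAt E m₀).map_target hx.1.1)
      refine (hfc.comp_continuousOn (hFcont l ((chartAt E m₀).symm x))).congr fun z hz => ?_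
      rw [Function.comp_apply, f.eq_symm_apply, hf,
        differential_eq_fderiv_comp_chart_symm (hFs l z hz) hx.1.1]
    · have h := hx.1.2
      rw [hW₀] at hdim
      exact hdim.trans (Nat.mul_le_mul_left 2 h)
  have hopen := hO.isOpenEmbedding_subtypeVal
  have hQc : ∀ {P : Bihamiltonian.TensorField 𝕜 E M}, Bihamiltonian.IsPoisson P →
      Continuous fun x : O => chartField P m₀ x := fun h =>
    ((contDiffOn_chartField h m₀).continuousOn.mono fun x hx => hx.1.1).domRestrict
  obtain ⟨d, D, hD, hcl, hDx⟩ := exists_isKroneckerSum_constant_type (R := R) (a := a) (b := b)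
    (hQc hP.1) (hQc hP.2.1) (fun x => chartField_skew hP.1 m₀ x)
    (fun x => chartField_skew hP.2.1 m₀ x)
    (fun x hx => (hpoint x x.2 (by rwa [← hopen.map_nhds_eq, Filter.eventually_map])).2)
    ⟨chartAt E m₀ m₀, hxO⟩
  obtain ⟨x, hxD⟩ := closure_nonempty_iff.mp ⟨_, hcl⟩
  have hx := hDx x hxD
  have hdimx := (hpoint x x.2 (by rw [← hopen.map_nhds_eq, Filter.eventually_map]; exact hx.1)).1
  have hle : Module.finrank ℂ (W (chartAt E m₀ m₀)) ≤ Module.finrank ℂ (W x) := x.2.1.2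
  -- At x the equality is exact and dim W at m₀ is at most dim W at x, so condition 1 leaves only
  -- equality at m₀.
  have heq : 2 * Module.finrank ℂ (Bihamiltonian.spanDifferentials 𝕜 E U F m₀) =
      Module.finrank 𝕜 E + R := by
    omega
  have hsum : ∑ k, (2 * d k + 1) = Module.finrank 𝕜 E := by
    obtain ⟨-, e, -⟩ := hx.2
    have h1 := Module.finrank_eq_card_basis e
    rw [Fintype.card_sigma, Module.finrank_eq_card_basis
      (covectorBasis (Module.finBasis 𝕜 E)), Fintype.card_fin] at h1
    simpa using h1.symm
  have hDO : Subtype.val '' D ⊆ (chartAt E m₀).target := by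
    rintro _ ⟨y, -, rfl⟩
    exact y.2.1.1
  have hkron : ∀ m ∈ (chartAt E m₀).symm '' (Subtype.val '' D), Bihamiltonian.IsKroneckerSum
      (Bihamiltonian.pairing P₁ m) (Bihamiltonian.pairing P₂ m) fun k => 2 * d k + 1 := by
    rintro _ ⟨_, ⟨y, hy, rfl⟩, rfl⟩
    exact isKroneckerSum_pairing y.2.1.1 (hDx y hy).2
  -- With w = dim W₁(m₀), 2 w = dim M + R gives dim M - R = (w - R) + (w - R).
  refine ⟨⟨Module.finrank ℂ (Bihamiltonian.spanDifferentials 𝕜 E U F m₀) - R, by omega⟩, heq,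
    fun k => 2 * d k + 1, fun k => Nat.succ_pos _, hsum,
    (chartAt E m₀).symm '' (Subtype.val '' D),
    (chartAt E m₀).isOpen_image_symm_of_subset_target (hopen.isOpenMap D hD) hDO, ?_,
    fun m hm => decomposesWithType_of_isKroneckerSum (hP.1.skew m) (hP.2.1.skew m) (hkron m hm),
    hkron⟩
  have h1 : chartAt E m₀ m₀ ∈ closure (Subtype.val '' D) := closure_subtype.mp hcl
  have h2 := mem_closure_image ((chartAt E m₀).continuousAt_symm hx₀) h1
  rwa [hinv] at h2
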